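/- **Theorem (sliding-window robust $\ell_0$-sampling).** Fix a dimension $d\ge 1$. There is a randomized sliding window algorithm, the same for sequence-based and for time-based windows, with the following properties. Let $\alpha>0$, $m\ge 2$, $w\ge 2$, and let $p_1,\dots,p_m\in[0,M]^d$ be a stream of points, at most one arriving per time step, that is well-separated: for some $\beta>2\alpha$ any two of its points are at Euclidean distance $\le\alpha$ or $>\beta$. The window at time $t$ consists of the last $w$ points received by time $t$ (sequence-based), or of the points received in the time steps $t-w+1,\dots,t$ (time-based); its groups are the classes of its points under "distance $\le\alpha$" (the natural partition). The algorithm is given $m$, $w$ and the number of grid cells per side. 1. All updates and queries halt. 2. With probability at least $1-1/m$ all of the following hold: at every time step at which the window is nonempty, the algorithm outputs a point of the window (it does not report an error); it uses $O(\log w\,\log m)$ words of space throughout; and for every $k$ the first $k$ points are processed in $O(k\log w\,\log m)$ steps, i.e. the amortized processing time per point is $O(\log w\,\log m)$. 3. At every time step at which the window is nonempty, the output, given that there is one, is a robust $\ell_0$-sample of the window: if the window has $n$ groups, then the output lies in each of them with probability exactly $1/n$. The constants in $O(\cdot)$ depend only on $d$. The machine is a word RAM with words of $\Theta(\log(m+w+\Delta+T))$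 bits, where $\Delta=\lfloor dM/\alpha\rfloor+1$ is the number of cells per side of the grid of side length $\alpha/d$ on $[0,M]^d$ and $T$ is the last value of the clock. A stored input point takes $d$ words and can be copied, tested for distance at most $\alpha$ from another stored point, located in the grid, and tested for distance at most $\alpha$ from a given cell, each in one step. A fully random hash function from words to words, and uniform random choices from $\{0,\dots,k-1\}$, are available at unit cost. -/

import Mathlib

open MeasureTheory

noncomputable section

namespace SlidingSample

/-- Points of the `d`-dimensional Euclidean space. -/
abbrev Pt (d : ℕ) : Type := EuclideanSpace ℝ (Fin d)

/-! ### Datasets with near-duplicates -/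

/-- `(α, β)`-sparse datasets. -/
def Sparse {d : ℕ} (α β : ℝ) (S : Set (Pt d)) : Prop :=
  ∀ u ∈ S, ∀ v ∈ S, dist u v ≤ α ∨ β < dist u v

/-- The separation ratio `sup β / α` is larger than `2`. -/
def WellSeparated {d : ℕ} (α : ℝ) (S : Set (Pt d)) : Prop :=
  ∃ β : ℝ, 2 < β / α ∧ Sparse α β S

/-- The group of `p` in the dataset `S`. -/
def group {d : ℕ} (α : ℝ) (S : Set (Pt d)) (p : Pt d) : Set (Pt d) :=
  {q | q ∈ S ∧ dist p q ≤ α}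

/-- The groups of `S`; for a well-separated `S` this is the natural partition
(see `naturalPartition_spec`). -/
def naturalPartition {d : ℕ} (α : ℝ) (S : Set (Pt d)) : Set (Set (Pt d)) :=
  group α S '' S

/-- The groups of a well-separated dataset are nonempty, every point of the dataset lies in exactly
one of them, two points of one group are at distance at most `α`, and points of two different groups
are at distance more than `2 α`. -/
theorem naturalPartition_spec {d : ℕ} {α : ℝ} (hα : 0 < α) {S : Set (Pt d)}
    (hS : WellSeparated α S) :
    (∀ G ∈ naturalPartition α S, G.Nonempty ∧ G ⊆ S) ∧
    (∀ p ∈ S, ∃! G, G ∈ naturalPartition α S ∧ p ∈ G) ∧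
    (∀ G ∈ naturalPartition α S, ∀ p ∈ G, ∀ q ∈ G, dist p q ≤ α) ∧
    (∀ G ∈ naturalPartition α S, ∀ H ∈ naturalPartition α S, G ≠ H →
      ∀ p ∈ G, ∀ q ∈ H, 2 * α < dist p q) := by
  obtain ⟨β, hβ, hsp⟩ := hS
  rw [lt_div_iff₀ hα] at hβ
  have tr : ∀ p ∈ S, ∀ q ∈ S, ∀ r ∈ S, dist p q ≤ α → dist q r ≤ α → dist p r ≤ α := by
    intro p hp q _ r hr h1 h2
    rcases hsp p hp r hr with h | h
    · exact h
    · have := dist_triangle p q r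
      linarith
  have key : ∀ u ∈ S, ∀ v ∈ S, dist u v ≤ α → group α S u = group α S v := by
    intro u hu v hv h
    ext x
    constructor
    · rintro ⟨hx, h'⟩
      exact ⟨hx, tr v hv u hu x hx (by rwa [dist_comm]) h'⟩
    · rintro ⟨hx, h'⟩
      exact ⟨hx, tr u hu v hv x hx h h'⟩
  refine ⟨?_, ?_, ?_, ?_⟩
  · rintro _ ⟨u, hu, rfl⟩
    exact ⟨⟨u, hu, by simpa using hα.le⟩, fun x hx => hx.1⟩
  · intro p hp
    refine ⟨group α S p, ⟨⟨p, hp, rfl⟩, hp, by simpa using hα.le⟩, ?_⟩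
    rintro _ ⟨⟨u, hu, rfl⟩, hpu⟩
    exact key u hu p hp hpu.2
  · rintro _ ⟨u, hu, rfl⟩ p hp q hq
    exact tr p hp.1 u hu q hq.1 (by rw [dist_comm]; exact hp.2) hq.2
  · rintro _ ⟨u, hu, rfl⟩ _ ⟨v, hv, rfl⟩ hne p hp q hq
    rcases hsp p hp.1 q hq.1 with h | h
    · exact absurd (((key u hu p hp.1 hp.2).trans (key p hp.1 q hq.1 h)).trans
        (key v hv q hq.1 hq.2).symm) hne
    · linarith

/-! ### Streams and sliding windows -/

/-- The two sliding window models. -/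
inductive WindowModel
  | sequenceBased
  | timeBased

/-- A stream of `m` points `p i`, arriving at the time steps `τ i`, observed up to time `T`, with
window length `w` and distance threshold `α`; the coordinates lie in `[0, M]`. -/
structure Stream (d : ℕ) where
  m : ℕ
  w : ℕ
  T : ℕ
  α : ℝ
  M : ℝ
  p : Fin m → Pt d
  τ : Fin m → ℕ

namespace Stream

variable {d : ℕ}

/-- The standing assumptions on a stream; at most one point arrives in a time step. -/
structure Admissible (I : Stream d) : Prop where
  two_le_m : 2 ≤ I.m
  two_le_w : 2 ≤ I.w
  α_pos : 0 < I.α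
  wellSeparated : WellSeparated I.α (Set.range I.p)
  coord_mem : ∀ i j, I.p i j ∈ Set.Icc 0 I.M
  strictMono : StrictMono I.τ
  le_T : ∀ i, I.τ i ≤ I.T

/-- The number of points received by time `t`. -/
def received (I : Stream d) (t : ℕ) : ℕ :=
  (Finset.univ.filter fun i => I.τ i ≤ t).card

/-- The time stamp of a point: its position in the stream (counted from `1`) or its arrival time. -/
def stamp (I : Stream d) : WindowModel → Fin I.m → ℕ
  | .sequenceBased, i => i + 1
  | .timeBased, i => I.τ i

/-- The clock at time `t`: the position of the latest point received, or the time itself. -/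
def clock (I : Stream d) : WindowModel → ℕ → ℕ
  | .sequenceBased, t => I.received t
  | .timeBased, t => t

/-- The set of points in the window at time `t`: the last `w` points received by time `t`
(sequence-based), or the points received in the time steps `t - w + 1, …, t` (time-based). -/
def window (I : Stream d) (mode : WindowModel) (t : ℕ) : Set (Pt d) :=
  {x | ∃ i, I.p i = x ∧ I.τ i ≤ t ∧ I.clock mode t < I.stamp mode i + I.w}

/-- The grid has side length `α / d`; this is the number of cells along a side of `[0, M] ^ d`. -/
def gridSize (I : Stream d) : ℕ := ⌊d * I.M / I.α⌋₊ + 1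

/-- The length in bits of a machine word, `c ⌈log₂ (m + w + Δ + t)⌉`, where `Δ` is the number of
cells along a side of the grid and `t` the last value of the clock. -/
def wordBits (I : Stream d) (mode : WindowModel) (c : ℕ) : ℕ :=
  c * Nat.clog 2 (I.m + I.w + I.gridSize + I.clock mode I.T)

end Stream

/-! ### The grid -/

/-- The cell with integer coordinates `k` in the grid of side length `α / d`. -/
def gridCell {d : ℕ} (α : ℝ) (k : Fin d → ℕ) : Set (Pt d) :=
  {x | ∀ i, k i * (α / d) ≤ x i ∧ x i < (k i + 1) * (α / d)}

/-- The integer coordinates of the cell that contains `x`, for `x` with nonnegative coordinates. -/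
def cellCoord {d : ℕ} (α : ℝ) (x : Pt d) (i : Fin d) : ℕ := ⌊x i * d / α⌋₊

/-- The cells at distance at most `α` from `x`. -/
def adj {d : ℕ} (α : ℝ) (x : Pt d) : Set (Fin d → ℕ) :=
  {k | Metric.infDist x (gridCell α k) ≤ α}

/-! ### The machine

A random access machine with two memories, one for words of `b` bits and one for input points. Words
can be used freely; points are opaque: they can be stored and copied, compared with one another
(distance at most `α` or not), and located in the grid. Besides it has a random function from words
to words and a source of random numbers. -/

/-- What a run of the machine depends on besides the contents of the memory. -/
structure Env (d : ℕ) where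
  bits : ℕ
  α : ℝ
  /-- the hash function; it is only used on words -/
  hash : ℕ → ℕ
  /-- a sequence of random reals in `[0, 1]` -/
  coin : ℕ → ℝ

/-- Word expressions. -/
inductive Expr (d : ℕ)
  /-- a constant -/
  | lit (n : ℕ)
  /-- the content of a word of the memory, at the address that is computed -/
  | word (a : Expr d)
  | add (a b : Expr d)
  | sub (a b : Expr d)
  | mul (a b : Expr d)
  | div (a b : Expr d)
  | mod (a b : Expr d)
  /-- `1` if `a < b` and `0` otherwise -/
  | lt (a b : Expr d)
  /-- the hash value of a word -/
  | hash (a : Expr d)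
  /-- coordinate `i` of the cell of the point at address `a` -/
  | cell (a : Expr d) (i : Fin d)
  /-- `1` if the points at the addresses `a` and `b` are at distance at most `α`, else `0` -/
  | near (a b : Expr d)
  /-- `1` if the cell whose coordinates are the `d` words from address `b` on is at distance at most
  `α` from the point at address `a`, else `0` -/
  | adj (a b : Expr d)

/-- The number of operations in the evaluation of an expression. -/
def Expr.cost {d : ℕ} : Expr d → ℕ
  | .lit _ => 1
  | .word a => a.cost + 1
  | .add a b => a.cost + b.cost + 1
  | .sub a b => a.cost + b.cost + 1
  | .mul a b => a.cost + b.cost + 1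
  | .div a b => a.cost + b.cost + 1
  | .mod a b => a.cost + b.cost + 1
  | .lt a b => a.cost + b.cost + 1
  | .hash a => a.cost + 1
  | .cell a _ => a.cost + 1
  | .near a b => a.cost + b.cost + 1
  | .adj a b => a.cost + b.cost + 1

/-- The state of the machine. The last four fields only keep the accounts: the words and the points
of the memory up to the last one that was ever written, the steps made, the random numbers drawn. -/
structure State (d : ℕ) where
  word : ℕ → ℕ
  point : ℕ → Option (Pt d)
  wordsUsed : ℕ
  pointsUsed : ℕ
  steps : ℕ
  drawn : ℕ

open Classical in
/-- The value of an expression; all arithmetic is modulo `2 ^ bits` (`sub` is truncated at `0`). -/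
def Expr.eval {d : ℕ} (E : Env d) (s : State d) : Expr d → ℕ
  | .lit n => n % 2 ^ E.bits
  | .word a => s.word (a.eval E s)
  | .add a b => (a.eval E s + b.eval E s) % 2 ^ E.bits
  | .sub a b => a.eval E s - b.eval E s
  | .mul a b => (a.eval E s * b.eval E s) % 2 ^ E.bits
  | .div a b => a.eval E s / b.eval E s
  | .mod a b => a.eval E s % b.eval E s
  | .lt a b => (if a.eval E s < b.eval E s then 1 else 0) % 2 ^ E.bits
  | .hash a => E.hash (a.eval E s)
  | .cell a i => match s.point (a.eval E s) with
    | some x => cellCoord E.α x i % 2 ^ E.bits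
    | none => 0
  | .near a b => match s.point (a.eval E s), s.point (b.eval E s) with
    | some x, some y => (if dist x y ≤ E.α then 1 else 0) % 2 ^ E.bits
    | _, _ => 0
  | .adj a b => match s.point (a.eval E s) with
    | some x => (if (fun i : Fin d => s.word (b.eval E s + i)) ∈ SlidingSample.adj E.α x then 1
        else 0) % 2 ^ E.bits
    | none => 0

namespace State

variable {d : ℕ}

/-- Account for `n` steps. -/
def tick (s : State d) (n : ℕ) : State d := { s with steps := s.steps + n }

/-- Write a word. -/
def setWord (s : State d) (a v : ℕ) : State d :=
  { s with word := Function.update s.word a v, wordsUsed := max s.wordsUsed (a + 1) }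

/-- Write a point (or erase it). -/
def setPoint (s : State d) (a : ℕ) (x : Option (Pt d)) : State d :=
  { s with point := Function.update s.point a x, pointsUsed := max s.pointsUsed (a + 1) }

/-- Account for a random number. -/
def draw (s : State d) : State d := { s with drawn := s.drawn + 1 }

/-- The memory used so far, in words; a point takes `d` words. -/
def space (s : State d) : ℕ := s.wordsUsed + d * s.pointsUsed

end State

/-- Programs. -/
inductive Prog (d : ℕ)
  | skip
  /-- write the value of `v` to the word at address `a` -/
  | setWord (a v : Expr d)
  /-- copy the point at address `b` to address `a` -/
  | copyPoint (a b : Expr d)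
  /-- write a uniformly random element of `{0, …, k - 1}` to the word at address `a` -/
  | random (a k : Expr d)
  | seq (P Q : Prog d)
  | ite (e : Expr d) (P Q : Prog d)
  | while (e : Expr d) (P : Prog d)

/-- `Exec E P s s'`: the program `P`, started in the state `s`, halts in the state `s'`. -/
inductive Exec {d : ℕ} (E : Env d) : Prog d → State d → State d → Prop
  | skip (s : State d) : Exec E .skip s (s.tick 1)
  | setWord (a v : Expr d) (s : State d) :
      Exec E (.setWord a v) s ((s.setWord (a.eval E s) (v.eval E s)).tick (a.cost + v.cost + 1))
  | copyPoint (a b : Expr d) (s : State d) :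
      Exec E (.copyPoint a b) s
        ((s.setPoint (a.eval E s) (s.point (b.eval E s))).tick (a.cost + b.cost + 1))
  | random (a k : Expr d) (s : State d) :
      Exec E (.random a k) s
        ((s.setWord (a.eval E s)
            (min ⌊k.eval E s * E.coin s.drawn⌋₊ (k.eval E s - 1))).draw.tick (a.cost + k.cost + 1))
  | seq {P Q : Prog d} {s s₁ s₂ : State d} :
      Exec E P s s₁ → Exec E Q s₁ s₂ → Exec E (.seq P Q) s s₂
  | ite_true {e : Expr d} {P Q : Prog d} {s s' : State d} :
      e.eval E s ≠ 0 → Exec E P (s.tick (e.cost + 1)) s' → Exec E (.ite e P Q) s s'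
  | ite_false {e : Expr d} {P Q : Prog d} {s s' : State d} :
      e.eval E s = 0 → Exec E Q (s.tick (e.cost + 1)) s' → Exec E (.ite e P Q) s s'
  | while_true {e : Expr d} {P : Prog d} {s s₁ s₂ : State d} :
      e.eval E s ≠ 0 → Exec E P (s.tick (e.cost + 1)) s₁ → Exec E (.while e P) s₁ s₂ →
        Exec E (.while e P) s s₂
  | while_false {e : Expr d} {P : Prog d} {s : State d} :
      e.eval E s = 0 → Exec E (.while e P) s (s.tick (e.cost + 1))

/-! ### Sliding window algorithms -/

/-- A sliding window algorithm: a program that is run on every arriving point, and a program that is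
run when a sample is asked for. -/
structure Algorithm (d : ℕ) where
  update : Prog d
  query : Prog d

/-- The random choices, for words of `b` bits: a function from words to words, one sequence of random
numbers (number `0`) for the processing of the stream, and one (number `t + 1`) for the query at
time `t`. -/
abbrev Randomness (b : ℕ) : Type := (Fin (2 ^ b) → Fin (2 ^ b)) × (ℕ × ℕ → unitInterval)

/-- The hash function is fully random, and the random numbers are independent of it, independent of
one another, and uniform. -/
def randomness (b : ℕ) : Measure (Randomness b) :=
  (PMF.uniformOfFintype (Fin (2 ^ b) → Fin (2 ^ b))).toMeasure.prod
    (Measure.infinitePi fun _ : ℕ × ℕ => (volume : Measure unitInterval))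

/-- The machine with words of `b` bits, with the random choices `ω` and sequence number `j` of random
numbers. -/
def env {d : ℕ} (I : Stream d) (b : ℕ) (ω : Randomness b) (j : ℕ) : Env d where
  bits := b
  α := I.α
  hash x := ω.1 ⟨x % 2 ^ b, Nat.mod_lt _ (by positivity)⟩
  coin n := ω.2 (j, n)

/-- The initial state: the words `1, 2, 3, 4` hold `m`, `w`, the number of cells along a side of the
grid, and the word length. -/
def initial {d : ℕ} (I : Stream d) (b : ℕ) : State d where
  word a := if a = 1 then I.m else if a = 2 then I.w else if a = 3 then I.gridSize
    else if a = 4 then b else 0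
  point _ := none
  wordsUsed := 5
  pointsUsed := 1
  steps := 0
  drawn := 0

/-- `s` is the state after the first `k` points. An arriving point is put into the first place of the
point memory, and its time stamp into the first place of the word memory. -/
def Reaches {d : ℕ} (A : Algorithm d) (I : Stream d) (mode : WindowModel) (b : ℕ)
    (ω : Randomness b) : ℕ → State d → Prop
  | 0, s => s = initial I b
  | k + 1, s => ∃ s₀, Reaches A I mode b ω k s₀ ∧ ∃ h : k < I.m,
      Exec (env I b ω 0) A.update
        ((s₀.setWord 0 (I.stamp mode ⟨k, h⟩)).setPoint 0 (some (I.p ⟨k, h⟩))) s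

/-- `s` is the state at the end of the query at time `t`. The query is run on a copy of the memory,
with the clock in the first place of the word memory. -/
def Answers {d : ℕ} (A : Algorithm d) (I : Stream d) (mode : WindowModel) (b : ℕ)
    (ω : Randomness b) (t : ℕ) (s : State d) : Prop :=
  ∃ s₀, Reaches A I mode b ω (I.received t) s₀ ∧
    Exec (env I b ω (t + 1)) A.query { s₀.setWord 0 (I.clock mode t) with drawn := 0 } s

/-- The query at time `t` outputs the point `u`: it ends with a nonzero word in the first place of the
word memory, and with `u` in the first place of the point memory. It reports an error if that word is
zero. -/
def Outputs {d : ℕ} (A : Algorithm d) (I : Stream d) (mode : WindowModel) (b : ℕ)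
    (ω : Randomness b) (t : ℕ) (u : Pt d) : Prop :=
  ∃ s, Answers A I mode b ω t s ∧ s.word 0 ≠ 0 ∧ s.point 0 = some u

/-- All updates and queries halt. -/
def Halts {d : ℕ} (A : Algorithm d) (I : Stream d) (mode : WindowModel) (b : ℕ)
    (ω : Randomness b) : Prop :=
  (∀ k ≤ I.m, ∃ s, Reaches A I mode b ω k s) ∧ ∀ t ≤ I.T, ∃ s, Answers A I mode b ω t s

/-- At every time step with a nonempty window a point of the window is output. -/
def AlwaysOutputs {d : ℕ} (A : Algorithm d) (I : Stream d) (mode : WindowModel) (b : ℕ)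
    (ω : Randomness b) : Prop :=
  ∀ t ≤ I.T, (I.window mode t).Nonempty → ∃ u ∈ I.window mode t, Outputs A I mode b ω t u

/-- All updates and queries together use at most `B` words of memory, the updates at any time during
the stream as well as each query. -/
def SpaceAtMost {d : ℕ} (A : Algorithm d) (I : Stream d) (mode : WindowModel) (b : ℕ)
    (ω : Randomness b) (B : ℝ) : Prop :=
  (∀ k s, Reaches A I mode b ω k s → (s.space : ℝ) ≤ B) ∧
    ∀ t ≤ I.T, ∀ s, Answers A I mode b ω t s → (s.space : ℝ) ≤ B

/-- The amortized processing time per point is at most `B`: for every `k`, the first `k` points are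
processed in at most `k B` steps. -/
def AmortizedTimeAtMost {d : ℕ} (A : Algorithm d) (I : Stream d) (mode : WindowModel) (b : ℕ)
    (ω : Randomness b) (B : ℝ) : Prop :=
  ∀ k s, Reaches A I mode b ω k s → (s.steps : ℝ) ≤ k * B

/-- The output at time `t`, given that there is one, is a robust `ℓ₀`-sample of the window: it lies
in each of the `n` groups of the window with probability `1 / n`. -/
def UniformOutput {d : ℕ} (A : Algorithm d) (I : Stream d) (mode : WindowModel) (b : ℕ)
    (t : ℕ) : Prop :=
  ∀ G ∈ naturalPartition I.α (I.window mode t),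
    randomness b {ω | ∃ u ∈ G, Outputs A I mode b ω t u} =
      randomness b {ω | ∃ u, Outputs A I mode b ω t u} /
        ((naturalPartition I.α (I.window mode t)).ncard : ENNReal)

end SlidingSample

end

/-! ### Deterministic part: lists of groups that expire, and what follows from well-behaved samples.
-/

noncomputable section

namespace SlidingSample

/-! ### Lists of groups with their latest points -/

section Model

variable (near : ℕ → ℕ → Prop) (st : ℕ → ℕ)

/-! At level `l` (for `l` up to `⌈log₂ (min m w)⌉`) a grid cell is sampled with probability `2 ^
(-l)`: this means that `2 ^ l` divides the hash value of its key. A level stores, for certain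
groups, the latest point together with a flag saying whether the cell of the representative is
sampled. The representative is the first point of the group since the group last expired. Points in
one cell are at distance at most `α`, and cells of points at distance at most `α` differ by at most
`d` in each coordinate. So if no cell near the representative is sampled, then no point of the group
lies in a sampled cell, and the group can be forgotten (`touched_of_accepted`). Entries with flag
`0` are kept so that a later point in a sampled cell is not mistaken for a new representative.

Expiry is not governed by the window but by a cut. When a list has more than `K = O(log m)` entries,
its oldest entry and all stamps up to it expire. The level then describes exactly the points with
stamps from the cut on. A query goes to the lowest level whose cut does not exceed the start of the
window, and chooses uniformly among the entries there that lie in the window and have flag `1`.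

Since the level depends on the samples, one list per level would give a biased output. Therefore
each level has two lists. The first uses the even keys (tag `0`); it alone determines the cuts,
hence the representatives and the level of the query. The second uses the odd keys (tag `1`), obeys
the cuts of the first, and is the one chosen from. Exchanging the hash values at the odd keys of the
representatives of two groups in the window leaves all even data fixed. This is an involution of the
finite set of hash functions that exchanges the two groups in the pool and preserves its size
(`exists_swap`). Hence all groups of the window are output with exactly the same probability
(`sampler_uniformOutput`), with no concentration bound involved.

Space, time and the presence of an output rest on four events for each level and each index range
(`GoodSample`). Many groups have many accepted last points, so the first list cannot reach back over
too many groups. Few groups have fewer than `K` touched ones, so a cut inside the window certifies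
that the window has many groups. The second list is short. A window with many groups has an accepted
representative. The failures are bounded by exponential moments (`card_few_le`, `card_many_le`) and,
for the representatives, by conditioning on the even values (`card_none_le`); `card_bad` is the
union bound, and `listsAtMost` and `queryPool_spec` are the consequences.

On the machine the lists are interleaved with a stride equal to their number, so none needs a length
fixed in advance. The program therefore computes the lists faithfully for every hash function
(`reaches_sampler`, `answers_sampler`), with the trivial length bound `m`. Halting and uniformity
use this; the good event only sharpens the length bound. -/

open Classical in
/-- The entries that stay untouched when point `i` arrives and stamps below `cut` expire. -/
def keepList (cut i : ℕ) (l : List (ℕ × ℕ)) : List (ℕ × ℕ) :=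
  l.filter fun e => decide (cut ≤ st e.1 ∧ ¬ near i e.1)

open Classical in
/-- The flag of the group of point `i`: the one that is stored, or else `f`. -/
def groupFlag (cut i : ℕ) (f : ℕ) (l : List (ℕ × ℕ)) : ℕ :=
  l.foldl (fun f e => if cut ≤ st e.1 ∧ near i e.1 then e.2 else f) f

/-- Process point `i`; a flag of at least `2` says that the group is not to be stored. -/
def refresh (cut i f : ℕ) (l : List (ℕ × ℕ)) : List (ℕ × ℕ) :=
  keepList near st cut i l ++
    if groupFlag near st cut i f l < 2 then [(i, groupFlag near st cut i f l)] else []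

/-- The list after `k` points, if stamps below `C i` expire when point `i` arrives. -/
def groupList (C f : ℕ → ℕ) : ℕ → List (ℕ × ℕ)
  | 0 => []
  | k + 1 => refresh near st (C k) k (f k) (groupList C f k)

/-- The oldest entry of a list of more than `K` entries expires. -/
def raiseCut (K cut : ℕ) (l : List (ℕ × ℕ)) : ℕ :=
  if K < l.length then st (l.headD (0, 0)).1 + 1 else cut

/-- The list that raises its cut after `k` points, and its cut. -/
def boundedList (K : ℕ) (f : ℕ → ℕ) : ℕ → List (ℕ × ℕ) × ℕ
  | 0 => ([], 0)
  | k + 1 =>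
    (refresh near st (raiseCut st K (boundedList K f k).2 (boundedList K f k).1) k (f k)
      (boundedList K f k).1, raiseCut st K (boundedList K f k).2 (boundedList K f k).1)

/-- The cut in force when point `k` is processed. -/
def cuts (K : ℕ) (f : ℕ → ℕ) (k : ℕ) : ℕ := (boundedList near st K f (k + 1)).2

/-- The list that raises its own cut is an ordinary `groupList` for the cuts it produces. Thus both
lists of a level obey one invariant, with the same cuts and the same representatives. -/
theorem boundedList_fst (K : ℕ) (f : ℕ → ℕ) (k : ℕ) :
    (boundedList near st K f k).1 = groupList near st (cuts near st K f) f k := by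
  induction k with
  | zero => rfl
  | succ k ih => rw [groupList, ← ih]; rfl

open Classical in
/-- The latest point before `i` in the group of `i`, if there is one. -/
def prevIndex (i : ℕ) : ℕ := Nat.findGreatest (fun j => j < i ∧ near i j) i

open Classical in
/-- The representative of the group of point `i` when `i` has been processed. -/
def rep (C : ℕ → ℕ) (i : ℕ) : ℕ :=
  if _h : prevIndex near i < i ∧ near i (prevIndex near i) ∧ C i ≤ st (prevIndex near i) then
    rep C (prevIndex near i)
  else i
termination_by i
decreasing_by exact _h.1

open Classical in
/-- The flag of a group with first point `i`. -/
def initFlag (acc nb : ℕ → Prop) (i : ℕ) : ℕ := if nb i then (if acc i then 1 else 0) else 2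

/-- `j` is the last point of its group among the first `k` points. -/
def IsLast (k j : ℕ) : Prop := j < k ∧ ∀ i, j < i → i < k → ¬ near j i

variable {near st}

theorem prevIndex_eq {i j : ℕ} (hj : IsLast near i j) (hn : near i j)
    (hnear : Equivalence near) : prevIndex near i = j := by
  classical
  rw [prevIndex, Nat.findGreatest_eq_iff]
  refine ⟨hj.1.le, fun _ => ⟨hj.1, hn⟩, ?_⟩
  rintro n hn1 - ⟨h1, h2⟩
  exact hj.2 n hn1 h1 (hnear.trans (hnear.symm hn) h2)

theorem isLast_prevIndex {i : ℕ} (hnear : Equivalence near) (h : prevIndex near i < i)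
    (h2 : near i (prevIndex near i)) : IsLast near i (prevIndex near i) := by
  classical
  refine ⟨h, fun j hj hji hn => ?_⟩
  exact Nat.findGreatest_is_greatest (P := fun j => j < i ∧ near i j) hj hji.le
    ⟨hji, hnear.trans h2 hn⟩

theorem exists_isLast (hnear : Equivalence near) {i k : ℕ} (h : i < k) :
    ∃ j, IsLast near k j ∧ near i j ∧ i ≤ j := by
  classical
  have h0 : i < k ∧ near i i := ⟨h, hnear.refl i⟩
  have := Nat.findGreatest_spec (P := fun j => j < k ∧ near i j) h.le h0
  refine ⟨_, ⟨this.1, fun j hj hjk hn => ?_⟩, this.2,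
    Nat.le_findGreatest (P := fun j => j < k ∧ near i j) h.le h0⟩
  exact Nat.findGreatest_is_greatest (P := fun j => j < k ∧ near i j) hj hjk.le
    ⟨hjk, hnear.trans this.2 hn⟩

theorem IsLast.eq_of_near {k j j' : ℕ} (hnear : Equivalence near) (h : IsLast near k j)
    (h' : IsLast near k j') (hn : near j j') : j = j' := by
  rcases lt_trichotomy j j' with h1 | h1 | h1
  · exact absurd hn (h.2 _ h1 h'.1)
  · exact h1
  · exact absurd (hnear.symm hn) (h'.2 _ h1 h.1)

theorem near_rep (hnear : Equivalence near) (C : ℕ → ℕ) (i : ℕ) : near i (rep near st C i) := by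
  induction i using Nat.strong_induction_on with
  | _ i ih =>
    rw [rep]
    split_ifs with h
    · exact hnear.trans h.2.1 (ih _ h.1)
    · exact hnear.refl i

theorem groupFlag_spec (cut i f : ℕ) (l : List (ℕ × ℕ)) :
    ((∀ e ∈ l, ¬ (cut ≤ st e.1 ∧ near i e.1)) ∧ groupFlag near st cut i f l = f) ∨
      ∃ e ∈ l, (cut ≤ st e.1 ∧ near i e.1) ∧ groupFlag near st cut i f l = e.2 := by
  classical
  induction l using List.reverseRecOn with
  | nil => left; simp [groupFlag]
  | append_singleton l e ih =>
    have h : groupFlag near st cut i f (l ++ [e]) =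
        if cut ≤ st e.1 ∧ near i e.1 then e.2 else groupFlag near st cut i f l := by
      simp [groupFlag]
    rw [h]
    by_cases hP : cut ≤ st e.1 ∧ near i e.1
    · right; exact ⟨e, by simp, hP, by rw [if_pos hP]⟩
    · rw [if_neg hP]
      rcases ih with ⟨h1, h2⟩ | ⟨e', h1, h2⟩
      · left
        refine ⟨fun e' he' => ?_, h2⟩
        rcases List.mem_append.1 he' with h | h
        · exact h1 _ h
        · rw [List.mem_singleton.1 h]; exact hP
      · right; exact ⟨e', by simp [h1], h2⟩

theorem mem_keepList {cut i : ℕ} {l : List (ℕ × ℕ)} {e : ℕ × ℕ} :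
    e ∈ keepList near st cut i l ↔ e ∈ l ∧ cut ≤ st e.1 ∧ ¬ near i e.1 := by
  simp [keepList]

theorem mem_refresh {cut i f : ℕ} {l : List (ℕ × ℕ)} {e : ℕ × ℕ} :
    e ∈ refresh near st cut i f l ↔ (e ∈ l ∧ cut ≤ st e.1 ∧ ¬ near i e.1) ∨
      (e = (i, groupFlag near st cut i f l) ∧ groupFlag near st cut i f l < 2) := by
  rw [refresh, List.mem_append, mem_keepList]
  split_ifs with h <;> simp [h]

open Classical in
/-- What is stored after `k` points. -/
structure ListInv (near : ℕ → ℕ → Prop) (st C : ℕ → ℕ) (acc nb : ℕ → Prop) (k : ℕ)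
    (l : List (ℕ × ℕ)) : Prop where
  isLast : ∀ e ∈ l, IsLast near k e.1
  flag : ∀ e ∈ l, e.2 = if acc (rep near st C e.1) then 1 else 0
  cut_le : ∀ e ∈ l, ∀ c, k = c + 1 → C c ≤ st e.1
  sorted : l.Pairwise fun e e' => e.1 < e'.1
  stored : ∀ j, IsLast near k j → (∀ c, k = c + 1 → C c ≤ st j) →
    (∃ e ∈ l, e.1 = j) ∨ ¬ nb (rep near st C j)
  sampled : ∀ e ∈ l, ∃ x, near e.1 x ∧ nb x

variable {C : ℕ → ℕ} {acc nb : ℕ → Prop}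

theorem isLast_succ {k j : ℕ} (hnear : Equivalence near) (h : IsLast near k j) (hn : ¬ near k j) :
    IsLast near (k + 1) j := by
  refine ⟨h.1.trans (Nat.lt_succ_self k), fun i hi hik hn' => ?_⟩
  rcases Nat.lt_succ_iff_lt_or_eq.1 hik with h1 | rfl
  · exact h.2 i hi h1 hn'
  · exact hn (hnear.symm hn')

theorem IsLast.pred {k j : ℕ} (h : IsLast near (k + 1) j) (hj : j ≠ k) :
    IsLast near k j ∧ ¬ near j k := by
  have h1 := h.1
  exact ⟨⟨by omega, fun i hi hik => h.2 i hi (by omega)⟩, h.2 k (by omega) (by omega)⟩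

/-- Everything except the flag of the incoming group is bookkeeping. If an unexpired entry of the
group is stored, its flag is inherited along with the representative. If the group is unexpired but
absent, nothing near its representative is sampled, so by `hacc` no point of it is accepted and flag
`0` is correct. Otherwise the point starts a new life of the group as its own representative. -/
theorem listInv_groupList (hnear : Equivalence near) (hC : Monotone C)
    (hCst : ∀ k, C k ≤ st k) (hacc : ∀ i j, near i j → acc j → nb i) (k : ℕ) :
    ListInv near st C acc nb k (groupList near st C (initFlag acc nb) k) := by
  classical
  induction k with
  | zero =>
    refine ⟨?_, ?_, ?_, ?_, ?_, ?_⟩ <;> simp [groupList]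
    exact fun j hj => absurd hj.1 (by simp)
  | succ k ih =>
    rw [groupList]
    set l := groupList near st C (initFlag acc nb) k
    -- Since cuts only increase, a point that survives the present cut survived the previous one, so
    -- the induction hypothesis covers it.
    have hprev : ∀ j, C k ≤ st j → ∀ c, k = c + 1 → C c ≤ st j := by
      rintro j hj c rfl
      exact (hC (Nat.le_succ c)).trans hj
    -- the flag of the new entry
    have key : (groupFlag near st (C k) k (initFlag acc nb k) l < 2 →
        groupFlag near st (C k) k (initFlag acc nb k) l =
          (if acc (rep near st C k) then 1 else 0) ∧ ∃ x, near k x ∧ nb x) ∧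
        (¬ groupFlag near st (C k) k (initFlag acc nb k) l < 2 → ¬ nb (rep near st C k)) := by
      rcases groupFlag_spec (near := near) (st := st) (C k) k (initFlag acc nb k) l with
        ⟨h1, h2⟩ | ⟨e, he, ⟨h1, h2⟩, h3⟩
      · rw [h2]
        by_cases hp : prevIndex near k < k ∧ near k (prevIndex near k) ∧
            C k ≤ st (prevIndex near k)
        · have hl := isLast_prevIndex hnear hp.1 hp.2.1
          have hr : rep near st C k = rep near st C (prevIndex near k) := by
            rw [rep, dif_pos hp]
          -- The latest earlier point of the group has not expired and yet is not stored, so the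
          -- group was forgotten because nothing near its representative is sampled.
          have hnb : ¬ nb (rep near st C k) := by
            rw [hr]
            rcases ih.stored _ hl (hprev _ hp.2.2) with ⟨e, he, hej⟩ | h
            · exact absurd ⟨by rw [hej]; exact hp.2.2, by rw [hej]; exact hp.2.1⟩ (h1 e he)
            · exact h
          have ha : ¬ acc k := fun h => hnb (hacc _ _ (hnear.symm (near_rep hnear C k)) h)
          have ha' : ¬ acc (rep near st C k) := fun h => hnb (hacc _ _ (hnear.refl _) h)
          refine ⟨fun h => ?_, fun _ => hnb⟩
          -- A forgotten group can reappear: the new point may have a sampled cell near it that is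
          -- out of reach of the representative. It then enters with flag `0`, which agrees with the
          -- representative not being accepted.
          unfold initFlag at h ⊢
          split_ifs at h with hk
          · simp only [ha', hk, ha, if_false, if_true, true_and]
            exact ⟨k, hnear.refl k, hk⟩
          · omega
        -- There is no unexpired earlier point of the group, so the chain of representatives starts
        -- afresh at `k`.
        · have hr : rep near st C k = k := by rw [rep, dif_neg hp]
          rw [hr]
          unfold initFlag
          by_cases hk : nb k
          · simp only [hk, if_true, not_true, imp_false, not_not, true_and]
            refine ⟨fun _ => ⟨k, hnear.refl k, hk⟩, by split_ifs <;> omega⟩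
          · simp [hk]
      · have hl := ih.isLast e he
        have hp := prevIndex_eq hl h2 hnear
        have hr : rep near st C k = rep near st C e.1 := by
          rw [rep, dif_pos (by rw [hp]; exact ⟨hl.1, h2, h1⟩), hp]
        rw [h3, hr, ih.flag e he]
        refine ⟨fun _ => ⟨rfl, ?_⟩, fun h => absurd ?_ h⟩
        · obtain ⟨x, hx, hx'⟩ := ih.sampled e he
          exact ⟨x, hnear.trans h2 hx, hx'⟩
        · split_ifs <;> omega
    refine ⟨fun e he => ?_, fun e he => ?_, fun e he c hc => ?_, ?_, fun j hj hjc => ?_,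
      fun e he => ?_⟩
    · rcases mem_refresh.1 he with ⟨h1, h2, h3⟩ | ⟨rfl, h⟩
      · exact isLast_succ hnear (ih.isLast e h1) h3
      · exact ⟨by simp, fun i hi hik => absurd hik (by simp at hi ⊢; omega)⟩
    · rcases mem_refresh.1 he with ⟨h1, h2, h3⟩ | ⟨rfl, h⟩
      · exact ih.flag e h1
      · exact (key.1 h).1
    · obtain rfl : k = c := by omega
      rcases mem_refresh.1 he with ⟨h1, h2, h3⟩ | ⟨rfl, h⟩
      · exact h2
      · exact hCst k
    · rw [refresh, List.pairwise_append]
      refine ⟨ih.sorted.filter _, by split_ifs <;> simp, fun e he e' he' => ?_⟩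
      split_ifs at he' with h
      · rw [List.mem_singleton.1 he']
        exact (ih.isLast e (mem_keepList.1 he).1).1
      · simp at he'
    · by_cases hjk : j = k
      · subst hjk
        by_cases h : groupFlag near st (C j) j (initFlag acc nb j) l < 2
        · exact Or.inl ⟨_, mem_refresh.2 (Or.inr ⟨rfl, h⟩), rfl⟩
        · exact Or.inr (key.2 h)
      · obtain ⟨h1, h2⟩ := hj.pred hjk
        have h3 := hjc k rfl
        rcases ih.stored j h1 (hprev j h3) with ⟨e, he, rfl⟩ | h
        · exact Or.inl ⟨e, mem_refresh.2 (Or.inl ⟨he, h3, fun h => h2 (hnear.symm h)⟩), rfl⟩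
        · exact Or.inr h
    · rcases mem_refresh.1 he with ⟨h1, h2, h3⟩ | ⟨rfl, h⟩
      · exact ih.sampled e h1
      · exact (key.1 h).2

theorem ListInv.mem_one_iff (hnear : Equivalence near) (hacc : ∀ i j, near i j → acc j → nb i)
    {k : ℕ} {l : List (ℕ × ℕ)} (h : ListInv near st C acc nb k l) {j : ℕ}
    (hj : IsLast near k j) (hjc : ∀ c, k = c + 1 → C c ≤ st j) :
    (j, 1) ∈ l ↔ acc (rep near st C j) := by
  constructor
  · intro hm
    have := h.flag _ hm
    by_contra hc
    simp [hc] at this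
  · intro ha
    rcases h.stored j hj hjc with ⟨e, he, rfl⟩ | hn
    · have := h.flag e he
      rw [if_pos ha] at this
      rw [← this]; exact he
    · exact absurd (hacc _ _ (hnear.refl _) ha) hn

/-- Acceptance of the last point itself already forces the group to be stored, because the
representative is close to it. Unlike acceptance of the representative, this condition does not
depend on the cuts, so it can be counted for a fixed set of points. -/
theorem ListInv.exists_of_acc (hnear : Equivalence near) (hacc : ∀ i j, near i j → acc j → nb i)
    {k : ℕ} {l : List (ℕ × ℕ)} (h : ListInv near st C acc nb k l) {j : ℕ}
    (hj : IsLast near k j) (hjc : ∀ c, k = c + 1 → C c ≤ st j) (ha : acc j) :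
    ∃ e ∈ l, e.1 = j := by
  rcases h.stored j hj hjc with h | hn
  · exact h
  · exact absurd (hacc _ _ (hnear.symm (near_rep hnear C j)) ha) hn

/-! ### The list that raises its cut -/

variable {K : ℕ} {f : ℕ → ℕ}

theorem boundedList_bounds (hst : StrictMono st) (k : ℕ) :
    (∀ e ∈ (boundedList near st K f k).1, e.1 < k ∧ (boundedList near st K f k).2 ≤ st e.1) ∧
      (boundedList near st K f k).2 ≤ st k ∧
      (boundedList near st K f k).2 ≤ (boundedList near st K f (k + 1)).2 ∧
      (boundedList near st K f (k + 1)).2 ≤ st k := by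
  have aux : ∀ k, (∀ e ∈ (boundedList near st K f k).1,
      e.1 < k ∧ (boundedList near st K f k).2 ≤ st e.1) → (boundedList near st K f k).2 ≤ st k →
      (boundedList near st K f k).2 ≤ (boundedList near st K f (k + 1)).2 ∧
      (boundedList near st K f (k + 1)).2 ≤ st k := by
    intro k h1 h2
    change _ ≤ raiseCut _ _ _ _ ∧ raiseCut _ _ _ _ ≤ _
    unfold raiseCut
    split_ifs with h
    · cases hl : (boundedList near st K f k).1 with
      | nil => rw [hl] at h; simp at h
      | cons e l =>
        have := h1 e (by rw [hl]; simp)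
        have h3 := hst this.1
        simp only [List.headD_cons]
        omega
    · exact ⟨le_rfl, h2⟩
  induction k with
  | zero =>
    have h : (∀ e ∈ (boundedList near st K f 0).1,
      e.1 < 0 ∧ (boundedList near st K f 0).2 ≤ st e.1) ∧ (boundedList near st K f 0).2 ≤ st 0 := by
      simp [boundedList]
    exact ⟨h.1, h.2, aux 0 h.1 h.2⟩
  | succ k ih =>
    have h : (∀ e ∈ (boundedList near st K f (k + 1)).1,
        e.1 < k + 1 ∧ (boundedList near st K f (k + 1)).2 ≤ st e.1) := by
      intro e he
      rcases mem_refresh.1 he with ⟨h1, h2, h3⟩ | ⟨rfl, h⟩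
      · exact ⟨(ih.1 e h1).1.trans (Nat.lt_succ_self k), h2⟩
      · exact ⟨Nat.lt_succ_self k, ih.2.2.2⟩
    have h' : (boundedList near st K f (k + 1)).2 ≤ st (k + 1) :=
      ih.2.2.2.trans (hst (Nat.lt_succ_self k)).le
    exact ⟨h, h', aux _ h h'⟩

theorem cuts_mono (hst : StrictMono st) : Monotone (cuts near st K f) :=
  monotone_nat_of_le_succ fun k => (boundedList_bounds hst (k + 1)).2.2.1

theorem cuts_le (hst : StrictMono st) (k : ℕ) : cuts near st K f k ≤ st k :=
  (boundedList_bounds hst k).2.2.2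

theorem boundedList_length (k : ℕ) : (boundedList near st K f k).1.length ≤ K + 1 := by
  classical
  induction k with
  | zero => simp [boundedList]
  | succ k ih =>
    have h1 : (keepList near st (raiseCut st K (boundedList near st K f k).2
        (boundedList near st K f k).1) k (boundedList near st K f k).1).length ≤ K := by
      by_cases h : K < (boundedList near st K f k).1.length
      · rw [raiseCut, if_pos h]
        cases hl : (boundedList near st K f k).1 with
        | nil => rw [hl] at h; simp at h
        | cons e l =>
          rw [hl] at ih
          -- The raised cut lies just above the stamp of the head, so filtering removes at least
          -- that entry before one new entry is appended.
          have : (keepList near st (st e.1 + 1) k (e :: l)) = keepList near st (st e.1 + 1) k l := by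
            unfold keepList
            rw [List.filter_cons_of_neg]
            simp
          rw [List.headD_cons, this]
          refine (List.length_filter_le _ _).trans ?_
          simpa using ih
      · exact (List.length_filter_le _ _).trans (not_lt.1 h)
    change (refresh _ _ _ _ _ _).length ≤ _
    rw [refresh, List.length_append]
    refine Nat.add_le_add h1 ?_
    split_ifs <;> simp

/-- A positive cut has been raised at a time when the list was full. -/
theorem cut_eq_zero_or (k : ℕ) : (boundedList near st K f k).2 = 0 ∨
    ∃ k₀ < k, K < (boundedList near st K f k₀).1.length ∧ (boundedList near st K f k).2 =
      st ((boundedList near st K f k₀).1.headD (0, 0)).1 + 1 := by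
  induction k with
  | zero => left; rfl
  | succ k ih =>
    by_cases h : K < (boundedList near st K f k).1.length
    · right
      refine ⟨k, Nat.lt_succ_self k, h, ?_⟩
      change raiseCut _ _ _ _ = _
      rw [raiseCut, if_pos h]
    · have : (boundedList near st K f (k + 1)).2 = (boundedList near st K f k).2 := by
        change raiseCut _ _ _ _ = _
        rw [raiseCut, if_neg h]
      rw [this]
      rcases ih with h | ⟨k₀, h1, h2⟩
      · exact Or.inl h
      · exact Or.inr ⟨k₀, h1.trans (Nat.lt_succ_self k), h2⟩

end Model

end SlidingSample

end

noncomputable section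

namespace SlidingSample

/-! ### Consequences of good samples -/

section Consequences

variable {near : ℕ → ℕ → Prop} {st : ℕ → ℕ} {K : ℕ}

open Classical in
/-- The last points of the groups that occur among the points `a, …, k - 1`. -/
def lasts (near : ℕ → ℕ → Prop) (a k : ℕ) : Finset ℕ :=
  (Finset.range k).filter fun j => a ≤ j ∧ IsLast near k j

theorem mem_lasts {a k j : ℕ} : j ∈ lasts near a k ↔ a ≤ j ∧ IsLast near k j := by
  simp only [lasts, Finset.mem_filter, Finset.mem_range, and_iff_right_iff_imp]
  exact fun h => h.2.1

theorem lasts_injOn (hnear : Equivalence near) {a k : ℕ} : ∀ i ∈ lasts near a k,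
    ∀ j ∈ lasts near a k, near i j → i = j := fun _ hi _ hj h =>
  (mem_lasts.1 hi).2.eq_of_near hnear (mem_lasts.1 hj).2 h

/-- Replaces a threshold on stamps by one on indices. The union bound then runs over pairs `a ≤ k ≤
m` only, whatever the arrival times are. -/
theorem exists_index_threshold (hst : StrictMono st) (t k : ℕ) :
    ∃ a ≤ k, ∀ j < k, t ≤ st j ↔ a ≤ j := by
  classical
  have h : ∃ j, t ≤ st j := ⟨t, hst.le_apply⟩
  refine ⟨min (Nat.find h) k, min_le_right _ _, fun j hj => ?_⟩
  have : t ≤ st j ↔ Nat.find h ≤ j :=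
    ⟨fun h' => Nat.find_min' h h', fun h' => (Nat.find_spec h).trans (hst.monotone h')⟩
  rw [this]
  omega

-- If more than `A` groups had occurred since the cut, at least `K + 2` of their last points would
-- be accepted, and all of these would be entries of the first list, which has at most `K + 1`. So
-- at most `A` groups occurred since the cut, and each entry of the second list belongs to a touched
-- one among them.
open Classical in
theorem groupList_length_le (hnear : Equivalence near) (hst : StrictMono st)
    {acc₀ nb₀ acc₁ nb₁ : ℕ → Prop} (hacc₀ : ∀ i j, near i j → acc₀ j → nb₀ i)
    (hacc₁ : ∀ i j, near i j → acc₁ j → nb₁ i) {k : ℕ} {A D : ℕ}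
    (h₀ : ∀ a ≤ k, A ≤ (lasts near a k).card → K + 2 ≤ ((lasts near a k).filter acc₀).card)
    (h₁ : ∀ a ≤ k, (lasts near a k).card ≤ A →
      ((lasts near a k).filter fun j => ∃ x, near j x ∧ nb₁ x).card < D) :
    (groupList near st (cuts near st K (initFlag acc₀ nb₀)) (initFlag acc₁ nb₁) k).length ≤ D := by
  set C := cuts near st K (initFlag acc₀ nb₀) with hC
  cases k with
  | zero => simp [groupList]
  | succ c =>
    have inv₀ := listInv_groupList (acc := acc₀) (nb := nb₀) hnear (cuts_mono hst)
      (cuts_le hst) hacc₀ (C := C) (c + 1)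
    have inv₁ := listInv_groupList (acc := acc₁) (nb := nb₁) hnear (cuts_mono hst)
      (cuts_le hst) hacc₁ (C := C) (c + 1)
    obtain ⟨a, hak, ha⟩ := exists_index_threshold hst (C c) (c + 1)
    have hA : (lasts near a (c + 1)).card ≤ A := by
      by_contra hcon
      have h := h₀ a hak (not_le.1 hcon).le
      have hlen := boundedList_length (near := near) (st := st) (K := K)
        (f := initFlag acc₀ nb₀) (c + 1)
      rw [boundedList_fst, ← hC] at hlen
      have hsub : (lasts near a (c + 1)).filter acc₀ ⊆
          ((groupList near st C (initFlag acc₀ nb₀) (c + 1)).map Prod.fst).toFinset := by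
        intro j hj
        obtain ⟨hj, hj'⟩ := Finset.mem_filter.1 hj
        obtain ⟨h1, h2⟩ := mem_lasts.1 hj
        obtain ⟨e, he, rfl⟩ := inv₀.exists_of_acc hnear hacc₀ h2
          (fun c' hc' => by obtain rfl : c = c' := by omega
                            exact (ha _ h2.1).2 h1) hj'
        simp only [List.mem_toFinset, List.mem_map]
        exact ⟨e, he, rfl⟩
      have := (Finset.card_le_card hsub).trans (List.toFinset_card_le _)
      rw [List.length_map] at this
      omega
    have hnd : ((groupList near st C (initFlag acc₁ nb₁) (c + 1)).map Prod.fst).Nodup :=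
      List.Pairwise.map _ (fun _ _ h => ne_of_lt h) inv₁.sorted
    rw [← List.length_map (f := Prod.fst), ← List.toFinset_card_of_nodup hnd]
    refine (Finset.card_le_card ?_).trans (h₁ a hak hA).le
    intro j hj
    simp only [List.mem_toFinset, List.mem_map] at hj
    obtain ⟨e, he, rfl⟩ := hj
    have hl := inv₁.isLast e he
    exact Finset.mem_filter.2 ⟨mem_lasts.2 ⟨(ha _ hl.1).1 (inv₁.cut_le e he c rfl), hl⟩,
      inv₁.sampled e he⟩

-- A cut above `t` was set when the list had more than `K` entries, the oldest of them with stamp at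
-- least `t`. The remaining entries, at least `K`, come from distinct touched groups with points
-- after `t`, which is too many if the groups since `t` number at most `B`.
open Classical in
theorem card_lasts_of_cut (hnear : Equivalence near) (hst : StrictMono st)
    {acc nb : ℕ → Prop} (hacc : ∀ i j, near i j → acc j → nb i) {k t a B : ℕ}
    (ha : ∀ j < k, t ≤ st j ↔ a ≤ j)
    (h : (lasts near a k).card ≤ B →
      ((lasts near a k).filter fun j => ∃ x, near j x ∧ nb x).card < K)
    (hcut : t < (boundedList near st K (initFlag acc nb) k).2) : B < (lasts near a k).card := by
  set C := cuts near st K (initFlag acc nb) with hC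
  by_contra hcon
  refine absurd (h (not_lt.1 hcon)) (not_lt.2 ?_)
  rcases cut_eq_zero_or (near := near) (st := st) (K := K) (f := initFlag acc nb) k with
    h0 | ⟨k₀, hk₀, hlen, hcut'⟩
  · omega
  rw [boundedList_fst, ← hC] at hlen hcut'
  have inv := listInv_groupList (acc := acc) (nb := nb) hnear (cuts_mono hst)
      (cuts_le hst) hacc (C := C) k₀
  set l := groupList near st C (initFlag acc nb) k₀
  cases hl : l with
  | nil => rw [hl] at hlen; simp at hlen
  | cons e₀ l' =>
    rw [hl] at hlen hcut' inv
    rw [List.headD_cons] at hcut'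
    have hsort := List.pairwise_cons.1 inv.sorted
    have hnd : (l'.map Prod.fst).Nodup :=
      List.Pairwise.map _ (fun _ _ h => ne_of_lt h) hsort.2
    have hK : K ≤ (l'.map Prod.fst).toFinset.card := by
      rw [List.toFinset_card_of_nodup hnd, List.length_map]
      simpa using Nat.lt_succ_iff.1 hlen
    refine hK.trans ?_
    -- Between `k₀` and `k` these groups may have received newer points. Passing to the last point
    -- of each group at time `k` keeps them distinct and can only increase the stamps.
    have hex : ∀ i < k, ∃ j, IsLast near k j ∧ near i j ∧ i ≤ j := fun i hi =>
      exists_isLast hnear hi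
    choose! g hg using hex
    have hmem : ∀ i ∈ (l'.map Prod.fst).toFinset, ∃ e ∈ l', e.1 = i ∧ i < k := by
      intro i hi
      simp only [List.mem_toFinset, List.mem_map] at hi
      obtain ⟨e, he, rfl⟩ := hi
      exact ⟨e, he, rfl, (inv.isLast e (List.mem_cons_of_mem _ he)).1.trans hk₀⟩
    refine Finset.card_le_card_of_injOn g (fun i hi => ?_) (fun i hi i' hi' hii => ?_)
    · obtain ⟨e, he, rfl, hek⟩ := hmem i hi
      obtain ⟨h1, h2, h3⟩ := hg _ hek
      obtain ⟨x, hx, hx'⟩ := inv.sampled e (List.mem_cons_of_mem _ he)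
      simp only [Finset.coe_filter, Set.mem_ofPred_eq]
      refine ⟨mem_lasts.2 ⟨(ha _ h1.1).1 ?_, h1⟩, x, hnear.trans (hnear.symm h2) hx, hx'⟩
      have h4 := hst (hsort.1 e he)
      have h5 := hst.monotone h3
      omega
    · obtain ⟨e, he, rfl, hek⟩ := hmem i hi
      obtain ⟨e', he', rfl, hek'⟩ := hmem i' hi'
      have h1 := (hg _ hek).2.1
      have h2 := (hg _ hek').2.1
      rw [← hii] at h2
      exact (inv.isLast e (List.mem_cons_of_mem _ he)).eq_of_near hnear
        (inv.isLast e' (List.mem_cons_of_mem _ he')) (hnear.trans h1 (hnear.symm h2))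

end Consequences

end SlidingSample

end

/-! ### Probability and geometry: counting hash functions, grid cells, and sampled cells. -/

noncomputable section

namespace SlidingSample

/-! ### Random functions -/

section RandomFunctions

open Finset

variable {ι X : Type*} [Fintype ι] [DecidableEq ι] [Fintype X]

/-- Independence of the values of a uniformly random function, in counting form: the coordinates in
`S` contribute one factor each, and the others are free. -/
theorem sum_prod_apply (S : Finset ι) (g : X → ℝ) :
    ∑ h : ι → X, ∏ k ∈ S, g (h k) =
      (∑ v, g v) ^ S.card * (Fintype.card X : ℝ) ^ (Fintype.card ι - S.card) := by
  classical
  have h1 : ∀ h : ι → X, ∏ k ∈ S, g (h k) = ∏ k, if k ∈ S then g (h k) else 1 := by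
    intro h
    rw [Finset.prod_ite_mem, Finset.univ_inter]
  simp_rw [h1]
  rw [← Fintype.piFinset_univ, ← Finset.prod_univ_sum (fun _ => Finset.univ)
    (fun k v => if k ∈ S then g v else 1)]
  rw [← Finset.prod_mul_prod_compl S]
  congr 1
  · rw [Finset.prod_congr rfl (g := fun _ => ∑ v, g v), Finset.prod_const]
    intro k hk
    simp [hk]
  · rw [Finset.prod_congr rfl (g := fun _ => (Fintype.card X : ℝ)), Finset.prod_const,
      Finset.card_compl]
    intro k hk
    simp [Finset.mem_compl.1 hk]

theorem sum_prod_apply_eq [Nonempty X] (S : Finset ι) (g : X → ℝ) {a : ℝ}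
    (ha : ∑ v, g v = a * Fintype.card X) :
    ∑ h : ι → X, ∏ k ∈ S, g (h k) = a ^ S.card * Fintype.card (ι → X) := by
  rw [sum_prod_apply, ha, mul_pow, mul_assoc, ← pow_add,
    Nat.add_sub_cancel' (Finset.card_le_univ S)]
  simp

variable (P : X → Prop) [DecidablePred P]

/-- The moment of a single coordinate, for a property of density exactly `1 / R`. The values `x = 1
/ 2`, `2` and `0` give the three tail bounds below. -/
theorem sum_ite_density {R : ℕ} (hR : 0 < R) (hP : (univ.filter P).card * R = Fintype.card X)
    (x : ℝ) : ∑ v, (if P v then x else 1) = (1 + (x - 1) / R) * Fintype.card X := by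
  have h : ∀ v, (if P v then x else 1) = 1 + (x - 1) * (if P v then 1 else 0) := by
    intro v; split_ifs <;> ring
  simp_rw [h]
  rw [Finset.sum_add_distrib, ← Finset.mul_sum, Finset.sum_boole]
  have : (Fintype.card X : ℝ) = (univ.filter P).card * R := by exact_mod_cast hP.symm
  have hR' : (R : ℝ) ≠ 0 := by positivity
  simp only [sum_const, card_univ, nsmul_eq_mul, mul_one]
  rw [this]
  field_simp

theorem prod_ite_eq_pow (S : Finset ι) (x : ℝ) (h : ι → X) :
    ∏ k ∈ S, (if P (h k) then x else 1) = x ^ (S.filter fun k => P (h k)).card := by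
  rw [← Finset.prod_filter, Finset.prod_const]

/-- Markov's inequality for `2 ^ (T - N)`, where `N` is the number of hits: each coordinate has
moment `1 - 1 / (2 R) ≤ exp (-1 / (2 R))`. -/
theorem card_few_le [Nonempty X] {R : ℕ} (hR : 0 < R)
    (hP : (univ.filter P).card * R = Fintype.card X) (S : Finset ι) (T : ℕ) :
    ((univ.filter fun h : ι → X => (S.filter fun k => P (h k)).card ≤ T).card : ℝ) ≤
      2 ^ T * Real.exp (-(S.card / (2 * R))) * Fintype.card (ι → X) := by
  have h1 : ((univ.filter fun h : ι → X => (S.filter fun k => P (h k)).card ≤ T).card : ℝ) ≤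
      ∑ h : ι → X, 2 ^ T * ∏ k ∈ S, (if P (h k) then (1 / 2 : ℝ) else 1) := by
    rw [← Finset.sum_boole]
    refine Finset.sum_le_sum fun h _ => ?_
    rw [prod_ite_eq_pow]
    split_ifs with hc
    · rw [one_div, inv_pow, ← div_eq_mul_inv, le_div_iff₀ (by positivity), one_mul]
      exact pow_le_pow_right₀ (by norm_num) hc
    · positivity
  refine h1.trans ?_
  rw [← Finset.mul_sum, sum_prod_apply_eq S _ (sum_ite_density P hR hP (1 / 2)), ← mul_assoc]
  refine mul_le_mul_of_nonneg_right ?_ (by positivity)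
  refine mul_le_mul_of_nonneg_left ?_ (by positivity)
  have hR' : (1 : ℝ) ≤ R := by exact_mod_cast hR
  have h2 : (1 + (1 / 2 - 1) / R : ℝ) = -(1 / (2 * R)) + 1 := by field_simp; ring
  have h3 : -(S.card / (2 * R) : ℝ) = S.card * -(1 / (2 * R)) := by ring
  rw [h3, Real.exp_nat_mul]
  refine pow_le_pow_left₀ ?_ (h2 ▸ Real.add_one_le_exp _) _
  rw [h2]
  have : (1 : ℝ) / (2 * R) ≤ 1 := by rw [div_le_one (by positivity)]; linarith
  linarith

/-- Markov's inequality for `2 ^ (N - T)`, where `N` is the number of hits: each coordinate has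
moment `1 + 1 / R ≤ exp (1 / R)`. -/
theorem card_many_le [Nonempty X] {R : ℕ} (hR : 0 < R)
    (hP : (univ.filter P).card * R = Fintype.card X) (S : Finset ι) (T : ℕ) :
    ((univ.filter fun h : ι → X => T ≤ (S.filter fun k => P (h k)).card).card : ℝ) ≤
      (1 / 2) ^ T * Real.exp (S.card / R) * Fintype.card (ι → X) := by
  have h1 : ((univ.filter fun h : ι → X => T ≤ (S.filter fun k => P (h k)).card).card : ℝ) ≤
      ∑ h : ι → X, (1 / 2) ^ T * ∏ k ∈ S, (if P (h k) then (2 : ℝ) else 1) := by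
    rw [← Finset.sum_boole]
    refine Finset.sum_le_sum fun h _ => ?_
    rw [prod_ite_eq_pow]
    split_ifs with hc
    · rw [one_div, inv_pow, mul_comm, ← div_eq_mul_inv, le_div_iff₀ (by positivity), one_mul]
      exact pow_le_pow_right₀ (by norm_num) hc
    · positivity
  refine h1.trans ?_
  rw [← Finset.mul_sum, sum_prod_apply_eq S _ (sum_ite_density P hR hP 2), ← mul_assoc]
  refine mul_le_mul_of_nonneg_right ?_ (by positivity)
  refine mul_le_mul_of_nonneg_left ?_ (by positivity)
  have h2 : (1 + (2 - 1) / R : ℝ) = 1 / R + 1 := by ring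
  have h3 : (S.card / R : ℝ) = S.card * (1 / R) := by ring
  rw [h3, Real.exp_nat_mul, h2]
  exact pow_le_pow_left₀ (by positivity) (Real.add_one_le_exp _) _

/-- The set of inspected coordinates may itself be random. It lies inside `p` and is determined by
the values outside `p`; conditionally on those, it is a fixed set of coordinates with independent
values. -/
theorem card_none_le [Nonempty X] {R : ℕ} (hR : 0 < R)
    (hP : (univ.filter P).card * R = Fintype.card X) (p : ι → Prop) [DecidablePred p]
    (S : (ι → X) → Finset ι) (hp : ∀ h, ∀ k ∈ S h, p k)
    (hS : ∀ h h', (∀ k, ¬ p k → h k = h' k) → S h = S h') (N : ℕ)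
    (T : Finset (ι → X)) (hT : ∀ h ∈ T, N ≤ (S h).card ∧ ∀ k ∈ S h, ¬ P (h k)) :
    (T.card : ℝ) ≤ Real.exp (-(N / R)) * Fintype.card (ι → X) := by
  have hT' : T ⊆ univ.filter fun h : ι → X => N ≤ (S h).card ∧ ∀ k ∈ S h, ¬ P (h k) :=
    fun h hh => mem_filter.2 ⟨mem_univ _, hT h hh⟩
  refine (Nat.cast_le.2 (card_le_card hT')).trans ?_
  rw [← Finset.sum_boole, ← (Equiv.piEquivPiSubtypeProd p (fun _ => X)).symm.sum_comp,
    Fintype.sum_prod_type_right]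
  have hR' : (1 : ℝ) ≤ R := by exact_mod_cast hR
  have key : ∀ e : {k // ¬ p k} → X, ∑ o : {k // p k} → X,
      (if N ≤ (S ((Equiv.piEquivPiSubtypeProd p (fun _ => X)).symm (o, e))).card ∧
        ∀ k ∈ S ((Equiv.piEquivPiSubtypeProd p (fun _ => X)).symm (o, e)),
          ¬ P ((Equiv.piEquivPiSubtypeProd p (fun _ => X)).symm (o, e) k) then (1 : ℝ) else 0) ≤
      Real.exp (-(N / R)) * Fintype.card ({k // p k} → X) := by
    intro e
    obtain ⟨v⟩ := ‹Nonempty X›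
    -- With the values `e` outside `p` fixed, the set does not depend on the values inside, so it
    -- may be computed with an arbitrary constant there.
    set S₀ := S ((Equiv.piEquivPiSubtypeProd p (fun _ => X)).symm (fun _ => v, e)) with hS₀
    have hSo : ∀ o, S ((Equiv.piEquivPiSubtypeProd p (fun _ => X)).symm (o, e)) = S₀ := by
      intro o
      refine hS _ _ fun k hk => ?_
      simp [Equiv.piEquivPiSubtypeProd, hk]
    simp_rw [hSo]
    have hcard : (S₀.subtype p).card = S₀.card := by
      rw [Finset.card_subtype, Finset.filter_true_of_mem (hp _)]
    by_cases hN : N ≤ S₀.card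
    · have h1 : ∀ o : {k // p k} → X, (if N ≤ S₀.card ∧ ∀ k ∈ S₀,
            ¬ P ((Equiv.piEquivPiSubtypeProd p (fun _ => X)).symm (o, e) k) then (1 : ℝ) else 0) ≤
          ∏ k ∈ S₀.subtype p, (if P (o k) then 0 else 1) := by
        intro o
        split_ifs with h
        · rw [Finset.prod_eq_one]
          intro k hk
          have h2 := h.2 k (Finset.mem_subtype.1 hk)
          simp only [Equiv.piEquivPiSubtypeProd, Equiv.coe_fn_symm_mk, k.2, dif_pos] at h2
          rw [if_neg h2]
        · exact Finset.prod_nonneg fun k _ => by split_ifs <;> norm_num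
      refine (Finset.sum_le_sum fun o _ => h1 o).trans ?_
      have : Nonempty X := ⟨v⟩
      rw [sum_prod_apply_eq _ (fun v => if P v then (0 : ℝ) else 1) (sum_ite_density P hR hP 0),
        hcard]
      refine mul_le_mul_of_nonneg_right ?_ (by positivity)
      have h2 : (1 + (0 - 1) / R : ℝ) = -(1 / R) + 1 := by ring
      have h3 : -(N / R : ℝ) = N * -(1 / R) := by ring
      have h4 : (1 : ℝ) / R ≤ 1 := by rw [div_le_one (by positivity)]; exact hR'
      have h5 : (0 : ℝ) < 1 / R := by positivity
      rw [h3, Real.exp_nat_mul, h2]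
      refine (pow_le_pow_of_le_one (by linarith) (by linarith) hN).trans ?_
      exact pow_le_pow_left₀ (by linarith) (Real.add_one_le_exp _) _
    · simp only [hN, false_and, if_false, Finset.sum_const_zero]
      positivity
  refine (Finset.sum_le_sum fun e _ => key e).trans ?_
  rw [Finset.sum_const, nsmul_eq_mul, Finset.card_univ,
    Fintype.card_congr (Equiv.piEquivPiSubtypeProd p (fun _ => X)), Fintype.card_prod]
  push_cast
  exact le_of_eq (by ring)

end RandomFunctions

end SlidingSample

end

noncomputable section

namespace SlidingSample

/-! ### Cells and keys -/

section Keys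

variable {d : ℕ}

/-- A vector of numbers less than `B` as one number. -/
def vecKey (B : ℕ) (v : Fin d → ℕ) : ℕ := (List.finRange d).foldr (fun i e => v i + B * e) 0

theorem vecKey_eq_ofDigits (B : ℕ) (v : Fin d → ℕ) :
    vecKey B v = Nat.ofDigits B ((List.finRange d).map v) := by
  rw [vecKey, Nat.ofDigits_eq_foldr, List.foldr_map]
  simp

theorem vecKey_lt {B : ℕ} (hB : 1 < B) {v : Fin d → ℕ} (hv : ∀ i, v i < B) :
    vecKey B v < B ^ d := by
  rw [vecKey_eq_ofDigits]
  have := Nat.ofDigits_lt_base_pow_length (b := B) (l := (List.finRange d).map v) hB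
    (by simpa using hv)
  simpa using this

theorem vecKey_inj {B : ℕ} (hB : 1 < B) {v v' : Fin d → ℕ} (hv : ∀ i, v i < B)
    (hv' : ∀ i, v' i < B) (h : vecKey B v = vecKey B v') : v = v' := by
  rw [vecKey_eq_ofDigits, vecKey_eq_ofDigits] at h
  have := Nat.ofDigits_inj_of_len_eq hB (by simp) (by simpa using hv) (by simpa using hv') h
  funext i
  have h2 := List.map_inj_left.1 this
  exact h2 i (List.mem_finRange i)

/-- Each coordinate changes by at most `α`, which is `d` side lengths of a cell. -/
theorem cellCoord_le_add {α : ℝ} (hα : 0 < α) {x y : Pt d} (hy : ∀ i, 0 ≤ y i)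
    (h : dist x y ≤ α) (i : Fin d) : cellCoord α x i ≤ cellCoord α y i + d := by
  have h1 : x i - y i ≤ α := by
    have := PiLp.norm_apply_le (x - y) i
    rw [← dist_eq_norm] at this
    exact (le_abs_self _).trans (this.trans h)
  have h2 : x i * d / α ≤ y i * d / α + d := by
    rw [div_add' _ _ _ hα.ne']
    refine div_le_div_of_nonneg_right ?_ hα.le
    have : (0 : ℝ) ≤ d := by positivity
    nlinarith
  unfold cellCoord
  rw [← Nat.floor_add_natCast (by have := hy i; positivity)]
  exact Nat.floor_le_floor h2

/-- Each coordinate differs by at most `α / d`, so the distance is at most `α / √d`. -/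
theorem dist_le_of_cellCoord_eq (hd : 1 ≤ d) {α : ℝ} (hα : 0 < α) {x y : Pt d}
    (hx : ∀ i, 0 ≤ x i) (hy : ∀ i, 0 ≤ y i) (h : ∀ i, cellCoord α x i = cellCoord α y i) :
    dist x y ≤ α := by
  have hd' : (1 : ℝ) ≤ d := by exact_mod_cast hd
  have h1 : ∀ i, (x i - y i) ^ 2 ≤ (α / d) ^ 2 := by
    intro i
    rw [sq_le_sq, abs_of_pos (show 0 < α / d by positivity)]
    have hx' : 0 ≤ x i * d / α := by have := hx i; positivity
    have hy' : 0 ≤ y i * d / α := by have := hy i; positivity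
    have hi := h i
    unfold cellCoord at hi
    have a1 := Nat.floor_le hx'
    have a2 := Nat.lt_floor_add_one (x i * d / α)
    have a3 := Nat.floor_le hy'
    have a4 := Nat.lt_floor_add_one (y i * d / α)
    rw [hi] at a1 a2
    have h3 : |x i * d / α - y i * d / α| ≤ 1 := by
      rw [abs_le]; constructor <;> linarith
    have h4 : x i - y i = (x i * d / α - y i * d / α) * (α / d) := by field_simp
    rw [h4, abs_mul, abs_of_pos (show 0 < α / d by positivity)]
    have : 0 < α / d := by positivity
    nlinarith
  rw [EuclideanSpace.dist_eq]
  refine Real.sqrt_le_iff.2 ⟨hα.le, ?_⟩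
  calc ∑ i, dist (x i) (y i) ^ 2 ≤ ∑ _i : Fin d, (α / d) ^ 2 := by
        refine Finset.sum_le_sum fun i _ => ?_
        rw [Real.dist_eq, sq_abs]; exact h1 i
    _ = α ^ 2 / d := by
        rw [Finset.sum_const, Finset.card_univ, Fintype.card_fin, nsmul_eq_mul]; field_simp
    _ ≤ α ^ 2 := div_le_self (by positivity) hd'

end Keys

/-! ### Streams as sequences -/

namespace Stream

variable {d : ℕ} (I : Stream d)

/-- The points of a stream; beyond the end the first one is repeated. -/
def pt (k : ℕ) : Pt d := if h : k < I.m then I.p ⟨k, h⟩ else if h : 0 < I.m then I.p ⟨0, h⟩ else 0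

/-- The time stamps of a stream; beyond the end they go on increasing. -/
def stampSeq (mode : WindowModel) (k : ℕ) : ℕ :=
  if h : k < I.m then I.stamp mode ⟨k, h⟩ else I.m + I.T + 1 + k

/-- Two points are in the same group. -/
def Near (i j : ℕ) : Prop := dist (I.pt i) (I.pt j) ≤ I.α

/-- The lowest stamp in the window. -/
def windowStart (mode : WindowModel) (t : ℕ) : ℕ := I.clock mode t + 1 - I.w

variable {I}

theorem pt_of_lt {k : ℕ} (h : k < I.m) : I.pt k = I.p ⟨k, h⟩ := dif_pos h

theorem Admissible.pt_mem (hI : I.Admissible) (k : ℕ) : I.pt k ∈ Set.range I.p := by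
  have := hI.two_le_m
  unfold pt
  split_ifs with h h'
  · exact ⟨_, rfl⟩
  · exact ⟨_, rfl⟩
  · omega

theorem Admissible.near_equivalence (hI : I.Admissible) : Equivalence I.Near := by
  refine ⟨fun i => by simpa [Near] using hI.α_pos.le, fun {i j} h => by
    rw [Near, dist_comm]; exact h, fun {i j k} h h' => ?_⟩
  obtain ⟨β, hβ, hs⟩ := hI.wellSeparated
  rw [lt_div_iff₀ hI.α_pos] at hβ
  rcases hs _ (hI.pt_mem i) _ (hI.pt_mem k) with h1 | h1
  · exact h1
  · have := dist_triangle (I.pt i) (I.pt j) (I.pt k)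
    unfold Near at h h'
    linarith

theorem Admissible.stampSeq_strictMono (hI : I.Admissible) (mode : WindowModel) :
    StrictMono (I.stampSeq mode) := by
  have hle : ∀ i, I.stamp mode i ≤ I.m + I.T := by
    intro i
    cases mode with
    | sequenceBased => have := i.2; simp only [stamp]; omega
    | timeBased => have := hI.le_T i; simp only [stamp]; omega
  intro i j hij
  unfold stampSeq
  split_ifs with h1 h2 h2
  · cases mode with
    | sequenceBased => simpa [stamp] using hij
    | timeBased => exact hI.strictMono (by simpa using hij)
  · have := hle ⟨i, h1⟩; omega
  · omega
  · omega

theorem received_le (t : ℕ) : I.received t ≤ I.m := by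
  unfold received
  exact (Finset.card_le_univ _).trans (by simp)

theorem Admissible.lt_received_iff (hI : I.Admissible) (t : ℕ) (i : Fin I.m) :
    (i : ℕ) < I.received t ↔ I.τ i ≤ t := by
  unfold received
  constructor
  · intro h
    by_contra hc
    have hsub : (Finset.univ.filter fun j => I.τ j ≤ t) ⊆ Finset.Iio i := by
      intro j hj
      rw [Finset.mem_Iio]
      by_contra hji
      exact hc ((hI.strictMono.monotone (not_lt.1 hji)).trans (Finset.mem_filter.1 hj).2)
    have := Finset.card_le_card hsub
    simp at this
    omega
  · intro h
    have hsub : Finset.Iic i ⊆ (Finset.univ.filter fun j => I.τ j ≤ t) := by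
      intro j hj
      exact Finset.mem_filter.2 ⟨Finset.mem_univ _,
        (hI.strictMono.monotone (Finset.mem_Iic.1 hj)).trans h⟩
    have := Finset.card_le_card hsub
    simp at this
    omega

theorem Admissible.received_T (hI : I.Admissible) : I.received I.T = I.m := by
  unfold received
  rw [Finset.filter_true_of_mem fun i _ => hI.le_T i]
  simp

theorem Admissible.mem_window_iff (hI : I.Admissible) (mode : WindowModel) (t : ℕ) (x : Pt d) :
    x ∈ I.window mode t ↔
      ∃ i < I.received t, I.pt i = x ∧ I.windowStart mode t ≤ I.stampSeq mode i := by
  constructor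
  · rintro ⟨i, rfl, h1, h2⟩
    refine ⟨i, (hI.lt_received_iff t i).2 h1, by rw [pt_of_lt i.2], ?_⟩
    rw [stampSeq, dif_pos i.2, windowStart]
    change _ ≤ I.stamp mode i
    omega
  · rintro ⟨i, h1, rfl, h2⟩
    have hi : i < I.m := h1.trans_le (received_le t)
    refine ⟨⟨i, hi⟩, by rw [pt_of_lt hi], (hI.lt_received_iff t ⟨i, hi⟩).1 h1, ?_⟩
    rw [stampSeq, dif_pos hi, windowStart] at h2
    omega

theorem Admissible.stamp_le_clock (hI : I.Admissible) (mode : WindowModel) (t : ℕ) {i : ℕ}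
    (hi : i < I.received t) : I.stampSeq mode i ≤ I.clock mode t := by
  have him : i < I.m := hi.trans_le (received_le t)
  rw [stampSeq, dif_pos him]
  cases mode with
  | sequenceBased => simpa [stamp, clock] using hi
  | timeBased => exact (hI.lt_received_iff t ⟨i, him⟩).1 hi

/-- Distinct last points have distinct indices below `m` and distinct stamps among the `w` latest
values of the clock. This is why `⌈log₂ (min m w)⌉ + 1` levels suffice. -/
theorem Admissible.card_lasts_le (hI : I.Admissible) (mode : WindowModel) (t : ℕ) {a : ℕ}
    (ha : ∀ j < I.received t, I.windowStart mode t ≤ I.stampSeq mode j ↔ a ≤ j) :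
    (lasts I.Near a (I.received t)).card ≤ min I.m I.w := by
  refine le_min ?_ ?_
  · have hsub : lasts I.Near a (I.received t) ⊆ Finset.range (I.received t) := fun j hj =>
      Finset.mem_range.2 (mem_lasts.1 hj).2.1
    exact (Finset.card_le_card hsub).trans (by simpa using received_le t)
  · have : (lasts I.Near a (I.received t)).card ≤
        (Finset.Icc (I.windowStart mode t) (I.clock mode t)).card := by
      refine Finset.card_le_card_of_injOn (I.stampSeq mode) (fun j hj => ?_)
        (hI.stampSeq_strictMono mode).injective.injOn
      obtain ⟨h1, h2⟩ := mem_lasts.1 hj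
      simp only [Finset.coe_Icc, Set.mem_Icc]
      exact ⟨(ha j h2.1).2 h1, hI.stamp_le_clock mode t h2.1⟩
    refine this.trans ?_
    rw [Nat.card_Icc, windowStart]
    omega

/-- The groups of the window are the groups of the last points. -/
theorem Admissible.naturalPartition_window (hI : I.Admissible) (mode : WindowModel) (t : ℕ)
    {a : ℕ} (ha : ∀ j < I.received t, I.windowStart mode t ≤ I.stampSeq mode j ↔ a ≤ j) :
    naturalPartition I.α (I.window mode t) =
      (fun j => group I.α (I.window mode t) (I.pt j)) '' (lasts I.Near a (I.received t) : Set ℕ) ∧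
    Set.InjOn (fun j => group I.α (I.window mode t) (I.pt j))
      (lasts I.Near a (I.received t) : Set ℕ) ∧
    (∀ i ∈ lasts I.Near a (I.received t), ∀ j ∈ lasts I.Near a (I.received t),
      I.pt j ∈ group I.α (I.window mode t) (I.pt i) ↔ j = i) := by
  have hnear := hI.near_equivalence
  have hwin : ∀ j < I.received t, a ≤ j → I.pt j ∈ I.window mode t := fun j hj haj =>
    (hI.mem_window_iff mode t _).2 ⟨j, hj, rfl, (ha j hj).2 haj⟩
  have h3 : ∀ i ∈ lasts I.Near a (I.received t), ∀ j ∈ lasts I.Near a (I.received t),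
      I.pt j ∈ group I.α (I.window mode t) (I.pt i) ↔ j = i := by
    intro i hi j hj
    constructor
    · exact fun h => (lasts_injOn hnear i hi j hj h.2).symm
    · rintro rfl
      exact ⟨hwin j (mem_lasts.1 hj).2.1 (mem_lasts.1 hj).1, hnear.refl j⟩
  refine ⟨?_, ?_, h3⟩
  · ext G
    constructor
    · rintro ⟨x, hx, rfl⟩
      obtain ⟨i, hi, rfl, hi'⟩ := (hI.mem_window_iff mode t _).1 hx
      obtain ⟨j, hj, hn, hij⟩ := exists_isLast hnear hi
      refine ⟨j, mem_lasts.2 ⟨((ha i hi).1 hi').trans hij, hj⟩, ?_⟩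
      ext y
      constructor
      · rintro ⟨hy, hy'⟩
        obtain ⟨l, -, rfl, -⟩ := (hI.mem_window_iff mode t _).1 hy
        exact ⟨hy, hnear.trans hn hy'⟩
      · rintro ⟨hy, hy'⟩
        obtain ⟨l, -, rfl, -⟩ := (hI.mem_window_iff mode t _).1 hy
        exact ⟨hy, hnear.trans (hnear.symm hn) hy'⟩
    · rintro ⟨j, hj, rfl⟩
      exact ⟨_, hwin j (mem_lasts.1 hj).2.1 (mem_lasts.1 hj).1, rfl⟩
  · intro i hi j hj hij
    refine ((h3 i hi j hj).1 ?_).symm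
    change group _ _ _ = group _ _ _ at hij
    rw [hij]
    exact (h3 j hj j hj).2 rfl

theorem Admissible.pt_nonneg (hI : I.Admissible) (k : ℕ) (i : Fin d) : 0 ≤ I.pt k i := by
  obtain ⟨j, hj⟩ := hI.pt_mem k
  rw [← hj]
  exact (hI.coord_mem j i).1

theorem Admissible.cellCoord_lt (hI : I.Admissible) (k : ℕ) (i : Fin d) :
    cellCoord I.α (I.pt k) i < I.gridSize := by
  obtain ⟨j, hj⟩ := hI.pt_mem k
  rw [← hj]
  have h := (hI.coord_mem j i).2
  unfold cellCoord gridSize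
  refine Nat.lt_succ_iff.2 (Nat.floor_le_floor ?_)
  refine div_le_div_of_nonneg_right ?_ hI.α_pos.le
  have : (0 : ℝ) ≤ d := by positivity
  nlinarith

theorem Admissible.near_of_cellCoord_eq (hI : I.Admissible) (hd : 1 ≤ d) {i j : ℕ}
    (h : ∀ l, cellCoord I.α (I.pt i) l = cellCoord I.α (I.pt j) l) : I.Near i j :=
  dist_le_of_cellCoord_eq hd hI.α_pos (hI.pt_nonneg i) (hI.pt_nonneg j) h

theorem Admissible.cellCoord_le_of_near (hI : I.Admissible) {i j : ℕ} (h : I.Near i j)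
    (l : Fin d) : cellCoord I.α (I.pt i) l ≤ cellCoord I.α (I.pt j) l + d :=
  cellCoord_le_add hI.α_pos (hI.pt_nonneg j) h l

end Stream

end SlidingSample

end

noncomputable section

namespace SlidingSample

/-! ### Sampled cells -/

/-- A function from words to words, applied to a number. -/
def applyHash {b : ℕ} (h : Fin (2 ^ b) → Fin (2 ^ b)) (x : ℕ) : ℕ :=
  h ⟨x % 2 ^ b, Nat.mod_lt _ (by positivity)⟩

/-- The density is exactly `2 ^ (-l)` because the number of words is a power of `2`; this requires
`l ≤ b`. -/
theorem card_filter_dvd {b l : ℕ} (hl : l ≤ b) :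
    (Finset.univ.filter fun v : Fin (2 ^ b) => 2 ^ l ∣ (v : ℕ)).card * 2 ^ l =
      Fintype.card (Fin (2 ^ b)) := by
  have h1 : (Finset.univ.filter fun v : Fin (2 ^ b) => 2 ^ l ∣ (v : ℕ)).card = 2 ^ (b - l) := by
    rw [← Fintype.card_fin (2 ^ (b - l)), ← Finset.card_univ]
    have hlt : ∀ u : Fin (2 ^ (b - l)), (u : ℕ) * 2 ^ l < 2 ^ b := by
      intro u
      calc (u : ℕ) * 2 ^ l < 2 ^ (b - l) * 2 ^ l :=
            Nat.mul_lt_mul_of_pos_right u.2 (by positivity)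
        _ = 2 ^ b := by rw [← pow_add, Nat.sub_add_cancel hl]
    symm
    refine Finset.card_bij (fun u _ => ⟨(u : ℕ) * 2 ^ l, hlt u⟩) ?_ ?_ ?_
    · intro u _
      simp
    · intro u _ v _ huv
      have h2 : (u : ℕ) * 2 ^ l = (v : ℕ) * 2 ^ l := by simpa using huv
      exact Fin.ext (Nat.eq_of_mul_eq_mul_right (by positivity) h2)
    · intro v hv
      obtain ⟨u, hu⟩ := (Finset.mem_filter.1 hv).2
      refine ⟨⟨u, ?_⟩, Finset.mem_univ _, ?_⟩
      · have := v.2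
        rw [hu, ← Nat.sub_add_cancel hl, pow_add, mul_comm] at this
        simpa using lt_of_mul_lt_mul_right this (Nat.zero_le _)
      · exact Fin.ext (by change u * 2 ^ l = (v : ℕ); rw [hu, mul_comm])
  rw [h1, ← pow_add, Nat.sub_add_cancel hl, Fintype.card_fin]

variable {d : ℕ}

namespace Stream

variable (I : Stream d)

/-- The base in which cells are coded. -/
def base : ℕ := I.gridSize + 2 * d

/-- The key with tag `τ` for the cell of `x`, moved by `o - d`. -/
def key (τ : ℕ) (x : Pt d) (o : Fin d → ℕ) : ℕ :=
  2 * vecKey I.base (fun i => cellCoord I.α x i + o i) + τ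

/-- The cell of point `i` is sampled with rate `1 / R`. -/
def Accepted (H : ℕ → ℕ) (τ R i : ℕ) : Prop := R ∣ H (I.key τ (I.pt i) fun _ => d)

/-- A cell near point `i` is sampled. -/
def Touched (H : ℕ → ℕ) (τ R i : ℕ) : Prop :=
  ∃ o : Fin d → Fin (2 * d + 1), R ∣ H (I.key τ (I.pt i) fun l => o l)

/-- Some point of the group of point `j` has a sampled cell near it. -/
def GroupTouched (H : ℕ → ℕ) (τ R j : ℕ) : Prop := ∃ x, I.Near j x ∧ I.Touched H τ R x

variable {I}

/-- The cell of `j` is among the cells inspected around `i`, since the two cells differ by at most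
`d` per coordinate. This is the implication from `acc` to `nb` on which all the list invariants
rest. -/
theorem Admissible.touched_of_accepted (hI : I.Admissible) (H : ℕ → ℕ) (τ R : ℕ) (i j : ℕ)
    (h : I.Near i j) (ha : I.Accepted H τ R j) : I.Touched H τ R i := by
  refine ⟨fun l => ⟨cellCoord I.α (I.pt j) l + d - cellCoord I.α (I.pt i) l, ?_⟩, ?_⟩
  · have := hI.cellCoord_le_of_near (hI.near_equivalence.symm h) l
    omega
  · have h1 : (fun l => cellCoord I.α (I.pt i) l +
        (cellCoord I.α (I.pt j) l + d - cellCoord I.α (I.pt i) l)) =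
        fun l => cellCoord I.α (I.pt j) l + d := by
      funext l
      have := hI.cellCoord_le_of_near h l
      omega
    unfold Accepted key at ha
    unfold key
    simp only [h1]
    exact ha

theorem Admissible.one_lt_base (hd : 1 ≤ d) : 1 < I.base := by
  unfold base gridSize; omega

theorem Admissible.cell_add_lt_base (hI : I.Admissible) (i : ℕ) {o : Fin d → ℕ}
    (ho : ∀ l, o l < 2 * d + 1) (l : Fin d) : cellCoord I.α (I.pt i) l + o l < I.base := by
  have := hI.cellCoord_lt i l
  have := ho l
  unfold base; omega

theorem Admissible.key_lt (hI : I.Admissible) (hd : 1 ≤ d) {b : ℕ}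
    (hb : 2 * I.base ^ d ≤ 2 ^ b) {τ : ℕ} (hτ : τ < 2) (i : ℕ) {o : Fin d → ℕ}
    (ho : ∀ l, o l < 2 * d + 1) : I.key τ (I.pt i) o < 2 ^ b := by
  have := vecKey_lt (Admissible.one_lt_base (I := I) hd) (hI.cell_add_lt_base i ho)
  unfold key; omega

theorem Admissible.cell_eq_of_key_eq (hI : I.Admissible) (hd : 1 ≤ d) {τ i j : ℕ}
    {o o' : Fin d → ℕ} (ho : ∀ l, o l < 2 * d + 1) (ho' : ∀ l, o' l < 2 * d + 1)
    (h : I.key τ (I.pt i) o = I.key τ (I.pt j) o') (l : Fin d) :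
    cellCoord I.α (I.pt i) l + o l = cellCoord I.α (I.pt j) l + o' l :=
  congrFun (vecKey_inj (Admissible.one_lt_base (I := I) hd) (hI.cell_add_lt_base i ho)
    (hI.cell_add_lt_base j ho') (by unfold key at h; omega)) l

/-- One cell never meets two groups. Hence last points of different groups have different keys, and
with a common tag their acceptances are independent events. -/
theorem Admissible.near_of_key_eq (hI : I.Admissible) (hd : 1 ≤ d) {τ i j : ℕ}
    (h : I.key τ (I.pt i) (fun _ => d) = I.key τ (I.pt j) (fun _ => d)) : I.Near i j :=
  hI.near_of_cellCoord_eq hd fun l => by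
    have := hI.cell_eq_of_key_eq hd (fun _ => by omega) (fun _ => by omega) h l
    omega

section Probability

variable {b : ℕ}

/-- A key as a word. -/
def keyWord (b x : ℕ) : Fin (2 ^ b) := ⟨x % 2 ^ b, Nat.mod_lt _ (by positivity)⟩

theorem keyWord_inj {x y : ℕ} (hx : x < 2 ^ b) (hy : y < 2 ^ b)
    (h : keyWord b x = keyWord b y) : x = y := by
  have := congrArg Fin.val h
  simpa [keyWord, Nat.mod_eq_of_lt hx, Nat.mod_eq_of_lt hy] using this

open Classical in
theorem Admissible.card_few_accepted (hI : I.Admissible) (hd : 1 ≤ d)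
    (hb : 2 * I.base ^ d ≤ 2 ^ b) {τ : ℕ} (hτ : τ < 2) {l : ℕ} (hl : l ≤ b) (a k T : ℕ) :
    ((Finset.univ.filter fun h : Fin (2 ^ b) → Fin (2 ^ b) =>
      ((lasts I.Near a k).filter (I.Accepted (applyHash h) τ (2 ^ l))).card ≤ T).card : ℝ) ≤
      2 ^ T * Real.exp (-((lasts I.Near a k).card / (2 * (2 ^ l : ℕ)))) *
        Fintype.card (Fin (2 ^ b) → Fin (2 ^ b)) := by
  set g : ℕ → Fin (2 ^ b) := fun i => keyWord b (I.key τ (I.pt i) fun _ => d)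
  have hinj : Set.InjOn g (lasts I.Near a k) := by
    intro i hi j hj hij
    refine lasts_injOn hI.near_equivalence i hi j hj (hI.near_of_key_eq hd (τ := τ) ?_)
    exact keyWord_inj (hI.key_lt hd hb hτ i fun _ => by omega)
      (hI.key_lt hd hb hτ j fun _ => by omega) hij
  have h := card_few_le (fun v : Fin (2 ^ b) => 2 ^ l ∣ (v : ℕ)) (R := 2 ^ l) (by positivity)
    (card_filter_dvd hl) ((lasts I.Near a k).image g) T
  rw [Finset.card_image_of_injOn hinj] at h
  refine le_trans (le_of_eq ?_) h
  congr 2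
  ext h
  rw [Finset.mem_filter, Finset.mem_filter, Finset.filter_image,
    Finset.card_image_of_injOn (hinj.mono fun x hx => (Finset.mem_filter.1 hx).1)]
  convert Iff.rfl
  exact Iff.rfl

-- A touched group has a sampled cell within `2 d` of the cell of its last point in each coordinate,
-- which leaves `(4 * d + 1) ^ d` candidates. Conversely one cell can serve at most `(4 * d + 1) ^
-- d` groups. So many touched groups force many sampled words in a set that is not much larger than
-- the number of groups.
open Classical in
theorem Admissible.card_many_touched (hI : I.Admissible) (hd : 1 ≤ d)
    (hb : 2 * I.base ^ d ≤ 2 ^ b) {τ : ℕ} (hτ : τ < 2) {l : ℕ} (hl : l ≤ b) (a k T : ℕ) :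
    ((Finset.univ.filter fun h : Fin (2 ^ b) → Fin (2 ^ b) =>
      (4 * d + 1) ^ d * T ≤
        ((lasts I.Near a k).filter (I.GroupTouched (applyHash h) τ (2 ^ l))).card).card : ℝ) ≤
      (1 / 2) ^ T * Real.exp (((4 * d + 1) ^ d * (lasts I.Near a k).card : ℕ) / (2 ^ l : ℕ)) *
        Fintype.card (Fin (2 ^ b) → Fin (2 ^ b)) := by
  -- The candidates: cells displaced by `z.2 - 2 d` from that of the last point. Keys already shift
  -- cells by `+ d`, so only `d` is subtracted here.
  set U : Finset (Fin (2 ^ b)) := ((lasts I.Near a k) ×ˢ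
    (Finset.univ : Finset (Fin d → Fin (4 * d + 1)))).image fun z => keyWord b
      (2 * vecKey I.base (fun i => cellCoord I.α (I.pt z.1) i + z.2 i - d) + τ)
  have hU : U.card ≤ (4 * d + 1) ^ d * (lasts I.Near a k).card := by
    refine Finset.card_image_le.trans ?_
    rw [Finset.card_product, mul_comm]
    simp
  have h := card_many_le (fun v : Fin (2 ^ b) => 2 ^ l ∣ (v : ℕ)) (R := 2 ^ l) (by positivity)
    (card_filter_dvd hl) U T
  refine le_trans ?_ (h.trans ?_)
  · refine Nat.cast_le.2 (Finset.card_le_card fun h hh => ?_)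
    rw [Finset.mem_filter] at hh ⊢
    refine ⟨Finset.mem_univ _, ?_⟩
    have hex : ∀ j, I.GroupTouched (applyHash h) τ (2 ^ l) j →
        ∃ x, ∃ o : Fin d → Fin (2 * d + 1), I.Near j x ∧
          2 ^ l ∣ applyHash h (I.key τ (I.pt x) fun l => o l) := by
      rintro j ⟨x, hx, o, ho⟩
      exact ⟨x, o, hx, ho⟩
    choose! x o hxo using hex
    have hoff : ∀ j, I.GroupTouched (applyHash h) τ (2 ^ l) j → ∀ i,
        cellCoord I.α (I.pt (x j)) i + o j i + d - cellCoord I.α (I.pt j) i < 4 * d + 1 := by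
      intro j hj i
      have := hI.cellCoord_le_of_near (hI.near_equivalence.symm (hxo j hj).1) i
      have := (o j i).2
      omega
    have hoff' : ∀ j, I.GroupTouched (applyHash h) τ (2 ^ l) j → ∀ i,
        cellCoord I.α (I.pt j) i ≤ cellCoord I.α (I.pt (x j)) i + d := fun j hj i =>
      hI.cellCoord_le_of_near (hxo j hj).1 i
    have hcard : ((lasts I.Near a k).filter (I.GroupTouched (applyHash h) τ (2 ^ l))).card ≤
        ((U.filter fun κ => 2 ^ l ∣ (h κ : ℕ)) ×ˢ
          (Finset.univ : Finset (Fin d → Fin (4 * d + 1)))).card := by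
      -- A sampled cell together with its displacement from the cell of the last point recovers the
      -- latter cell, hence the group.
      refine Finset.card_le_card_of_injOn (fun j => (keyWord b (I.key τ (I.pt (x j)) fun l => o j l),
        fun i => Fin.ofNat (4 * d + 1)
          (cellCoord I.α (I.pt (x j)) i + o j i + d - cellCoord I.α (I.pt j) i))) ?_ ?_
      · intro j hj
        obtain ⟨hj1, hj2⟩ := Finset.mem_filter.1 hj
        simp only [Finset.coe_product, Set.mem_prod, Finset.mem_coe, Finset.mem_univ, and_true,
          Finset.mem_filter]
        refine ⟨?_, (hxo j hj2).2⟩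
        refine Finset.mem_image.2 ⟨(j, fun i => Fin.ofNat (4 * d + 1)
          (cellCoord I.α (I.pt (x j)) i + o j i + d - cellCoord I.α (I.pt j) i)),
          by simpa using hj1, ?_⟩
        simp only [Fin.val_ofNat, Nat.mod_eq_of_lt (hoff j hj2 _)]
        unfold key
        congr 3
        congr 1
        funext i
        have := hoff' j hj2 i
        change cellCoord I.α (I.pt j) i + (cellCoord I.α (I.pt (x j)) i + (o j i : ℕ) + d -
          cellCoord I.α (I.pt j) i) - d = cellCoord I.α (I.pt (x j)) i + (o j i : ℕ)
        omega
      · intro j hj j' hj' hjj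
        obtain ⟨hj1, hj2⟩ := Finset.mem_filter.1 hj
        obtain ⟨hj1', hj2'⟩ := Finset.mem_filter.1 hj'
        simp only [Prod.mk.injEq] at hjj
        have e1 := keyWord_inj (hI.key_lt hd hb hτ (x j) fun l => (o j l).2)
          (hI.key_lt hd hb hτ (x j') fun l => (o j' l).2) hjj.1
        have e2 := hI.cell_eq_of_key_eq hd (fun l => (o j l).2) (fun l => (o j' l).2) e1
        refine lasts_injOn hI.near_equivalence j hj1 j' hj1' (hI.near_of_cellCoord_eq hd fun i => ?_)
        have e3 := congrArg Fin.val (congrFun hjj.2 i)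
        simp only [Fin.val_ofNat, Nat.mod_eq_of_lt (hoff j hj2 _),
          Nat.mod_eq_of_lt (hoff j' hj2' _)] at e3
        have e4 := e2 i
        have := hoff' j hj2 i
        have := hoff' j' hj2' i
        omega
    rw [Finset.card_product] at hcard
    have h1 := hh.2.trans hcard
    simp only [Finset.card_univ, Fintype.card_pi, Fintype.card_fin, Finset.prod_const] at h1
    rw [mul_comm] at h1
    exact Nat.le_of_mul_le_mul_right h1 (by positivity)
  · refine mul_le_mul_of_nonneg_right ?_ (by positivity)
    refine mul_le_mul_of_nonneg_left (Real.exp_le_exp.2 ?_) (by positivity)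
    refine div_le_div_of_nonneg_right (by exact_mod_cast hU) (by positivity)

/-- The cuts at rate `1 / R`. -/
def levelCuts (I : Stream d) (mode : WindowModel) (K : ℕ) (H : ℕ → ℕ) (R : ℕ) : ℕ → ℕ :=
  cuts I.Near (I.stampSeq mode) K (initFlag (I.Accepted H 0 R) (I.Touched H 0 R))

/-- The representatives at rate `1 / R`. -/
def levelRep (I : Stream d) (mode : WindowModel) (K : ℕ) (H : ℕ → ℕ) (R : ℕ) : ℕ → ℕ :=
  rep I.Near (I.stampSeq mode) (levelCuts I mode K H R)

/-- Keys with tag `0` are even and remain so modulo `2 ^ b`, so hash values at odd words are never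
consulted. Everything derived from the first lists, namely cuts, representatives and the level of a
query, inherits this. -/
theorem initFlag_congr {h h' : Fin (2 ^ b) → Fin (2 ^ b)}
    (hbpos : 0 < b) (hh : ∀ κ : Fin (2 ^ b), (κ : ℕ) % 2 ≠ 1 → h κ = h' κ) (R : ℕ) :
    initFlag (I.Accepted (applyHash h) 0 R) (I.Touched (applyHash h) 0 R) =
      initFlag (I.Accepted (applyHash h') 0 R) (I.Touched (applyHash h') 0 R) := by
  have hk : ∀ x o, applyHash h (I.key 0 x o) = applyHash h' (I.key 0 x o) := by
    intro x o
    unfold applyHash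
    rw [hh]
    have h2 : 2 ∣ 2 ^ b := dvd_pow_self 2 hbpos.ne'
    change (2 * _ + 0) % 2 ^ b % 2 ≠ 1
    rw [Nat.mod_mod_of_dvd _ h2]
    omega
  unfold Accepted Touched
  simp_rw [hk]

theorem levelCuts_congr {mode : WindowModel} {K : ℕ} {h h' : Fin (2 ^ b) → Fin (2 ^ b)}
    (hbpos : 0 < b) (hh : ∀ κ : Fin (2 ^ b), (κ : ℕ) % 2 ≠ 1 → h κ = h' κ) (R : ℕ) :
    levelCuts I mode K (applyHash h) R = levelCuts I mode K (applyHash h') R := by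
  unfold levelCuts
  rw [initFlag_congr hbpos hh]

theorem levelRep_congr {mode : WindowModel} {K : ℕ} {h h' : Fin (2 ^ b) → Fin (2 ^ b)}
    (hbpos : 0 < b) (hh : ∀ κ : Fin (2 ^ b), (κ : ℕ) % 2 ≠ 1 → h κ = h' κ) (R : ℕ) :
    levelRep I mode K (applyHash h) R = levelRep I mode K (applyHash h') R := by
  unfold levelRep
  rw [levelCuts_congr hbpos hh]

/-- The word with the key of the representative of point `j`. -/
def repWord (I : Stream d) (mode : WindowModel) (K b : ℕ) (H : ℕ → ℕ) (R j : ℕ) : Fin (2 ^ b) :=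
  keyWord b (I.key 1 (I.pt (levelRep I mode K H R j)) fun _ => d)

theorem Admissible.repWord_injOn (hI : I.Admissible) (hd : 1 ≤ d) (hb : 2 * I.base ^ d ≤ 2 ^ b)
    (mode : WindowModel) (K : ℕ) (H : ℕ → ℕ) (R a k : ℕ) :
    Set.InjOn (repWord I mode K b H R) (lasts I.Near a k) := by
  intro i hi j hj hij
  have hn := hI.near_equivalence
  have h1 : I.Near (levelRep I mode K H R i) (levelRep I mode K H R j) := by
    refine hI.near_of_key_eq hd (τ := 1) ?_
    exact keyWord_inj (hI.key_lt hd hb (by omega) _ fun _ => by omega)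
      (hI.key_lt hd hb (by omega) _ fun _ => by omega) hij
  exact lasts_injOn hn i hi j hj
    (hn.trans (near_rep hn _ i) (hn.trans h1 (hn.symm (near_rep hn _ j))))

theorem repWord_odd (hbpos : 0 < b) (mode : WindowModel) (K : ℕ) (H : ℕ → ℕ) (R j : ℕ) :
    (repWord I mode K b H R j : ℕ) % 2 = 1 := by
  have h2 : 2 ∣ 2 ^ b := dvd_pow_self 2 hbpos.ne'
  change (2 * _ + 1) % 2 ^ b % 2 = 1
  rw [Nat.mod_mod_of_dvd _ h2]
  omega

-- The keys of the representatives are odd, distinct for distinct groups, and determined by the even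
-- hash values. Given the latter, they are a fixed set of fresh independent values.
open Classical in
theorem Admissible.card_none_accepted (hI : I.Admissible) (hd : 1 ≤ d)
    (hb : 2 * I.base ^ d ≤ 2 ^ b) (hbpos : 0 < b) (mode : WindowModel) (K : ℕ) {l : ℕ}
    (hl : l ≤ b) (a k : ℕ) :
    ((Finset.univ.filter fun h : Fin (2 ^ b) → Fin (2 ^ b) =>
      ∀ j ∈ lasts I.Near a k, ¬ I.Accepted (applyHash h) 1 (2 ^ l)
        (levelRep I mode K (applyHash h) (2 ^ l) j)).card : ℝ) ≤
      Real.exp (-((lasts I.Near a k).card / (2 ^ l : ℕ))) *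
        Fintype.card (Fin (2 ^ b) → Fin (2 ^ b)) := by
  refine card_none_le (fun v : Fin (2 ^ b) => 2 ^ l ∣ (v : ℕ)) (R := 2 ^ l) (by positivity)
    (card_filter_dvd hl) (fun κ : Fin (2 ^ b) => (κ : ℕ) % 2 = 1)
    (fun h => (lasts I.Near a k).image (repWord I mode K b (applyHash h) (2 ^ l)))
    (fun h κ hκ => by
      obtain ⟨j, -, rfl⟩ := Finset.mem_image.1 hκ
      exact repWord_odd hbpos mode K _ _ j)
    (fun h h' hh => by
      have : repWord I mode K b (applyHash h) (2 ^ l) = repWord I mode K b (applyHash h') (2 ^ l) := by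
        funext j
        unfold repWord
        rw [levelRep_congr hbpos hh]
      rw [this]) (lasts I.Near a k).card _ fun h hh => ?_
  rw [Finset.mem_filter] at hh
  refine ⟨?_, fun κ hκ => ?_⟩
  · rw [Finset.card_image_of_injOn (hI.repWord_injOn hd hb mode K _ _ a k)]
  · obtain ⟨j, hj, rfl⟩ := Finset.mem_image.1 hκ
    exact hh.2 j hj

end Probability

end Stream

end SlidingSample

end

/-! ### Implementation: the program computes the lists for every hash function. -/

noncomputable section

namespace SlidingSample

variable {d : ℕ}

/-! ### Running programs -/

/-- The program `P`, started in `s`, halts in a state with property `Q`. -/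
def Runs (E : Env d) (P : Prog d) (s : State d) (Q : State d → Prop) : Prop :=
  ∃ s', Exec E P s s' ∧ Q s'

/-- Determinism: a claim about all final states follows from the one run that is exhibited. -/
theorem Exec.unique {E : Env d} {P : Prog d} {s s₁ s₂ : State d} (h₁ : Exec E P s s₁)
    (h₂ : Exec E P s s₂) : s₁ = s₂ := by
  induction h₁ generalizing s₂ with
  | skip s => cases h₂; rfl
  | setWord a v s => cases h₂; rfl
  | copyPoint a b s => cases h₂; rfl
  | random a k s => cases h₂; rfl
  | seq _ _ ih₁ ih₂ =>
    cases h₂ with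
    | seq h h' => rw [← ih₁ h] at h'; exact ih₂ h'
  | ite_true he _ ih =>
    cases h₂ with
    | ite_true _ h => exact ih h
    | ite_false he' _ => exact absurd he' he
  | ite_false he _ ih =>
    cases h₂ with
    | ite_true he' _ => exact absurd he he'
    | ite_false _ h => exact ih h
  | while_true he _ _ ih₁ ih₂ =>
    cases h₂ with
    | while_true _ h h' => rw [← ih₁ h] at h'; exact ih₂ h'
    | while_false he' => exact absurd he' he
  | while_false he =>
    cases h₂ with
    | while_true he' _ _ => exact absurd he he'
    | while_false _ => rfl

namespace Runs

variable {E : Env d} {P P' : Prog d} {s : State d} {Q Q' : State d → Prop}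

theorem mono (h : Runs E P s Q) (hQ : ∀ s', Q s' → Q' s') : Runs E P s Q' := by
  obtain ⟨s', h1, h2⟩ := h
  exact ⟨s', h1, hQ _ h2⟩

theorem seq (h : Runs E P s fun s' => Runs E P' s' Q) : Runs E (.seq P P') s Q := by
  obtain ⟨s₁, h1, s₂, h2, h3⟩ := h
  exact ⟨s₂, .seq h1 h2, h3⟩

theorem skip (h : Q (s.tick 1)) : Runs E .skip s Q := ⟨_, .skip s, h⟩

theorem setWord {a v : Expr d}
    (h : Q ((s.setWord (a.eval E s) (v.eval E s)).tick (a.cost + v.cost + 1))) :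
    Runs E (.setWord a v) s Q := ⟨_, .setWord a v s, h⟩

theorem copyPoint {a b : Expr d}
    (h : Q ((s.setPoint (a.eval E s) (s.point (b.eval E s))).tick (a.cost + b.cost + 1))) :
    Runs E (.copyPoint a b) s Q := ⟨_, .copyPoint a b s, h⟩

theorem ite_pos {e : Expr d} (he : e.eval E s ≠ 0) (h : Runs E P (s.tick (e.cost + 1)) Q) :
    Runs E (.ite e P P') s Q := by
  obtain ⟨s', h1, h2⟩ := h
  exact ⟨s', .ite_true he h1, h2⟩

theorem ite_neg {e : Expr d} (he : e.eval E s = 0) (h : Runs E P' (s.tick (e.cost + 1)) Q) :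
    Runs E (.ite e P P') s Q := by
  obtain ⟨s', h1, h2⟩ := h
  exact ⟨s', .ite_false he h1, h2⟩

theorem while_pos {e : Expr d} (he : e.eval E s ≠ 0)
    (h : Runs E P (s.tick (e.cost + 1)) fun s' => Runs E (.while e P) s' Q) :
    Runs E (.while e P) s Q := by
  obtain ⟨s₁, h1, s₂, h2, h3⟩ := h
  exact ⟨s₂, .while_true he h1 h2, h3⟩

theorem while_neg {e : Expr d} (he : e.eval E s = 0) (h : Q (s.tick (e.cost + 1))) :
    Runs E (.while e P) s Q := ⟨_, .while_false he, h⟩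

end Runs

namespace State

variable (s : State d) (a b v n : ℕ) (x : Option (Pt d))

@[simp] theorem tick_word : (s.tick n).word = s.word := rfl
@[simp] theorem tick_point : (s.tick n).point = s.point := rfl
@[simp] theorem tick_wordsUsed : (s.tick n).wordsUsed = s.wordsUsed := rfl
@[simp] theorem tick_pointsUsed : (s.tick n).pointsUsed = s.pointsUsed := rfl
@[simp] theorem tick_steps : (s.tick n).steps = s.steps + n := rfl
@[simp] theorem tick_drawn : (s.tick n).drawn = s.drawn := rfl
@[simp] theorem setWord_word : (s.setWord a v).word b = if b = a then v else s.word b := by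
  simp [setWord, Function.update_apply]
@[simp] theorem setWord_point : (s.setWord a v).point = s.point := rfl
@[simp] theorem setWord_wordsUsed : (s.setWord a v).wordsUsed = max s.wordsUsed (a + 1) := rfl
@[simp] theorem setWord_pointsUsed : (s.setWord a v).pointsUsed = s.pointsUsed := rfl
@[simp] theorem setWord_steps : (s.setWord a v).steps = s.steps := rfl
@[simp] theorem setWord_drawn : (s.setWord a v).drawn = s.drawn := rfl
@[simp] theorem setPoint_word : (s.setPoint a x).word = s.word := rfl
@[simp] theorem setPoint_point :
    (s.setPoint a x).point b = if b = a then x else s.point b := by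
  simp [setPoint, Function.update_apply]
@[simp] theorem setPoint_wordsUsed : (s.setPoint a x).wordsUsed = s.wordsUsed := rfl
@[simp] theorem setPoint_pointsUsed :
    (s.setPoint a x).pointsUsed = max s.pointsUsed (a + 1) := rfl
@[simp] theorem setPoint_steps : (s.setPoint a x).steps = s.steps := rfl
@[simp] theorem setPoint_drawn : (s.setPoint a x).drawn = s.drawn := rfl

/-- From `s` to `s'` at most `n` steps were made and only the cells below `Y` were used. -/
structure Within (s s' : State d) (Y n : ℕ) : Prop where
  words : s'.wordsUsed ≤ max s.wordsUsed (4 * Y)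
  points : s'.pointsUsed ≤ max s.pointsUsed Y
  steps : s'.steps ≤ s.steps + n
  drawn : s'.drawn = s.drawn

theorem Within.trans {s s' s'' : State d} {Y n n' : ℕ} (h : Within s s' Y n)
    (h' : Within s' s'' Y n') : Within s s'' Y (n + n') := by
  have h1 := h.words; have h2 := h.points; have h3 := h.steps
  have h1' := h'.words; have h2' := h'.points; have h3' := h'.steps
  exact ⟨by omega, by omega, by omega, h'.drawn.trans h.drawn⟩

theorem Within.mono {s s' : State d} {Y Y' n n' : ℕ} (h : Within s s' Y n) (hY : Y ≤ Y')
    (hn : n ≤ n') : Within s s' Y' n' := by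
  have h1 := h.words; have h2 := h.points; have h3 := h.steps
  exact ⟨by omega, by omega, by omega, h.drawn⟩

end State

/-! ### Expressions -/

/-- The content of word `n`. -/
def var (n : ℕ) : Expr d := .word (.lit n)

/-- The address of field `f` of the cell whose number is in word `x`. -/
def fieldAddr (f x : ℕ) : Expr d := .add (.mul (.lit 4) (var x)) (.lit f)

/-- The content of field `f` of the cell whose number is in word `x`. -/
def field (f x : ℕ) : Expr d := .word (fieldAddr f x)

section Eval

variable {E : Env d} {s : State d}

theorem eval_lit {n : ℕ} (h : n < 2 ^ E.bits) : (Expr.lit n : Expr d).eval E s = n :=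
  Nat.mod_eq_of_lt h

theorem eval_var {n : ℕ} (h : n < 2 ^ E.bits) : (var n : Expr d).eval E s = s.word n := by
  rw [var, Expr.eval, eval_lit h]

theorem eval_add {a b : Expr d} {u v : ℕ} (ha : a.eval E s = u) (hb : b.eval E s = v)
    (h : u + v < 2 ^ E.bits) : (a.add b).eval E s = u + v := by
  rw [Expr.eval, ha, hb, Nat.mod_eq_of_lt h]

theorem eval_mul {a b : Expr d} {u v : ℕ} (ha : a.eval E s = u) (hb : b.eval E s = v)
    (h : u * v < 2 ^ E.bits) : (a.mul b).eval E s = u * v := by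
  rw [Expr.eval, ha, hb, Nat.mod_eq_of_lt h]

theorem eval_sub {a b : Expr d} {u v : ℕ} (ha : a.eval E s = u) (hb : b.eval E s = v) :
    (a.sub b).eval E s = u - v := by
  rw [Expr.eval, ha, hb]

theorem eval_lt {a b : Expr d} {u v : ℕ} (hE : 1 < 2 ^ E.bits) (ha : a.eval E s = u)
    (hb : b.eval E s = v) : (a.lt b).eval E s = if u < v then 1 else 0 := by
  rw [Expr.eval, ha, hb, Nat.mod_eq_of_lt]
  split_ifs <;> omega

theorem eval_fieldAddr {f x z : ℕ} (hE : 64 ≤ 2 ^ E.bits) (hx : x < 64) (hz : s.word x = z)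
    (h : 4 * z + 4 ≤ 2 ^ E.bits) (hf : f < 4) :
    (fieldAddr f x : Expr d).eval E s = 4 * z + f :=
  eval_add (eval_mul (eval_lit (by omega)) ((eval_var (by omega)).trans hz) (by omega))
    (eval_lit (by omega)) (by omega)

theorem eval_field {f x z : ℕ} (hE : 64 ≤ 2 ^ E.bits) (hx : x < 64) (hz : s.word x = z)
    (h : 4 * z + 4 ≤ 2 ^ E.bits) (hf : f < 4) :
    (field f x : Expr d).eval E s = s.word (4 * z + f) := by
  rw [field, Expr.eval, eval_fieldAddr hE hx hz h hf]

theorem eval_congr {s' : State d} (hw : s'.word = s.word) (hp : s'.point = s.point)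
    (e : Expr d) : e.eval E s' = e.eval E s := by
  induction e with
  | adj a b iha ihb =>
    have h : (fun i : Fin d => s'.word (b.eval E s' + i)) =
        fun i : Fin d => s.word (b.eval E s + i) := by rw [hw, ihb]
    rw [Expr.eval, Expr.eval, hp, iha, h]
  | _ => simp only [Expr.eval, *]

@[simp] theorem eval_tick (n : ℕ) (e : Expr d) : e.eval E (s.tick n) = e.eval E s :=
  eval_congr (s := s) (s' := s.tick n) rfl rfl e

open Classical in
theorem eval_near {a b : Expr d} {u v : ℕ} {x y : Pt d} (hE : 1 < 2 ^ E.bits)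
    (ha : a.eval E s = u) (hb : b.eval E s = v) (hx : s.point u = some x)
    (hy : s.point v = some y) : (a.near b).eval E s = if dist x y ≤ E.α then 1 else 0 := by
  rw [Expr.eval, ha, hb, hx, hy]
  change (if dist x y ≤ E.α then 1 else 0) % 2 ^ E.bits = _
  rw [Nat.mod_eq_of_lt]
  split_ifs <;> omega

end Eval

/-! ### Lists in memory -/

section Segments

variable (st : ℕ → ℕ) (p : ℕ → Pt d)

/-- Cell `x` holds the entry `e`. -/
def CellHolds (s : State d) (x : ℕ) (e : ℕ × ℕ) : Prop :=
  s.word (4 * x) = st e.1 ∧ s.word (4 * x + 1) = e.2 ∧ s.point x = some (p e.1)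

/-- The cells `x`, `x + Λ`, … hold the list `l`. -/
def Segment (s : State d) (Λ : ℕ) : ℕ → List (ℕ × ℕ) → Prop
  | _, [] => True
  | x, e :: l => CellHolds st p s x e ∧ Segment s Λ (x + Λ) l

variable {st p} {s s' : State d} {Λ : ℕ}

theorem Segment.congr {x : ℕ} {l : List (ℕ × ℕ)} (h : Segment st p s Λ x l)
    (hs : ∀ j < l.length, s'.word (4 * (x + Λ * j)) = s.word (4 * (x + Λ * j)) ∧
      s'.word (4 * (x + Λ * j) + 1) = s.word (4 * (x + Λ * j) + 1) ∧
      s'.point (x + Λ * j) = s.point (x + Λ * j)) : Segment st p s' Λ x l := by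
  induction l generalizing x with
  | nil => trivial
  | cons e l ih =>
    refine ⟨?_, ih h.2 fun j hj => ?_⟩
    · obtain ⟨h1, h2, h3⟩ := hs 0 (by simp)
      simp only [mul_zero, add_zero] at h1 h2 h3
      exact ⟨h1.trans h.1.1, h2.trans h.1.2.1, h3.trans h.1.2.2⟩
    · have := hs (j + 1) (by simpa using hj)
      rwa [show x + Λ * (j + 1) = x + Λ + Λ * j by ring] at this

theorem segment_append {x : ℕ} {l l' : List (ℕ × ℕ)} :
    Segment st p s Λ x (l ++ l') ↔
      Segment st p s Λ x l ∧ Segment st p s Λ (x + Λ * l.length) l' := by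
  induction l generalizing x with
  | nil => simp [Segment]
  | cons e l ih =>
    rw [List.cons_append, Segment, Segment, ih, List.length_cons,
      show x + Λ * (l.length + 1) = x + Λ + Λ * l.length by ring, and_assoc]

/-- From `s` to `s'` only words in `V` and entries in the cells `≡ r` modulo `Λ` were changed. -/
structure LaneFrame (s s' : State d) (V : Finset ℕ) (Λ r : ℕ) : Prop where
  vars : ∀ a < 32, a ∉ V → s'.word a = s.word a
  words : ∀ a, 32 ≤ a → (a / 4 % Λ ≠ r ∨ 2 ≤ a % 4) → s'.word a = s.word a
  points : ∀ y, (y % Λ ≠ r ∨ y < 8) → s'.point y = s.point y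

theorem LaneFrame.trans {s s' s'' : State d} {V : Finset ℕ} {r : ℕ} (h : LaneFrame s s' V Λ r)
    (h' : LaneFrame s' s'' V Λ r) : LaneFrame s s'' V Λ r :=
  ⟨fun a h1 h2 => (h'.vars a h1 h2).trans (h.vars a h1 h2),
    fun a h1 h2 => (h'.words a h1 h2).trans (h.words a h1 h2),
    fun a h1 => (h'.points a h1).trans (h.points a h1)⟩

end Segments

/-! ### Storing an entry -/

/-- Write an entry to the cell whose number is in word `11` and go on to the next cell. -/
def storeProg (v₀ v₁ q : Expr d) : Prog d :=
  .seq (.setWord (fieldAddr 0 11) v₀) <| .seq (.setWord (fieldAddr 1 11) v₁) <|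
    .seq (.copyPoint (var 11) q) (.setWord (.lit 11) (.add (var 11) (var 5)))

/-- By the time `v₁` and `q` are evaluated, parts of the target cell have been overwritten. Their
values are therefore required in every state that differs from `s` only there. -/
theorem storeProg_runs {E : Env d} {s : State d} {v₀ v₁ q : Expr d} {y Λ a₀ a₁ z : ℕ}
    (hE : 64 ≤ 2 ^ E.bits) (hy : s.word 11 = y) (hy8 : 8 ≤ y) (hΛ : s.word 5 = Λ)
    (hb : 4 * (y + Λ) + 4 ≤ 2 ^ E.bits) (h₀ : v₀.eval E s = a₀)
    (h₁ : ∀ s' : State d, (∀ a, a ≠ 4 * y → s'.word a = s.word a) → v₁.eval E s' = a₁)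
    (hq : ∀ s' : State d, (∀ a, a ≠ 4 * y → a ≠ 4 * y + 1 → s'.word a = s.word a) →
      q.eval E s' = z) :
    Runs E (storeProg v₀ v₁ q) s fun s' =>
      (∀ a, s'.word a = if a = 11 then y + Λ else if a = 4 * y then a₀ else
        if a = 4 * y + 1 then a₁ else s.word a) ∧
      (∀ x, s'.point x = if x = y then s.point z else s.point x) ∧
      s.Within s' (y + 1) (25 + v₀.cost + v₁.cost + q.cost) := by
  unfold storeProg
  refine Runs.seq (Runs.setWord (Runs.seq (Runs.setWord (Runs.seq (Runs.copyPoint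
    (Runs.setWord ?_))))))
  rw [eval_fieldAddr (z := y) hE (by omega) hy (by omega) (by omega), h₀]
  set s₁ := (s.setWord (4 * y + 0) a₀).tick ((fieldAddr 0 11 : Expr d).cost + v₀.cost + 1) with hs₁
  have e1 : ∀ a, s₁.word a = if a = 4 * y then a₀ else s.word a := fun a => by simp [hs₁]
  rw [eval_fieldAddr (z := y) hE (by omega) (by rw [e1, if_neg (by omega)]; exact hy) (by omega)
    (by omega), h₁ s₁ fun a ha => by rw [e1, if_neg ha]]
  set s₂ := (s₁.setWord (4 * y + 1) a₁).tick ((fieldAddr 1 11 : Expr d).cost + v₁.cost + 1)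
    with hs₂
  have e2 : ∀ a, s₂.word a = if a = 4 * y + 1 then a₁ else if a = 4 * y then a₀ else s.word a :=
    fun a => by simp [hs₂, e1]
  rw [eval_var (by omega), hq s₂ fun a ha ha' => by rw [e2, if_neg ha', if_neg ha]]
  have e3 : s₂.word 11 = y := by rw [e2, if_neg (by omega), if_neg (by omega)]; exact hy
  rw [e3]
  set s₃ := (s₂.setPoint y (s₂.point z)).tick ((var 11 : Expr d).cost + q.cost + 1) with hs₃
  have e4 : s₃.word = s₂.word := rfl
  have e5 : s₃.word 5 = Λ := by
    rw [e4, e2, if_neg (by omega), if_neg (by omega)]; exact hΛ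
  have e6 : s₃.word 11 = y := e3
  rw [eval_lit (by omega), eval_add (u := y) (v := Λ) ((eval_var (by omega)).trans e6)
    ((eval_var (by omega)).trans e5) (by omega)]
  refine ⟨fun a => ?_, fun x => ?_, ?_, ?_, ?_, ?_⟩
  · simp only [State.tick_word, State.setWord_word, e4, e2]
    split_ifs <;> first | rfl | omega
  · simp [hs₃, hs₂, hs₁]
  · simp only [State.tick_wordsUsed, State.setWord_wordsUsed, hs₃, hs₂, hs₁,
      State.setPoint_wordsUsed]
    omega
  · simp only [State.tick_pointsUsed, State.setWord_pointsUsed, hs₃, hs₂, hs₁,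
      State.setPoint_pointsUsed]
    omega
  · simp only [State.tick_steps, State.setWord_steps, hs₃, hs₂, hs₁, State.setPoint_steps,
      fieldAddr, var, Expr.cost]
    omega
  · simp [hs₃, hs₂, hs₁]

/-! ### Going through a list -/

/-- Drop the expired entries and the entry of the group of the new point from a list; the flag of
the latter goes to word `12`. -/
def matchLoop : Prog d :=
  .while (.lt (var 10) (var 13)) <|
    .seq (.ite (.lt (field 0 10) (var 9)) .skip
      (.ite (.near (.lit 0) (var 10)) (.setWord (.lit 12) (field 1 10))
        (storeProg (field 0 10) (field 1 10) (var 10))))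
    (.setWord (.lit 10) (.add (var 10) (var 5)))

theorem mod_mul_add_left (x Λ j : ℕ) : (x + Λ * j) % Λ = x % Λ := Nat.add_mul_mod_self_left x Λ j

/-- The list is compacted in place: `done` is what has been kept, `rest` what is unread. The writing
position `x₀ + Λ * done.length` never overtakes the reading position `x`, and both stay in one
residue class modulo `Λ`. -/
theorem matchLoop_runs {E : Env d} {st : ℕ → ℕ} {p : ℕ → Pt d} {near : ℕ → ℕ → Prop}
    (hnear : ∀ i j, near i j ↔ dist (p i) (p j) ≤ E.α) (hE : 64 ≤ 2 ^ E.bits)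
    {i cut Λ x₀ X : ℕ} (hx₀ : 8 ≤ x₀) (hX : 4 * X + 4 ≤ 2 ^ E.bits) (hΛ0 : 0 < Λ)
    (rest : List (ℕ × ℕ)) : ∀ (s : State d) (done : List (ℕ × ℕ)) (x f : ℕ),
    s.word 5 = Λ → s.word 9 = cut → s.word 10 = x → s.word 11 = x₀ + Λ * done.length →
    s.word 12 = f → s.word 13 = x + Λ * rest.length → x₀ + Λ * done.length ≤ x →
    x % Λ = x₀ % Λ → x + Λ * rest.length ≤ X → s.point 0 = some (p i) →
    Segment st p s Λ x rest → Segment st p s Λ x₀ done →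
    Runs E matchLoop s fun s' =>
      s'.word 11 = x₀ + Λ * (done ++ keepList near st cut i rest).length ∧
      s'.word 12 = groupFlag near st cut i f rest ∧
      Segment st p s' Λ x₀ (done ++ keepList near st cut i rest) ∧
      LaneFrame s s' {10, 11, 12} Λ (x₀ % Λ) ∧ s.Within s' X (80 * (rest.length + 1)) := by
  classical
  induction rest with
  | nil =>
    intro s done x f h5 h9 h10 h11 h12 h13 hx hmod hxX hp0 hseg hdone
    rw [List.length_nil, mul_zero, add_zero] at h13
    refine Runs.while_neg ?_ ?_
    · rw [eval_lt (u := x) (v := x) (by omega) ((eval_var (by omega)).trans h10)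
        ((eval_var (by omega)).trans h13), if_neg (lt_irrefl x)]
    · simp only [State.tick_word, keepList, List.filter_nil, List.append_nil, groupFlag,
        List.foldl_nil]
      refine ⟨h11, h12, hdone.congr fun _ _ => ⟨rfl, rfl, rfl⟩, ⟨fun _ _ _ => rfl, fun _ _ _ => rfl, fun _ _ => rfl⟩,
        ?_, ?_, ?_, rfl⟩
      · simp
      · simp
      · simp [Expr.cost, var]
  | cons e rest ih =>
    intro s done x f h5 h9 h10 h11 h12 h13 hx hmod hxX hp0 hseg hdone
    obtain ⟨⟨c0, c1, c2⟩, hseg⟩ := hseg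
    have hlen : x + Λ * (e :: rest).length = x + Λ + Λ * rest.length := by
      rw [List.length_cons]; ring
    rw [hlen] at h13 hxX
    refine Runs.while_pos ?_ (Runs.seq ?_)
    · rw [eval_lt (u := x) (v := x + Λ + Λ * rest.length) (by omega)
        ((eval_var (by omega)).trans h10) ((eval_var (by omega)).trans h13), if_pos (by omega)]
      exact one_ne_zero
    set n₁ := (Expr.lt (var 10) (var 13) : Expr d).cost + 1 with hn₁
    have hn₁' : n₁ = 6 := by simp [hn₁, Expr.cost, var]
    -- the rest of the loop
    have hrest : ∀ (s₁ : State d) (done' : List (ℕ × ℕ)) (f' : ℕ),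
        s₁.word 11 = x₀ + Λ * done'.length → x₀ + Λ * done'.length ≤ x + Λ → s₁.word 12 = f' →
        LaneFrame s s₁ {10, 11, 12} Λ (x₀ % Λ) → s₁.word 10 = x →
        Segment st p s₁ Λ (x + Λ) rest → Segment st p s₁ Λ x₀ done' →
        s.Within s₁ X 70 →
        done' ++ keepList near st cut i rest = done ++ keepList near st cut i (e :: rest) →
        groupFlag near st cut i f' rest = groupFlag near st cut i f (e :: rest) →
        Runs E (.setWord (.lit 10) (.add (var 10) (var 5))) s₁ fun s' =>
          Runs E matchLoop s' fun s' =>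
          s'.word 11 = x₀ + Λ * (done ++ keepList near st cut i (e :: rest)).length ∧
          s'.word 12 = groupFlag near st cut i f (e :: rest) ∧
          Segment st p s' Λ x₀ (done ++ keepList near st cut i (e :: rest)) ∧
          LaneFrame s s' {10, 11, 12} Λ (x₀ % Λ) ∧
          s.Within s' X (80 * ((e :: rest).length + 1)) := by
      intro s₁ done' f' g11 gle g12 gframe g10 gseg gdone gwithin hd hf
      have g5 : s₁.word 5 = Λ := (gframe.vars 5 (by omega) (by decide)).trans h5
      have g9 : s₁.word 9 = cut := (gframe.vars 9 (by omega) (by decide)).trans h9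
      have g13 : s₁.word 13 = x + Λ + Λ * rest.length :=
        (gframe.vars 13 (by omega) (by decide)).trans h13
      refine Runs.setWord ?_
      rw [eval_lit (by omega), eval_add (u := x) (v := Λ) ((eval_var (by omega)).trans g10)
        ((eval_var (by omega)).trans g5) (by omega)]
      set s₂ := (s₁.setWord 10 (x + Λ)).tick _ with hs₂
      have e2 : ∀ a, s₂.word a = if a = 10 then x + Λ else s₁.word a := fun a => by simp [hs₂]
      have hfr : LaneFrame s₁ s₂ {10, 11, 12} Λ (x₀ % Λ) :=
        ⟨fun a _ ha => by rw [e2, if_neg (by rintro rfl; simp at ha)],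
          fun a ha _ => by rw [e2, if_neg (by omega)], fun _ _ => rfl⟩
      have hw : s₁.Within s₂ X 8 := by
        refine ⟨?_, ?_, ?_, ?_⟩ <;> simp [hs₂, Expr.cost, var]
        omega
      refine (ih s₂ done' (x + Λ) f' (by rw [e2]; simpa using g5) (by rw [e2]; simpa using g9)
        (by rw [e2]; simp) (by rw [e2]; simpa using g11) (by rw [e2]; simpa using g12)
        (by rw [e2]; simpa using g13) gle
        (by rw [Nat.add_mod_right, hmod]) hxX
        (((gframe.trans hfr).points 0 (Or.inr (by omega))).trans hp0)
        (gseg.congr fun j _ => ?_) (gdone.congr fun j _ => ?_)).mono ?_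
      · rw [e2, e2, if_neg (by omega), if_neg (by omega)]; exact ⟨rfl, rfl, rfl⟩
      · rw [e2, e2, if_neg (by omega), if_neg (by omega)]; exact ⟨rfl, rfl, rfl⟩
      · rintro s' ⟨k1, k2, k3, k4, k5⟩
        rw [hd] at k1 k3
        rw [hf] at k2
        refine ⟨k1, k2, k3, (gframe.trans hfr).trans k4,
          ((gwithin.trans hw).trans k5).mono le_rfl ?_⟩
        rw [List.length_cons]; omega
    have hx4 : 4 * x + 4 ≤ 2 ^ E.bits := by omega
    have e0 : (field 0 10 : Expr d).eval E (s.tick n₁) = st e.1 := by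
      rw [eval_tick, eval_field (z := x) hE (by omega) h10 hx4 (by omega)]; exact c0
    by_cases hc : st e.1 < cut
    · refine Runs.ite_pos ?_ (Runs.skip ?_)
      · rw [eval_lt (by omega) e0 ((eval_var (by omega)).trans h9), if_pos hc]
        exact one_ne_zero
      refine hrest _ done f h11 (by omega) h12
        ⟨fun _ _ _ => rfl, fun _ _ _ => rfl, fun _ _ => rfl⟩ h10
        (hseg.congr fun _ _ => ⟨rfl, rfl, rfl⟩) (hdone.congr fun _ _ => ⟨rfl, rfl, rfl⟩) ?_ ?_ ?_
      · refine ⟨by simp, by simp, ?_, rfl⟩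
        simp [Expr.cost, var, field, fieldAddr, hn₁']
      · rw [keepList, keepList, List.filter_cons_of_neg]
        simp [hc]
      · simp [groupFlag, not_le.2 hc]
    · refine Runs.ite_neg ?_ ?_
      · rw [eval_lt (by omega) e0 ((eval_var (by omega)).trans h9), if_neg hc]
      set n₂ := (Expr.lt (field 0 10) (var 9) : Expr d).cost + 1 with hn₂
      have hn₂' : n₂ = 11 := by simp [hn₂, Expr.cost, var, field, fieldAddr]
      have hev : (Expr.near (.lit 0) (var 10) : Expr d).eval E ((s.tick n₁).tick n₂) =
          if dist (p i) (p e.1) ≤ E.α then 1 else 0 := by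
        simp only [eval_tick]
        exact eval_near (by omega) (eval_lit (by omega)) ((eval_var (by omega)).trans h10) hp0 c2
      by_cases hn : near i e.1
      · refine Runs.ite_pos ?_ (Runs.setWord ?_)
        · rw [hev, if_pos ((hnear _ _).1 hn)]
          exact one_ne_zero
        simp only [eval_tick]
        rw [eval_lit (by omega), eval_field (z := x) hE (by omega) h10 hx4 (by omega)]
        rw [c1]
        set s₁ := State.tick (State.setWord _ 12 e.2) _ with hs₁
        have e1 : ∀ a, s₁.word a = if a = 12 then e.2 else s.word a := fun a => by simp [hs₁]
        refine hrest s₁ done e.2 (by rw [e1]; simpa using h11) (by omega) (by rw [e1]; simp)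
          ⟨fun a _ ha => by rw [e1, if_neg (by rintro rfl; simp at ha)],
            fun a ha _ => by rw [e1, if_neg (by omega)], fun _ _ => rfl⟩
          (by rw [e1]; simpa using h10) (hseg.congr fun j _ => ?_) (hdone.congr fun j _ => ?_)
          ?_ ?_ ?_
        · rw [e1, e1, if_neg (by omega), if_neg (by omega)]; exact ⟨rfl, rfl, rfl⟩
        · rw [e1, e1, if_neg (by omega), if_neg (by omega)]; exact ⟨rfl, rfl, rfl⟩
        · refine ⟨?_, ?_, ?_, ?_⟩ <;>
            simp [hs₁, Expr.cost, var, field, fieldAddr, hn₁', hn₂']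
          omega
        · rw [keepList, keepList, List.filter_cons_of_neg]
          simp [hn]
        · simp [groupFlag, hn, not_lt.1 hc]
      · refine Runs.ite_neg (by rw [hev, if_neg fun h => hn ((hnear _ _).2 h)]) ?_
        set n₃ := (Expr.near (.lit 0) (var 10) : Expr d).cost + 1 with hn₃
        have hn₃' : n₃ = 5 := by simp [hn₃, Expr.cost, var]
        set y := x₀ + Λ * done.length with hy
        refine (storeProg_runs (s := ((s.tick n₁).tick n₂).tick n₃) (y := y) (Λ := Λ) (a₀ := st e.1) (a₁ := e.2) (z := x) hE h11
          (by omega) h5 (by omega) ?_ ?_ ?_).mono ?_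
        · simp only [eval_tick]
          rw [eval_field (z := x) hE (by omega) h10 hx4 (by omega)]; exact c0
        · intro s' hs'
          rw [eval_field (z := x) hE (by omega) ((hs' 10 (by omega)).trans h10) hx4 (by omega),
            hs' _ (by omega)]
          exact c1
        · intro s' hs'
          rw [eval_var (by omega), hs' 10 (by omega) (by omega)]
          exact h10
        · rintro s₁ ⟨k1, k2, k3⟩
          simp only [State.tick_word, State.tick_point] at k1 k2
          have hlen' : x₀ + Λ * (done ++ [e]).length = y + Λ := by
            rw [hy, List.length_append, List.length_singleton]; ring
          refine hrest s₁ (done ++ [e]) f (by rw [k1, if_pos rfl, hlen']) (by omega)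
            (by rw [k1, if_neg (by omega), if_neg (by omega), if_neg (by omega)]; exact h12)
            ⟨fun a _ ha => ?_, fun a ha ha' => ?_, fun z hz => ?_⟩
            (by rw [k1, if_neg (by omega), if_neg (by omega), if_neg (by omega)]; exact h10)
            (hseg.congr fun j _ => ?_) ?_ ?_ ?_ ?_
          · rw [k1, if_neg (by rintro rfl; simp at ha), if_neg (by omega), if_neg (by omega)]
          · have hym : y % Λ = x₀ % Λ := mod_mul_add_left _ _ _
            rw [k1, if_neg (by omega), if_neg, if_neg]
            · rintro rfl
              rw [show (4 * y + 1) / 4 = y by omega] at ha'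
              omega
            · rintro rfl
              rw [show (4 * y) / 4 = y by omega] at ha'
              omega
          · have hym : y % Λ = x₀ % Λ := mod_mul_add_left _ _ _
            rw [k2, if_neg]
            rintro rfl
            omega
          -- The cell just written is at most `x`, and the unread cells start at `x + Λ`, so they
          -- are intact.
          · rw [k1, k1, k2, if_neg (by omega), if_neg (by omega), if_neg (by omega),
              if_neg (by omega), if_neg (by omega), if_neg (by omega), if_neg (by omega)]
            exact ⟨rfl, rfl, rfl⟩
          · rw [segment_append]
            refine ⟨hdone.congr fun j hj => ?_, ⟨?_, ?_, ?_⟩, trivial⟩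
            · have hlt : Λ * j < Λ * done.length := Nat.mul_lt_mul_of_pos_left hj hΛ0
              rw [k1, k1, k2, if_neg (by omega), if_neg (by omega), if_neg (by omega),
                if_neg (by omega), if_neg (by omega), if_neg (by omega), if_neg (by omega)]
              exact ⟨rfl, rfl, rfl⟩
            · rw [← hy, k1, if_neg (by omega), if_pos rfl]
            · rw [← hy, k1, if_neg (by omega), if_neg (by omega), if_pos rfl]
            · rw [← hy, k2, if_pos rfl]; exact c2
          · have hw0 : s.Within (((s.tick n₁).tick n₂).tick n₃) X 22 := by
              refine ⟨by simp, by simp, ?_, rfl⟩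
              simp [hn₁', hn₂', hn₃']
            refine (hw0.trans (k3.mono (Y' := X) (by omega) le_rfl)).mono le_rfl ?_
            simp [Expr.cost, var, field, fieldAddr]
          · rw [keepList, keepList, List.filter_cons_of_pos, List.append_assoc]
            · rfl
            · simpa [hn] using not_lt.1 hc
          · simp [groupFlag, hn]

end SlidingSample

end

noncomputable section

namespace SlidingSample

variable {d : ℕ}

/-! ### Hashing the cells near a point -/

/-- The key with tag `τ` for the cell of point `0`, moved by `o - d`. -/
def keyExpr (τ : ℕ) (o : Fin d → ℕ) : Expr d :=
  .add (.mul (.lit 2) ((List.finRange d).foldr (fun i e =>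
    .add (.add (.cell (.lit 0) i) (.lit (o i))) (.mul (.add (var 3) (.lit (2 * d))) e)) (.lit 0)))
    (.lit τ)

/-- Whether a cell is sampled; word `7` is the inverse of the rate. -/
def sampledExpr (τ : ℕ) (o : Fin d → ℕ) : Expr d :=
  .lt (.mod (.hash (keyExpr τ o)) (var 7)) (.lit 1)

/-- The number of sampled cells from a list. -/
def sampledSum (τ : ℕ) (l : List (Fin d → Fin (2 * d + 1))) : Expr d :=
  l.foldr (fun o e => .add (sampledExpr τ fun i => o i) e) (.lit 0)

/-- The number of sampled cells near point `0`. -/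
def touchedExpr (d τ : ℕ) : Expr d := sampledSum τ Finset.univ.toList

/-- The new point is point `i` of the stream `I`, and the words are long enough for the keys. -/
structure Ready (I : Stream d) (E : Env d) (s : State d) (i : ℕ) : Prop where
  admissible : I.Admissible
  d_pos : 1 ≤ d
  α_eq : E.α = I.α
  size : s.word 3 = I.gridSize
  point : s.point 0 = some (I.pt i)
  base_pow : 2 * I.base ^ d < 2 ^ E.bits

variable {I : Stream d} {E : Env d} {s : State d} {i τ : ℕ}

/-- Horner's scheme in base `I.base`. A partial value of length `n` is below `I.base ^ n`, so
`base_pow` excludes any overflow modulo `2 ^ bits`. -/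
theorem eval_keyExpr (h : Ready I E s i) (hτ : τ < 2) {o : Fin d → ℕ}
    (ho : ∀ l, o l < 2 * d + 1) : (keyExpr τ o).eval E s = I.key τ (I.pt i) o := by
  have hB : 1 < I.base := Stream.Admissible.one_lt_base h.d_pos
  have hle : I.base ≤ I.base ^ d := Nat.le_self_pow (by have := h.d_pos; omega) _
  have hbp := h.base_pow
  have hgrid : 2 * d < I.base := by unfold Stream.base Stream.gridSize; omega
  have key : ∀ l : List (Fin d), l.length ≤ d →
      ((l.foldr (fun i e => Expr.add (.add (.cell (.lit 0) i) (.lit (o i)))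
        (.mul (.add (var 3) (.lit (2 * d))) e)) (.lit 0)).eval E s =
        l.foldr (fun j e => cellCoord I.α (I.pt i) j + o j + I.base * e) 0) ∧
      l.foldr (fun j e => cellCoord I.α (I.pt i) j + o j + I.base * e) 0 < I.base ^ l.length := by
    intro l
    induction l with
    | nil => intro _; exact ⟨eval_lit (by positivity), by simp⟩
    | cons j l ih =>
      intro hl
      rw [List.length_cons] at hl
      obtain ⟨h1, h2⟩ := ih (by omega)
      simp only [List.foldr_cons, List.length_cons]
      set v := l.foldr (fun j e => cellCoord I.α (I.pt i) j + o j + I.base * e) 0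
      have hc := h.admissible.cell_add_lt_base i ho j
      have h3 : I.base * v + I.base ≤ I.base ^ (l.length + 1) := by
        rw [pow_succ, mul_comm _ I.base, ← Nat.mul_succ]
        exact Nat.mul_le_mul_left _ h2
      have h4 : I.base ^ (l.length + 1) ≤ I.base ^ d := Nat.pow_le_pow_right (by omega) hl
      refine ⟨?_, by omega⟩
      have hcell : (Expr.cell (.lit 0) j : Expr d).eval E s = cellCoord I.α (I.pt i) j := by
        rw [Expr.eval, eval_lit (by positivity), h.point]
        change cellCoord E.α (I.pt i) j % 2 ^ E.bits = _
        rw [h.α_eq, Nat.mod_eq_of_lt (by omega)]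
      have hbase : (Expr.add (var 3) (.lit (2 * d)) : Expr d).eval E s = I.base :=
        eval_add ((eval_var (by have := h.d_pos; omega)).trans h.size) (eval_lit (by omega))
          (by change I.base < _; omega)
      exact eval_add (eval_add hcell (eval_lit (by have := ho j; omega)) (by omega))
        (eval_mul hbase h1 (by omega)) (by omega)
  obtain ⟨h1, h2⟩ := key (List.finRange d) (by simp)
  rw [List.length_finRange] at h2
  have h3 : vecKey I.base (fun j => cellCoord I.α (I.pt i) j + o j) < I.base ^ d := h2
  exact eval_add (eval_mul (eval_lit (by omega)) h1 (by omega)) (eval_lit (by omega)) (by omega)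

theorem eval_sampledExpr (h : Ready I E s i) (hτ : τ < 2) {o : Fin d → ℕ}
    (ho : ∀ l, o l < 2 * d + 1) {R : ℕ} (hR : s.word 7 = R) (h7 : 7 < 2 ^ E.bits)
    [Decidable (R ∣ E.hash (I.key τ (I.pt i) o))] :
    (sampledExpr τ o).eval E s = if R ∣ E.hash (I.key τ (I.pt i) o) then 1 else 0 := by
  have h1 : (Expr.mod (.hash (keyExpr τ o)) (var 7) : Expr d).eval E s =
      E.hash (I.key τ (I.pt i) o) % R := by
    rw [Expr.eval, Expr.eval, eval_keyExpr h hτ ho, eval_var h7, hR]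
  rw [sampledExpr, eval_lt (by omega) h1 (eval_lit (by omega))]
  simp only [Nat.lt_one_iff, Nat.dvd_iff_mod_eq_zero]

/-- A disjunction computed as a sum of bits. It cannot wrap around to zero, because there are only
`(2 * d + 1) ^ d ≤ I.base ^ d` terms. -/
theorem eval_touchedExpr (h : Ready I E s i) (hτ : τ < 2) {R : ℕ} (hR : s.word 7 = R)
    (h7 : 7 < 2 ^ E.bits) : (touchedExpr d τ).eval E s ≠ 0 ↔ I.Touched E.hash τ R i := by
  classical
  have key : ∀ l : List (Fin d → Fin (2 * d + 1)), l.length < 2 ^ E.bits →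
      (sampledSum τ l).eval E s ≤ l.length ∧ ((sampledSum τ l).eval E s ≠ 0 ↔
        ∃ o ∈ l, R ∣ E.hash (I.key τ (I.pt i) fun j => o j)) := by
    intro l
    induction l with
    | nil =>
      intro _
      have : (sampledSum τ [] : Expr d).eval E s = 0 := eval_lit (by positivity)
      rw [this]; simp
    | cons o l ih =>
      intro hl
      rw [List.length_cons] at hl
      obtain ⟨h1, h2⟩ := ih (by omega)
      have h3 := eval_sampledExpr h hτ (o := fun j => o j) (fun l => (o l).2) hR h7
      have hle : (if R ∣ E.hash (I.key τ (I.pt i) fun j => o j) then 1 else 0) ≤ 1 := by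
        split_ifs <;> omega
      have h4 : (sampledSum τ (o :: l)).eval E s =
          (if R ∣ E.hash (I.key τ (I.pt i) fun j => o j) then 1 else 0) +
            (sampledSum τ l).eval E s := eval_add h3 rfl (by omega)
      rw [h4]
      refine ⟨by rw [List.length_cons]; omega, ?_⟩
      simp only [List.mem_cons, exists_eq_or_imp]
      rw [← h2]
      split_ifs with hc
      · simp [hc]
      · simp [hc]
  have hlen : (Finset.univ.toList : List (Fin d → Fin (2 * d + 1))).length < 2 ^ E.bits := by
    rw [Finset.length_toList, Finset.card_univ, Fintype.card_fun, Fintype.card_fin,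
      Fintype.card_fin]
    have h1 : (2 * d + 1) ^ d ≤ I.base ^ d :=
      Nat.pow_le_pow_left (by unfold Stream.base Stream.gridSize; omega) _
    have := h.base_pow
    omega
  have := (key _ hlen).2
  unfold touchedExpr Stream.Touched
  rw [this]
  simp

/-! ### Processing a point at one level -/

/-- Refresh the list whose first cell is in word `14`. -/
def laneUpdate (d τ : ℕ) : Prog d :=
  .seq (.setWord (.lit 12) (.lit 2)) <|
    .seq (.ite (touchedExpr d τ) (.setWord (.lit 12) (sampledExpr τ fun _ => d)) .skip) <|
    .seq (.setWord (.lit 10) (var 14)) <| .seq (.setWord (.lit 11) (var 14)) <|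
    .seq (.setWord (.lit 13) (.add (var 14) (field 2 14))) <| .seq matchLoop <|
    .seq (.ite (.lt (var 12) (.lit 2)) (storeProg (var 0) (var 12) (.lit 0)) .skip)
      (.setWord (fieldAddr 2 14) (.sub (var 11) (var 14)))

/-- The cost of hashing the cells near a point. -/
def hashCost (d τ : ℕ) : ℕ := (touchedExpr d τ).cost + (sampledExpr τ fun _ : Fin d => d).cost

/-- A list with its length times `Λ`. -/
def LaneHolds (st : ℕ → ℕ) (p : ℕ → Pt d) (s : State d) (Λ x : ℕ) (l : List (ℕ × ℕ)) : Prop :=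
  s.word (4 * x + 2) = Λ * l.length ∧ Segment st p s Λ x l

/-- From `s` to `s'` only words in `V` and the list that starts in cell `x` were changed. -/
structure ListFrame (s s' : State d) (V : Finset ℕ) (Λ x : ℕ) : Prop where
  vars : ∀ a < 32, a ∉ V → s'.word a = s.word a
  words : ∀ a, 32 ≤ a → a ≠ 4 * x + 2 → (a / 4 % Λ ≠ x % Λ ∨ 2 ≤ a % 4) → s'.word a = s.word a
  points : ∀ y, (y % Λ ≠ x % Λ ∨ y < 8) → s'.point y = s.point y

theorem ListFrame.trans {s s' s'' : State d} {V : Finset ℕ} {Λ x : ℕ}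
    (h : ListFrame s s' V Λ x) (h' : ListFrame s' s'' V Λ x) : ListFrame s s'' V Λ x :=
  ⟨fun a h1 h2 => (h'.vars a h1 h2).trans (h.vars a h1 h2),
    fun a h1 h2 h3 => (h'.words a h1 h2 h3).trans (h.words a h1 h2 h3),
    fun a h1 => (h'.points a h1).trans (h.points a h1)⟩

/-- Word `12` is first given the flag for a new group, with `2` meaning that it is not to be stored.
The pass through the list overwrites it if an unexpired entry of the group is found, which is the
fold in `groupFlag`. -/
theorem laneUpdate_runs {st : ℕ → ℕ} (h : Ready I E s i) (hτ : τ < 2)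
    (hE : 64 ≤ 2 ^ E.bits) {cut Λ R x X : ℕ} {l : List (ℕ × ℕ)} (hx : 8 ≤ x)
    (hX : 4 * X + 4 ≤ 2 ^ E.bits) (hΛ0 : 0 < Λ) (hxX : x + Λ * (l.length + 1) ≤ X)
    (h0 : s.word 0 = st i) (h5 : s.word 5 = Λ) (h7 : s.word 7 = R) (h9 : s.word 9 = cut)
    (h14 : s.word 14 = x) (hl : LaneHolds st I.pt s Λ x l) :
    Runs E (laneUpdate d τ) s fun s' =>
      LaneHolds st I.pt s' Λ x (refresh I.Near st cut i
        (initFlag (I.Accepted E.hash τ R) (I.Touched E.hash τ R) i) l) ∧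
      ListFrame s s' {10, 11, 12, 13} Λ x ∧
      s.Within s' X (hashCost d τ + 200 + 80 * l.length) := by
  classical
  obtain ⟨hlen, hseg⟩ := hl
  have hxX' : x + Λ * l.length + Λ ≤ X := by
    rw [Nat.mul_succ] at hxX; omega
  set f := initFlag (I.Accepted E.hash τ R) (I.Touched E.hash τ R) i with hf
  unfold laneUpdate
  refine Runs.seq (Runs.setWord ?_)
  rw [eval_lit (by omega), eval_lit (by omega)]
  -- the flag
  refine Runs.seq (Runs.mono (Q := fun s₁ => (∀ a, s₁.word a = if a = 12 then f else s.word a) ∧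
    s₁.point = s.point ∧ s.Within s₁ 8 (hashCost d τ + 10)) ?_ ?_)
  · set s₁ := State.tick (s.setWord 12 2) _ with hs₁
    have e1 : ∀ a, s₁.word a = if a = 12 then 2 else s.word a := fun a => by simp [hs₁]
    have hr : Ready I E s₁ i := ⟨h.admissible, h.d_pos, h.α_eq, by rw [e1]; simpa using h.size,
      h.point, h.base_pow⟩
    have hR : s₁.word 7 = R := by rw [e1]; simpa using h7
    by_cases ht : I.Touched E.hash τ R i
    · refine Runs.ite_pos ((eval_touchedExpr hr hτ hR (by omega)).2 ht) (Runs.setWord ?_)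
      rw [eval_lit (by omega), eval_tick, eval_sampledExpr hr hτ (fun _ => by omega) hR (by omega)]
      refine ⟨fun a => ?_, rfl, ?_, ?_, ?_, ?_⟩
      · simp only [State.tick_word, State.setWord_word, e1, hf, initFlag, ht, if_true]
        by_cases ha : a = 12
        · simp only [ha, if_true]
          exact if_congr Iff.rfl rfl rfl
        · simp only [ha, if_false]
      · simp [hs₁]; omega
      · simp [hs₁]
      · simp [hs₁, Expr.cost, hashCost]; omega
      · simp [hs₁]
    · refine Runs.ite_neg ?_ (Runs.skip ?_)
      · by_contra hc
        exact ht ((eval_touchedExpr hr hτ hR (by omega)).1 hc)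
      refine ⟨fun a => ?_, rfl, ?_, ?_, ?_, ?_⟩
      · simp only [State.tick_word, e1, hf, initFlag, ht, if_false]
      · simp [hs₁]; omega
      · simp [hs₁]
      · simp [hs₁, Expr.cost, hashCost]; omega
      · simp [hs₁]
  rintro s₁ ⟨e1, p1, w1⟩
  have i14 : s₁.word 14 = x := by rw [e1]; simpa using h14
  refine Runs.seq (Runs.setWord (Runs.seq (Runs.setWord (Runs.seq (Runs.setWord ?_)))))
  rw [eval_lit (by omega), eval_var (by omega), i14]
  set s₂ := State.tick (s₁.setWord 10 x) _ with hs₂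
  have i14' : s₂.word 14 = x := by simpa [hs₂] using i14
  rw [eval_lit (by omega), eval_var (by omega), i14']
  set s₃ := State.tick (s₂.setWord 11 x) _ with hs₃
  have i14'' : s₃.word 14 = x := by simpa [hs₃] using i14'
  have i2 : s₃.word (4 * x + 2) = Λ * l.length := by
    simp only [hs₃, hs₂, State.tick_word, State.setWord_word, e1]
    rw [if_neg (by omega), if_neg (by omega), if_neg (by omega)]
    exact hlen
  rw [eval_lit (by omega), eval_add (u := x) (v := Λ * l.length)
    ((eval_var (by omega)).trans i14'')
    ((eval_field hE (by omega) i14'' (by omega) (by omega)).trans i2) (by omega)]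
  set s₄ := State.tick (s₃.setWord 13 (x + Λ * l.length)) _ with hs₄
  have e4 : ∀ a, s₄.word a = if a = 13 then x + Λ * l.length else if a = 11 then x else
      if a = 10 then x else if a = 12 then f else s.word a := by
    intro a
    simp [hs₄, hs₃, hs₂, e1]
  have p4 : s₄.point = s.point := p1
  have w4 : s.Within s₄ 8 (hashCost d τ + 40) := by
    have hw : s₁.Within s₄ 8 30 := by
      refine ⟨?_, ?_, ?_, ?_⟩ <;> simp [hs₄, hs₃, hs₂, Expr.cost, var, field, fieldAddr]
      omega
    exact w1.trans hw
  have hseg4 : ∀ l', Segment st I.pt s Λ x l' → Segment st I.pt s₄ Λ x l' := by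
    intro l' hl'
    refine hl'.congr fun j _ => ?_
    rw [p4, e4, e4]
    repeat rw [if_neg (by omega)]
    exact ⟨rfl, rfl, rfl⟩
  refine Runs.seq ((matchLoop_runs (near := I.Near) (i := i) (st := st) (p := I.pt) (cut := cut)
    (Λ := Λ) (x₀ := x) (X := X)
    (fun i j => by rw [h.α_eq]; rfl) hE hx hX hΛ0 l s₄ [] x f (by rw [e4]; simpa using h5)
    (by rw [e4]; simpa using h9) (by rw [e4]; simp) (by rw [e4]; simp) (by rw [e4]; simp)
    (by rw [e4]; simp) (by simp) rfl (by omega) (by rw [p4]; exact h.point) (hseg4 _ hseg)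
    trivial).mono ?_)
  rintro s₅ ⟨k1, k2, k3, k4, k5⟩
  rw [List.nil_append] at k1 k3
  have hkl : (keepList I.Near st cut i l).length ≤ l.length := List.length_filter_le _ _
  have hkl' : Λ * (keepList I.Near st cut i l).length ≤ Λ * l.length := Nat.mul_le_mul_left _ hkl
  set kl := keepList I.Near st cut i l with hkl0
  set fl := groupFlag I.Near st cut i f l with hfl
  have hv5 : ∀ a < 32, a ∉ ({10, 11, 12, 13} : Finset ℕ) → s₅.word a = s.word a := by
    intro a ha ha'
    simp only [Finset.mem_insert, Finset.mem_singleton, not_or] at ha'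
    rw [k4.vars a ha (by simp; omega), e4, if_neg (by omega), if_neg (by omega), if_neg (by omega),
      if_neg (by omega)]
  have hf5 : ListFrame s s₅ {10, 11, 12, 13} Λ x := by
    refine ⟨hv5, fun a ha _ ha' => ?_, fun y hy => ?_⟩
    · rw [k4.words a ha ha', e4, if_neg (by omega), if_neg (by omega), if_neg (by omega),
        if_neg (by omega)]
    · rw [k4.points y hy, p4]
  have w5 : s.Within s₅ X (hashCost d τ + 120 + 80 * l.length) :=
    ((w4.mono (Y' := X) (by omega) le_rfl).trans k5).mono le_rfl (by omega)
  -- the new entry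
  refine Runs.seq (Runs.mono (Q := fun s₆ =>
    s₆.word 11 = x + Λ * (refresh I.Near st cut i f l).length ∧
    Segment st I.pt s₆ Λ x (refresh I.Near st cut i f l) ∧
    ListFrame s s₆ {10, 11, 12, 13} Λ x ∧
    s.Within s₆ X (hashCost d τ + 170 + 80 * l.length)) ?_ ?_)
  · have hcond : (Expr.lt (var 12) (.lit 2) : Expr d).eval E s₅ = if fl < 2 then 1 else 0 :=
      eval_lt (by omega) ((eval_var (by omega)).trans k2) (eval_lit (by omega))
    by_cases hc : fl < 2
    · rw [if_pos hc] at hcond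
      refine Runs.ite_pos (by rw [hcond]; exact one_ne_zero) ?_
      set s₆ := s₅.tick _ with hs₆
      refine (storeProg_runs (s := s₆) (y := x + Λ * kl.length) (Λ := Λ) (a₀ := st i) (a₁ := fl)
        (z := 0) hE k1 (by omega) ((hv5 5 (by omega) (by simp)).trans h5) (by omega) ?_ ?_ ?_).mono ?_
      · rw [eval_var (by omega)]
        exact (hv5 0 (by omega) (by simp)).trans h0
      · intro s' hs'
        rw [eval_var (by omega), hs' 12 (by omega)]
        exact k2
      · intro s' _
        exact eval_lit (by omega)
      · rintro s₇ ⟨m1, m2, m3⟩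
        have hre : refresh I.Near st cut i f l = kl ++ [(i, fl)] := by
          rw [refresh, if_pos hc]
        rw [hre]
        refine ⟨?_, ?_, ⟨fun a ha ha' => ?_, fun a ha hax ha' => ?_, fun y hy => ?_⟩, ?_⟩
        · rw [m1, if_pos rfl, List.length_append, List.length_singleton]; ring
        · rw [segment_append]
          refine ⟨k3.congr fun j hj => ?_, ⟨?_, ?_, ?_⟩, trivial⟩
          · have hlt : Λ * j < Λ * kl.length := Nat.mul_lt_mul_of_pos_left hj hΛ0
            rw [m1, m1, m2]
            repeat rw [if_neg (by omega)]
            exact ⟨rfl, rfl, rfl⟩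
          · rw [m1, if_neg (by omega), if_pos rfl]
          · rw [m1, if_neg (by omega), if_neg (by omega), if_pos rfl]
          · rw [m2, if_pos rfl]
            exact (hf5.points 0 (Or.inr (by omega))).trans h.point
        · have ha'' : a ≠ 11 := by rintro rfl; simp at ha'
          rw [m1, if_neg ha'', if_neg (by omega), if_neg (by omega)]
          exact hv5 a ha ha'
        · have hym : (x + Λ * kl.length) % Λ = x % Λ := mod_mul_add_left _ _ _
          rw [m1, if_neg (by omega), if_neg, if_neg]
          · exact hf5.words a ha hax ha'
          · rintro rfl
            rw [show (4 * (x + Λ * kl.length) + 1) / 4 = x + Λ * kl.length by omega] at ha'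
            omega
          · rintro rfl
            rw [show (4 * (x + Λ * kl.length)) / 4 = x + Λ * kl.length by omega] at ha'
            omega
        · have hym : (x + Λ * kl.length) % Λ = x % Λ := mod_mul_add_left _ _ _
          rw [m2, if_neg]
          · exact hf5.points y hy
          · rintro rfl
            omega
        · have w6 : s₅.Within s₆ X 6 := by
            refine ⟨by simp [hs₆], by simp [hs₆], ?_, rfl⟩
            simp [hs₆, Expr.cost, var]
          refine ((w5.trans w6).trans (m3.mono (Y' := X) (by omega) le_rfl)).mono le_rfl ?_
          simp [Expr.cost, var]
          omega
    · rw [if_neg hc] at hcond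
      have hre : refresh I.Near st cut i f l = kl := by
        rw [refresh, if_neg hc, List.append_nil]
      rw [hre]
      refine Runs.ite_neg hcond (Runs.skip ⟨k1, k3.congr fun j _ => ⟨rfl, rfl, rfl⟩,
        ⟨hf5.vars, hf5.words, hf5.points⟩, ?_⟩)
      have w6 : s₅.Within ((s₅.tick ((Expr.lt (var 12) (.lit 2) : Expr d).cost + 1)).tick 1) X 10 := by
        refine ⟨by simp, by simp, ?_, rfl⟩
        simp [Expr.cost, var]
      exact (w5.trans w6).mono le_rfl (by omega)
  · rintro s₆ ⟨m1, m2, m3, m4⟩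
    have j14 : s₆.word 14 = x := (m3.vars 14 (by omega) (by simp)).trans h14
    refine Runs.setWord ?_
    rw [eval_fieldAddr hE (by omega) j14 (by omega) (by omega),
      eval_sub ((eval_var (by omega)).trans m1) ((eval_var (by omega)).trans j14),
      Nat.add_sub_cancel_left]
    set s₇ := State.tick (s₆.setWord _ _) _ with hs₇
    have e7 : ∀ a, s₇.word a = if a = 4 * x + 2 then
        Λ * (refresh I.Near st cut i f l).length else s₆.word a := fun a => by simp [hs₇]
    refine ⟨⟨by rw [e7, if_pos rfl], m2.congr fun j _ => ?_⟩,
      m3.trans ⟨fun a ha _ => by rw [e7, if_neg (by omega)],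
        fun a _ ha _ => by rw [e7, if_neg ha], fun y _ => rfl⟩, ?_⟩
    · rw [e7, e7, if_neg (by omega), if_neg (by omega)]
      exact ⟨rfl, rfl, rfl⟩
    · have hΛl := Nat.le_mul_of_pos_right Λ (Nat.succ_pos l.length)
      have w7 : s₆.Within s₇ X 20 := by
        refine ⟨?_, ?_, ?_, ?_⟩ <;> simp [hs₇, Expr.cost, var, fieldAddr]
        omega
      exact (m4.trans w7).mono le_rfl (by omega)

end SlidingSample

end

noncomputable section

namespace SlidingSample

variable {d : ℕ}

/-! ### Processing a point at all levels -/

/-- Raise the cut if the list whose first cell is in word `8` is too long; word `6` is the greatest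
length times `Λ`, and the cut is also left in word `9`. -/
def cutUpdate : Prog d :=
  .seq (.setWord (.lit 9) (field 3 8)) <|
    .ite (.lt (var 6) (field 2 8))
      (.seq (.setWord (.lit 9) (.add (field 0 8) (.lit 1))) (.setWord (fieldAddr 3 8) (var 9))) .skip

/-- Process a point at the level whose first cell is in word `8`. -/
def levelUpdate (d : ℕ) : Prog d :=
  .seq cutUpdate <| .seq (.setWord (.lit 14) (var 8)) <| .seq (laneUpdate d 0) <|
    .seq (.setWord (.lit 14) (.add (var 8) (.lit 1))) <| .seq (laneUpdate d 1) <|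
    .seq (.setWord (.lit 8) (.add (var 8) (.lit 2))) (.setWord (.lit 7) (.add (var 7) (var 7)))

/-- Process a point at all levels. -/
def levelsLoop (d : ℕ) : Prog d :=
  .while (.lt (var 8) (.add (.lit 8) (var 5))) (levelUpdate d)

/-- The two lists of a level, and its cut. -/
structure LevelHolds (st : ℕ → ℕ) (p : ℕ → Pt d) (s : State d) (Λ x : ℕ) (l₀ : List (ℕ × ℕ))
    (c : ℕ) (l₁ : List (ℕ × ℕ)) : Prop where
  fst : LaneHolds st p s Λ x l₀
  cut : s.word (4 * x + 3) = c
  snd : LaneHolds st p s Λ (x + 1) l₁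

section Frames

variable {st : ℕ → ℕ} {p : ℕ → Pt d} {s s' : State d} {Λ x c : ℕ} {l l₀ l₁ : List (ℕ × ℕ)}

/-- A list occupies the cells of one residue class modulo `Λ`, its length being kept in a spare
field of its first cell. Changes in other classes cannot disturb it. -/
theorem LaneHolds.congr (h : LaneHolds st p s Λ x l) (hx : 8 ≤ x)
    (hw : ∀ a, 32 ≤ a → a / 4 % Λ = x % Λ → s'.word a = s.word a)
    (hp : ∀ y, 8 ≤ y → y % Λ = x % Λ → s'.point y = s.point y) : LaneHolds st p s' Λ x l := by
  refine ⟨(hw _ (by omega) ?_).trans h.1, h.2.congr fun j _ => ?_⟩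
  · rw [show (4 * x + 2) / 4 = x by omega]
  · have hm := mod_mul_add_left x Λ j
    refine ⟨hw _ (by omega) ?_, hw _ (by omega) ?_, hp _ (by omega) hm⟩
    · rw [show (4 * (x + Λ * j)) / 4 = x + Λ * j by omega, hm]
    · rw [show (4 * (x + Λ * j) + 1) / 4 = x + Λ * j by omega, hm]

theorem LevelHolds.congr (h : LevelHolds st p s Λ x l₀ c l₁) (hx : 8 ≤ x)
    (hw : ∀ a, 32 ≤ a → (a / 4 % Λ = x % Λ ∨ a / 4 % Λ = (x + 1) % Λ) → s'.word a = s.word a)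
    (hp : ∀ y, 8 ≤ y → (y % Λ = x % Λ ∨ y % Λ = (x + 1) % Λ) → s'.point y = s.point y) :
    LevelHolds st p s' Λ x l₀ c l₁ := by
  refine ⟨h.fst.congr hx (fun a h1 h2 => hw a h1 (Or.inl h2)) (fun y h1 h2 => hp y h1 (Or.inl h2)),
    (hw _ (by omega) (Or.inl ?_)).trans h.cut,
    h.snd.congr (by omega) (fun a h1 h2 => hw a h1 (Or.inr h2))
      (fun y h1 h2 => hp y h1 (Or.inr h2))⟩
  rw [show (4 * x + 3) / 4 = x by omega]

end Frames

variable {I : Stream d} {E : Env d}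

theorem Ready.congr {s s' : State d} {i : ℕ} (h : Ready I E s i) (h3 : s'.word 3 = s.word 3)
    (h0 : s'.point 0 = s.point 0) : Ready I E s' i :=
  ⟨h.admissible, h.d_pos, h.α_eq, h3.trans h.size, h0.trans h.point, h.base_pow⟩

theorem cutUpdate_runs {s : State d} {st : ℕ → ℕ} {p : ℕ → Pt d} {K Λ x c : ℕ}
    {l : List (ℕ × ℕ)} (hE : 64 ≤ 2 ^ E.bits) (hx : 8 ≤ x) (hX : 4 * x + 4 ≤ 2 ^ E.bits)
    (hΛ0 : 0 < Λ) (h6 : s.word 6 = K * Λ) (h8 : s.word 8 = x) (hl : LaneHolds st p s Λ x l)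
    (hc : s.word (4 * x + 3) = c) (hst : ∀ e ∈ l, st e.1 + 1 < 2 ^ E.bits) :
    Runs E cutUpdate s fun s' => (∀ a, s'.word a = if a = 9 ∨ a = 4 * x + 3 then raiseCut st K c l
      else s.word a) ∧ s'.point = s.point ∧ s.Within s' (x + 1) 70 := by
  unfold cutUpdate
  refine Runs.seq (Runs.setWord ?_)
  rw [eval_lit (by omega), eval_field hE (by omega) h8 hX (by omega), hc]
  set s₁ := State.tick (s.setWord 9 c) _ with hs₁
  have e1 : ∀ a, s₁.word a = if a = 9 then c else s.word a := fun a => by simp [hs₁]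
  have i8 : s₁.word 8 = x := by rw [e1]; simpa using h8
  have w1 : s.Within s₁ (x + 1) 20 := by
    refine ⟨?_, ?_, ?_, ?_⟩ <;> simp [hs₁, Expr.cost, var, field, fieldAddr]
    omega
  have hcond : (Expr.lt (var 6) (field 2 8) : Expr d).eval E s₁ =
      if K * Λ < Λ * l.length then 1 else 0 := by
    refine eval_lt (by omega) ((eval_var (by omega)).trans ?_)
      ((eval_field hE (by omega) i8 hX (by omega)).trans ?_)
    · rw [e1, if_neg (by omega)]; exact h6
    · rw [e1, if_neg (by omega)]; exact hl.1
  -- Lengths are stored multiplied by the stride, so the threshold in word `6` is `K * Λ` as well.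
  have hiff : K * Λ < Λ * l.length ↔ K < l.length := by
    rw [mul_comm K]
    exact Nat.mul_lt_mul_left hΛ0
  simp only [hiff] at hcond
  by_cases hK : K < l.length
  · rw [if_pos hK] at hcond
    refine Runs.ite_pos (by rw [hcond]; exact one_ne_zero) (Runs.seq (Runs.setWord (Runs.setWord ?_)))
    have hr : raiseCut st K c l = s.word (4 * x) + 1 ∧ s.word (4 * x) + 1 < 2 ^ E.bits := by
      rw [raiseCut, if_pos hK]
      cases l with
      | nil => simp at hK
      | cons e l =>
        rw [hl.2.1.1]
        exact ⟨rfl, hst e (by simp)⟩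
    have e2 : (Expr.add (field 0 8) (.lit 1) : Expr d).eval E s₁ = raiseCut st K c l := by
      rw [hr.1]
      refine eval_add ((eval_field hE (by omega) i8 hX (by omega)).trans ?_) (eval_lit (by omega)) hr.2
      rw [e1, if_neg (by omega), add_zero]
    rw [eval_lit (by omega), eval_tick, e2]
    set s₂ := State.tick (State.setWord _ 9 (raiseCut st K c l)) _ with hs₂
    have e3 : ∀ a, s₂.word a = if a = 9 then raiseCut st K c l else s₁.word a :=
      fun a => by simp [hs₂]
    have i8' : s₂.word 8 = x := by rw [e3]; simpa using i8
    rw [eval_fieldAddr hE (by omega) i8' hX (by omega), eval_var (by omega),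
      show s₂.word 9 = raiseCut st K c l by rw [e3, if_pos rfl]]
    refine ⟨fun a => ?_, rfl, w1.trans (n' := 50) ⟨?_, ?_, ?_, ?_⟩⟩
    · simp only [State.tick_word, State.setWord_word, e3, e1]
      split_ifs <;> first | rfl | omega
    · simp [hs₂]; omega
    · simp [hs₂]
    · simp [hs₂, Expr.cost, var, field, fieldAddr]
    · simp [hs₂]
  · rw [if_neg hK] at hcond
    refine Runs.ite_neg hcond (Runs.skip ⟨fun a => ?_, rfl, w1.trans (n' := 50) ⟨?_, ?_, ?_, ?_⟩⟩)
    · simp only [State.tick_word, e1, raiseCut, if_neg hK]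
      split_ifs <;> first | rfl | omega | skip
      rename_i h1 h2
      rcases h2 with rfl | rfl
      · omega
      · exact hc
    · simp
    · simp
    · simp [Expr.cost, var, field, fieldAddr]
    · simp

/-- The cost of processing a point at one level. -/
def levelCost (d N : ℕ) : ℕ := hashCost d 0 + hashCost d 1 + 600 + 160 * N

/-- The cut is raised once and stays in word `9` for both lists. They occupy adjacent residue
classes, so refreshing the first leaves the second intact and conversely. -/
theorem levelUpdate_runs {s : State d} {i : ℕ} {st : ℕ → ℕ} (h : Ready I E s i)
    (hE : 64 ≤ 2 ^ E.bits) {K Λ R x X c N : ℕ} {l₀ l₁ : List (ℕ × ℕ)} (hx : 8 ≤ x)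
    (hX : 4 * X + 4 ≤ 2 ^ E.bits) (hΛ0 : 0 < Λ) (hne : (x + 1) % Λ ≠ x % Λ)
    (hxX : x + 1 + Λ * (N + 1) ≤ X) (hl₀ : l₀.length ≤ N) (hl₁ : l₁.length ≤ N)
    (hR : R + R < 2 ^ E.bits) (hst : ∀ e ∈ l₀, st e.1 + 1 < 2 ^ E.bits)
    (h0 : s.word 0 = st i) (h5 : s.word 5 = Λ) (h6 : s.word 6 = K * Λ) (h7 : s.word 7 = R)
    (h8 : s.word 8 = x) (hl : LevelHolds st I.pt s Λ x l₀ c l₁) :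
    Runs E (levelUpdate d) s fun s' =>
      LevelHolds st I.pt s' Λ x
        (refresh I.Near st (raiseCut st K c l₀) i
          (initFlag (I.Accepted E.hash 0 R) (I.Touched E.hash 0 R) i) l₀) (raiseCut st K c l₀)
        (refresh I.Near st (raiseCut st K c l₀) i
          (initFlag (I.Accepted E.hash 1 R) (I.Touched E.hash 1 R) i) l₁) ∧
      s'.word 8 = x + 2 ∧ s'.word 7 = R + R ∧
      (∀ a < 32, (a < 7 ∨ 14 < a) → s'.word a = s.word a) ∧
      (∀ a, 32 ≤ a → a / 4 % Λ ≠ x % Λ → a / 4 % Λ ≠ (x + 1) % Λ → s'.word a = s.word a) ∧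
      (∀ y, (y < 8 ∨ (y % Λ ≠ x % Λ ∧ y % Λ ≠ (x + 1) % Λ)) → s'.point y = s.point y) ∧
      s.Within s' X (levelCost d N) := by
  have hm₀ := Nat.mul_le_mul_left Λ (Nat.succ_le_succ hl₀)
  have hm₁ := Nat.mul_le_mul_left Λ (Nat.succ_le_succ hl₁)
  simp only [Nat.succ_eq_add_one] at hm₀ hm₁
  set c' := raiseCut st K c l₀ with hc'
  unfold levelUpdate
  refine Runs.seq ((cutUpdate_runs hE hx (by omega) hΛ0 h6 h8 hl.fst hl.cut hst).mono ?_)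
  rintro s₁ ⟨e1, p1, w1⟩
  rw [← hc'] at e1
  have i8 : s₁.word 8 = x := by rw [e1, if_neg (by omega)]; exact h8
  refine Runs.seq (Runs.setWord ?_)
  rw [eval_lit (by omega), eval_var (by omega), i8]
  set s₂ := State.tick (s₁.setWord 14 x) _ with hs₂
  have e2 : ∀ a, s₂.word a = if a = 14 then x else if a = 9 ∨ a = 4 * x + 3 then c' else s.word a :=
    fun a => by simp [hs₂, e1]
  have p2 : s₂.point = s.point := p1
  have w2 : s.Within s₂ X 80 := by
    refine (w1.mono (Y' := X) (by omega) le_rfl).trans (n' := 10) ⟨?_, ?_, ?_, ?_⟩ <;>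
      simp [hs₂, Expr.cost, var]
    omega
  have hlane : ∀ z l, 8 ≤ z → LaneHolds st I.pt s Λ z l → LaneHolds st I.pt s₂ Λ z l := by
    intro z l hz hzl
    refine ⟨?_, hzl.2.congr fun j _ => ⟨?_, ?_, by rw [p2]⟩⟩
    · rw [e2, if_neg (by omega), if_neg (by omega)]; exact hzl.1
    · rw [e2, if_neg (by omega), if_neg (by omega)]
    · rw [e2, if_neg (by omega), if_neg (by omega)]
  refine Runs.seq ((laneUpdate_runs (st := st) (cut := c') (Λ := Λ) (R := R) (x := x) (X := X)
    (τ := 0) (l := l₀) (h.congr (by rw [e2]; simp; omega) (by rw [p2])) (by omega) hE hx hX hΛ0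
    (by omega)
    (by rw [e2, if_neg (by omega), if_neg (by omega)]; exact h0)
    (by rw [e2, if_neg (by omega), if_neg (by omega)]; exact h5)
    (by rw [e2, if_neg (by omega), if_neg (by omega)]; exact h7)
    (by rw [e2, if_neg (by omega), if_pos (by omega)])
    (by rw [e2, if_pos rfl]) (hlane _ _ hx hl.fst)).mono ?_)
  rintro s₃ ⟨L3, f3, w3⟩
  have v3 : ∀ a < 32, (a < 9 ∨ 14 < a) → s₃.word a = s.word a := by
    intro a ha ha'
    rw [f3.vars a ha (by simp; omega), e2, if_neg (by omega), if_neg (by omega)]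
  have i9 : s₃.word 9 = c' := by
    rw [f3.vars 9 (by omega) (by simp), e2, if_neg (by omega), if_pos (by omega)]
  have i8' : s₃.word 8 = x := (v3 8 (by omega) (by omega)).trans h8
  refine Runs.seq (Runs.setWord ?_)
  rw [eval_lit (by omega), eval_add (u := x) (v := 1) ((eval_var (by omega)).trans i8')
    (eval_lit (by omega)) (by omega)]
  set s₄ := State.tick (s₃.setWord 14 (x + 1)) _ with hs₄
  have e4 : ∀ a, s₄.word a = if a = 14 then x + 1 else s₃.word a := fun a => by simp [hs₄]
  have w4 : s.Within s₄ X (hashCost d 0 + 290 + 80 * N) := by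
    have hw : s₃.Within s₄ X 10 := by
      refine ⟨?_, ?_, ?_, ?_⟩ <;> simp [hs₄, Expr.cost, var]
      omega
    exact ((w2.trans w3).trans hw).mono le_rfl (by omega)
  have hne' : ∀ y, y % Λ = (x + 1) % Λ → y % Λ ≠ x % Λ := fun y hy => by rw [hy]; exact hne
  have L4 : LaneHolds st I.pt s₄ Λ (x + 1) l₁ := by
    refine (hlane _ _ (by omega) hl.snd).congr (by omega) (fun a ha ha' => ?_) (fun y _ hy => ?_)
    · have hax : a ≠ 4 * x + 2 := by
        rintro rfl
        rw [show (4 * x + 2) / 4 = x by omega] at ha'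
        exact hne ha'.symm
      rw [e4, if_neg (by omega)]
      exact f3.words a ha hax (Or.inl (hne' _ ha'))
    · exact f3.points y (Or.inl (hne' _ hy))
  have v4 : ∀ a < 32, (a < 9 ∨ 14 < a) → s₄.word a = s.word a := by
    intro a ha ha'
    rw [e4, if_neg (by omega)]
    exact v3 a ha ha'
  have p4 : s₄.point 0 = s.point 0 := (f3.points 0 (Or.inr (by omega))).trans (by rw [p2])
  refine Runs.seq ((laneUpdate_runs (st := st) (cut := c') (Λ := Λ) (R := R) (x := x + 1) (X := X)
    (τ := 1) (l := l₁) (h.congr (v4 3 (by omega) (by omega)) p4) (by omega) hE (by omega) hX hΛ0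
    (by omega)
    ((v4 0 (by omega) (by omega)).trans h0) ((v4 5 (by omega) (by omega)).trans h5)
    ((v4 7 (by omega) (by omega)).trans h7)
    (by rw [e4]; simpa using i9) (by rw [e4, if_pos rfl]) L4).mono ?_)
  rintro s₅ ⟨L5, f5, w5⟩
  have v5 : ∀ a < 32, (a < 9 ∨ 14 < a) → s₅.word a = s.word a := by
    intro a ha ha'
    rw [f5.vars a ha (by simp; omega)]
    exact v4 a ha ha'
  have i8'' : s₅.word 8 = x := (v5 8 (by omega) (by omega)).trans h8
  refine Runs.seq (Runs.setWord (Runs.setWord ?_))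
  rw [eval_lit (by omega), eval_add (u := x) (v := 2) ((eval_var (by omega)).trans i8'')
    (eval_lit (by omega)) (by omega)]
  set s₆ := State.tick (s₅.setWord 8 (x + 2)) _ with hs₆
  have i7 : s₆.word 7 = R := by
    simp only [hs₆, State.tick_word, State.setWord_word]
    rw [if_neg (by omega)]
    exact (v5 7 (by omega) (by omega)).trans h7
  rw [eval_lit (by omega), eval_add (u := R) (v := R) ((eval_var (by omega)).trans i7)
    ((eval_var (by omega)).trans i7) hR]
  set s₇ := State.tick (s₆.setWord 7 (R + R)) _ with hs₇
  have e7 : ∀ a, s₇.word a = if a = 7 then R + R else if a = 8 then x + 2 else s₅.word a :=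
    fun a => by simp [hs₇, hs₆]
  have e7' : ∀ a, 32 ≤ a → s₇.word a = s₅.word a := fun a ha => by
    rw [e7, if_neg (by omega), if_neg (by omega)]
  have p7 : s₇.point = s₅.point := rfl
  refine ⟨⟨?_, ?_, ?_⟩, ?_, ?_, fun a ha ha' => ?_, fun a ha h1 h2 => ?_, fun y hy => ?_, ?_⟩
  · refine L3.congr hx (fun a ha ha' => ?_) (fun y _ hy => ?_)
    · have hax : a ≠ 4 * (x + 1) + 2 := by
        rintro rfl
        rw [show (4 * (x + 1) + 2) / 4 = x + 1 by omega] at ha'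
        exact hne ha'
      rw [e7' a ha, f5.words a ha hax (Or.inl (by rw [ha']; exact hne.symm)), e4, if_neg (by omega)]
    · rw [p7, f5.points y (Or.inl (by rw [hy]; exact hne.symm))]
      rfl
  · rw [e7' _ (by omega), f5.words _ (by omega) (by omega) (Or.inr (by omega)), e4,
      if_neg (by omega), f3.words _ (by omega) (by omega) (Or.inr (by omega)), e2,
      if_neg (by omega), if_pos (by omega)]
  · exact L5.congr (by omega) (fun a ha _ => e7' a ha) (fun y _ _ => rfl)
  · rw [e7, if_neg (by omega), if_pos rfl]
  · rw [e7, if_pos rfl]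
  · rw [e7, if_neg (by omega), if_neg (by omega)]
    exact v5 a ha (by omega)
  · have ha1 : a ≠ 4 * x + 2 ∧ a ≠ 4 * x + 3 := by
      constructor
      · rintro rfl
        rw [show (4 * x + 2) / 4 = x by omega] at h1
        exact h1 rfl
      · rintro rfl
        rw [show (4 * x + 3) / 4 = x by omega] at h1
        exact h1 rfl
    have ha2 : a ≠ 4 * (x + 1) + 2 := by
      rintro rfl
      rw [show (4 * (x + 1) + 2) / 4 = x + 1 by omega] at h2
      exact h2 rfl
    rw [e7' a ha, f5.words a ha ha2 (Or.inl h2), e4, if_neg (by omega),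
      f3.words a ha ha1.1 (Or.inl h1), e2, if_neg (by omega), if_neg (by omega)]
  · rw [p7, f5.points y (by omega)]
    exact (f3.points y (by omega)).trans (by rw [p2])
  · have hw : s₅.Within s₇ X 20 := by
      refine ⟨?_, ?_, ?_, ?_⟩ <;> simp [hs₇, hs₆, Expr.cost, var]
      omega
    refine ((w4.trans w5).trans hw).mono le_rfl ?_
    unfold levelCost
    omega

section Levels

/-- The first list of the level with rate `1 / R`, and its cut, after `k` points. -/
def topList (I : Stream d) (mode : WindowModel) (K : ℕ) (H : ℕ → ℕ) (R k : ℕ) :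
    List (ℕ × ℕ) × ℕ :=
  boundedList I.Near (I.stampSeq mode) K (initFlag (I.Accepted H 0 R) (I.Touched H 0 R)) k

/-- The second list of the level with rate `1 / R` after `k` points. -/
def sampleList (I : Stream d) (mode : WindowModel) (K : ℕ) (H : ℕ → ℕ) (R k : ℕ) :
    List (ℕ × ℕ) :=
  groupList I.Near (I.stampSeq mode) (I.levelCuts mode K H R)
    (initFlag (I.Accepted H 1 R) (I.Touched H 1 R)) k

/-- The memory holds the lists of `n` levels after `k` points. -/
def MemoryHolds (I : Stream d) (mode : WindowModel) (K : ℕ) (H : ℕ → ℕ) (Λ n k : ℕ)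
    (s : State d) : Prop :=
  ∀ l < n, LevelHolds (I.stampSeq mode) I.pt s Λ (8 + 2 * l) (topList I mode K H (2 ^ l) k).1
    (topList I mode K H (2 ^ l) k).2 (sampleList I mode K H (2 ^ l) k)

theorem lane_mod_ne {n u v : ℕ} (hu : u < n) (hv : v < n) (huv : u ≠ v) :
    (8 + u) % n ≠ (8 + v) % n := by
  intro h
  have h1 : u ≡ v [MOD n] := Nat.ModEq.add_left_cancel' 8 h
  exact huv (Nat.ModEq.eq_of_lt_of_lt h1 hu hv)

/-- Loop invariant: levels below `l` are at stage `k + 1`, the others still at stage `k`. The space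
allows for one new entry per list and for the offset of its first cell, whence `N + 2`. -/
theorem levelsLoop_runs {mode : WindowModel} (hE : 64 ≤ 2 ^ E.bits) {K Λ n k N : ℕ}
    (hΛ : Λ = 2 * n) (hX : 4 * (8 + Λ * (N + 2)) + 4 ≤ 2 ^ E.bits) (hn : n < E.bits)
    (hN₀ : ∀ l < n, (topList I mode K E.hash (2 ^ l) k).1.length ≤ N)
    (hN₁ : ∀ l < n, (sampleList I mode K E.hash (2 ^ l) k).length ≤ N)
    (hst : ∀ l < n, ∀ e ∈ (topList I mode K E.hash (2 ^ l) k).1,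
      I.stampSeq mode e.1 + 1 < 2 ^ E.bits) (r : ℕ) :
    ∀ (s : State d) (l : ℕ), l + r = n → Ready I E s k → s.word 0 = I.stampSeq mode k →
    s.word 5 = Λ → s.word 6 = K * Λ → s.word 7 = 2 ^ l → s.word 8 = 8 + 2 * l →
    (∀ l' < l, LevelHolds (I.stampSeq mode) I.pt s Λ (8 + 2 * l')
      (topList I mode K E.hash (2 ^ l') (k + 1)).1
      (topList I mode K E.hash (2 ^ l') (k + 1)).2 (sampleList I mode K E.hash (2 ^ l') (k + 1))) →
    (∀ l', l ≤ l' → l' < n → LevelHolds (I.stampSeq mode) I.pt s Λ (8 + 2 * l')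
      (topList I mode K E.hash (2 ^ l') k).1
      (topList I mode K E.hash (2 ^ l') k).2 (sampleList I mode K E.hash (2 ^ l') k)) →
    Runs E (levelsLoop d) s fun s' => MemoryHolds I mode K E.hash Λ n (k + 1) s' ∧
      (∀ a < 32, (a < 7 ∨ 14 < a) → s'.word a = s.word a) ∧
      s.Within s' (8 + Λ * (N + 2)) (r * (levelCost d N + 10) + 10) := by
  have hcond : ∀ (s : State d) (l : ℕ), l ≤ n → s.word 5 = Λ → s.word 8 = 8 + 2 * l →
      (Expr.lt (var 8) (.add (.lit 8) (var 5)) : Expr d).eval E s =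
        if 8 + 2 * l < 8 + Λ then 1 else 0 := by
    intro s l _ h5 h8
    have hΛN : Λ ≤ Λ * (N + 2) := Nat.le_mul_of_pos_right _ (by omega)
    exact eval_lt (by omega) ((eval_var (by omega)).trans h8)
      (eval_add (eval_lit (by omega)) ((eval_var (by omega)).trans h5) (by omega))
  induction r with
  | zero =>
    intro s l hl _ _ h5 _ _ h8 hnew _
    refine Runs.while_neg ?_ ⟨fun l' hl' => ?_, fun _ _ _ => rfl, ?_, ?_, ?_, ?_⟩
    · rw [hcond s l (by omega) h5 h8, if_neg (by omega)]
    · exact (hnew l' (by omega)).congr (by omega) (fun _ _ _ => rfl) (fun _ _ _ => rfl)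
    · simp
    · simp
    · simp [Expr.cost, var]
    · rfl
  | succ r ih =>
    intro s l hl hr h0 h5 h6 h7 h8 hnew hold
    have hln : l < n := by omega
    refine Runs.while_pos ?_ ?_
    · rw [hcond s l hln.le h5 h8, if_pos (by omega)]
      exact one_ne_zero
    have hexp : Λ * (N + 2) = Λ * (N + 1) + Λ := by ring
    -- The rate is doubled once more after the last level; `n < bits` leaves room for this.
    have hpow : 2 ^ l + 2 ^ l < 2 ^ E.bits := by
      rw [← two_mul, ← pow_succ']
      exact Nat.pow_lt_pow_right (by omega) (by omega)
    have hmod : ∀ l' < n, l' ≠ l → (8 + 2 * l') % Λ ≠ (8 + 2 * l) % Λ ∧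
        (8 + 2 * l') % Λ ≠ (8 + 2 * l + 1) % Λ ∧ (8 + 2 * l' + 1) % Λ ≠ (8 + 2 * l) % Λ ∧
        (8 + 2 * l' + 1) % Λ ≠ (8 + 2 * l + 1) % Λ := by
      intro l' hl' hne
      simp only [add_assoc]
      refine ⟨?_, ?_, ?_, ?_⟩ <;> exact lane_mod_ne (by omega) (by omega) (by omega)
    refine (levelUpdate_runs (s := s.tick _) (st := I.stampSeq mode) (x := 8 + 2 * l)
      (X := 8 + Λ * (N + 2)) (N := N) (R := 2 ^ l) (K := K) (hr.congr rfl rfl) hE (by omega) hX (by omega)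
      (by rw [add_assoc]; exact lane_mod_ne (by omega) (by omega) (by omega)) (by omega) (hN₀ l hln)
      (hN₁ l hln) hpow (hst l hln) h0 h5 h6 h7 h8
      ((hold l le_rfl hln).congr (by omega) (fun _ _ _ => rfl) (fun _ _ _ => rfl))).mono ?_
    rintro s₁ ⟨g1, g8, g7, gv, gw, gp, gi⟩
    have hkeep : ∀ l' < n, l' ≠ l → ∀ L₀ c L₁,
        LevelHolds (I.stampSeq mode) I.pt s Λ (8 + 2 * l') L₀ c L₁ →
        LevelHolds (I.stampSeq mode) I.pt s₁ Λ (8 + 2 * l') L₀ c L₁ := by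
      intro l' hl' hne L₀ c L₁ hL
      obtain ⟨m1, m2, m3, m4⟩ := hmod l' hl' hne
      refine hL.congr (by omega) (fun a ha ha' => ?_) (fun y _ hy => ?_)
      · rcases ha' with h | h
        · exact gw a ha (by rw [h]; exact m1) (by rw [h]; exact m2)
        · exact gw a ha (by rw [h]; exact m3) (by rw [h]; exact m4)
      · rcases hy with h | h
        · exact gp y (Or.inr ⟨by rw [h]; exact m1, by rw [h]; exact m2⟩)
        · exact gp y (Or.inr ⟨by rw [h]; exact m3, by rw [h]; exact m4⟩)
    refine (ih s₁ (l + 1) (by omega) (hr.congr (gv 3 (by omega) (by omega)) (gp 0 (by omega)))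
      ((gv 0 (by omega) (by omega)).trans h0) ((gv 5 (by omega) (by omega)).trans h5)
      ((gv 6 (by omega) (by omega)).trans h6) (by rw [g7, pow_succ]; ring) (by rw [g8]; ring)
      (fun l' hl' => ?_) (fun l' hl' hl'' => hkeep l' hl'' (by omega) _ _ _ (hold l' (by omega) hl''))).mono ?_
    · by_cases hll : l' = l
      · subst hll
        exact g1
      · exact hkeep l' (by omega) hll _ _ _ (hnew l' (by omega))
    · rintro s' ⟨k1, k2, k3⟩
      refine ⟨k1, fun a ha ha' => (k2 a ha ha').trans (gv a ha ha'), ?_⟩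
      have hw : s.Within (s.tick ((Expr.lt (var 8) (.add (.lit 8) (var 5)) : Expr d).cost + 1))
          (8 + Λ * (N + 2)) 10 := by
        refine ⟨by simp, by simp, ?_, rfl⟩
        simp [Expr.cost, var]
      refine ((hw.trans gi).trans k3).mono le_rfl ?_
      rw [Nat.succ_mul]
      omega

end Levels

end SlidingSample

end

noncomputable section

namespace SlidingSample

variable {d : ℕ}

/-! ### Processing a point -/

/-- Add `inc` to word `v` for every doubling of word `16` below word `n`. -/
def clogLoop (n v inc : ℕ) : Prog d :=
  .while (.lt (var 16) (var n)) <|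
    .seq (.setWord (.lit 16) (.add (var 16) (var 16)))
      (.setWord (.lit v) (.add (var v) (.lit inc)))

/-- Word `16` equals `2 ^ i`, and `2 ^ i < N` holds exactly for `i < ⌈log₂ N⌉`. The hypothesis `2 *
N ≤ 2 ^ bits` makes the last doubling fit. -/
theorem clogLoop_runs {E : Env d} (hE : 64 ≤ 2 ^ E.bits) {n v inc N Y : ℕ} (hn : n < 16)
    (hv : v < 16) (hnv : n ≠ v) (_ : inc < 64) (hN : 2 * N ≤ 2 ^ E.bits) (hY : 8 ≤ Y) (r : ℕ) :
    ∀ (s : State d) (i a : ℕ), i + r = Nat.clog 2 N → s.word 16 = 2 ^ i → s.word n = N →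
    s.word v = a → a + inc * r < 2 ^ E.bits →
    Runs E (clogLoop n v inc) s fun s' =>
      s'.word v = a + inc * r ∧ (∀ x, x ≠ v → x ≠ 16 → s'.word x = s.word x) ∧
      s'.point = s.point ∧ s.Within s' Y (20 * (r + 1)) := by
  have hcond : ∀ (s : State d) (i : ℕ), s.word 16 = 2 ^ i → s.word n = N →
      (Expr.lt (var 16) (var n) : Expr d).eval E s = if i < Nat.clog 2 N then 1 else 0 := by
    intro s i h16 hn'
    rw [eval_lt (by omega) ((eval_var (by omega)).trans h16) ((eval_var (by omega)).trans hn')]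
    simp only [Nat.lt_clog_iff_pow_lt one_lt_two]
  induction r with
  | zero =>
    intro s i a hi h16 hN' ha _
    refine Runs.while_neg (by rw [hcond s i h16 hN', if_neg (by omega)])
      ⟨by simpa using ha, fun _ _ _ => rfl, rfl, ?_, ?_, ?_, rfl⟩ <;> simp [Expr.cost, var]
  | succ r ih =>
    intro s i a hi h16 hN' ha hlt
    have hiN : 2 ^ i < N := (Nat.lt_clog_iff_pow_lt one_lt_two).1 (by omega)
    have hmul : inc * (r + 1) = inc * r + inc := by ring
    refine Runs.while_pos (by rw [hcond s i h16 hN', if_pos (by omega)]; exact one_ne_zero)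
      (Runs.seq (Runs.setWord (Runs.setWord ?_)))
    simp only [eval_tick]
    rw [eval_lit (by omega), eval_add (u := 2 ^ i) (v := 2 ^ i) ((eval_var (by omega)).trans h16)
      ((eval_var (by omega)).trans h16) (by omega)]
    set s₁ := State.setWord _ 16 (2 ^ i + 2 ^ i) with hs₁
    rw [eval_lit (by omega), eval_add (u := a) (v := inc) ((eval_var (by omega)).trans ?_)
      (eval_lit (by omega)) (by omega)]
    · set s₂ := State.tick (State.setWord _ v (a + inc)) _ with hs₂
      have e : ∀ x, s₂.word x = if x = v then a + inc else if x = 16 then 2 ^ i + 2 ^ i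
          else s.word x := fun x => by simp [hs₂, hs₁]
      have hw : s.Within s₂ Y 20 := by
        refine ⟨?_, ?_, ?_, ?_⟩ <;> simp [hs₂, hs₁, Expr.cost, var]
        omega
      refine (ih s₂ (i + 1) (a + inc) (by omega) ?_ ?_ ?_ (by omega)).mono ?_
      · rw [e, if_neg (by omega), if_pos rfl, pow_succ]; ring
      · rw [e, if_neg hnv, if_neg (by omega)]; exact hN'
      · rw [e, if_pos rfl]
      · rintro s' ⟨k1, k2, k3, k4⟩
        refine ⟨by rw [k1]; omega, fun x h1 h2 => ?_, k3.trans rfl, (hw.trans k4).mono le_rfl ?_⟩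
        · rw [k2 x h1 h2, e, if_neg h1, if_neg h2]
        · omega
    · simp [hs₁, show v ≠ 16 by omega, ha]

namespace Stream

/-- The number of levels. -/
def levels (I : Stream d) : ℕ := Nat.clog 2 (min I.m I.w) + 1

/-- The greatest length of the first list of a level. -/
def bound (I : Stream d) : ℕ := 64 * ((4 * d + 1) ^ d) ^ 2 * Nat.clog 2 I.m

/-- Words of `b` bits suffice for all the computations. -/
structure WordSize (I : Stream d) (mode : WindowModel) (b : ℕ) : Prop where
  small : 64 ≤ 2 ^ b
  keys : 2 * I.base ^ d < 2 ^ b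
  levels : I.levels < b
  points : 2 * I.m ≤ 2 ^ b
  const : 64 * ((4 * d + 1) ^ d) ^ 2 < 2 ^ b
  bound : I.bound * (2 * I.levels) < 2 ^ b
  cells : 4 * (8 + 2 * I.levels * (I.m + 2)) + 4 ≤ 2 ^ b
  stamps : ∀ k < I.m, I.stampSeq mode k + 1 < 2 ^ b
  clock : I.clock mode I.T + 1 < 2 ^ b

end Stream

/-- The program that processes a point. -/
def updateProg (d : ℕ) : Prog d :=
  .seq (.setWord (.lit 15) (var 1)) <|
    .seq (.ite (.lt (var 2) (var 15)) (.setWord (.lit 15) (var 2)) .skip) <|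
    .seq (.setWord (.lit 5) (.lit 2)) <| .seq (.setWord (.lit 16) (.lit 1)) <|
    .seq (clogLoop 15 5 2) <|
    .seq (.setWord (.lit 6) (.lit 0)) <| .seq (.setWord (.lit 16) (.lit 1)) <|
    .seq (clogLoop 1 6 1) <|
    .seq (.setWord (.lit 6) (.mul (.mul (.lit (64 * ((4 * d + 1) ^ d) ^ 2)) (var 6)) (var 5))) <|
    .seq (.setWord (.lit 7) (.lit 1)) <| .seq (.setWord (.lit 8) (.lit 8)) (levelsLoop d)

/-- The cost of processing a point with lists of length `N`. -/
def updateCost (I : Stream d) (N : ℕ) : ℕ :=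
  I.levels * (levelCost d N + 10) + 20 * I.levels + 20 * Nat.clog 2 I.m + 140

variable {I : Stream d} {E : Env d}

/-- The number of lists and the scaled bound are recomputed for every point, at logarithmic cost.
Word `5` keeps the number of lists, where the queries find it. -/
theorem updateProg_runs {mode : WindowModel} (hW : I.WordSize mode E.bits) {k N : ℕ} (hN : N ≤ I.m)
    (hN₀ : ∀ l < I.levels, (topList I mode I.bound E.hash (2 ^ l) k).1.length ≤ N)
    (hN₁ : ∀ l < I.levels, (sampleList I mode I.bound E.hash (2 ^ l) k).length ≤ N)
    (hk : k < I.m) {s : State d} (hr : Ready I E s k)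
    (h0 : s.word 0 = I.stampSeq mode k) (h1 : s.word 1 = I.m) (h2 : s.word 2 = I.w)
    (hM : MemoryHolds I mode I.bound E.hash (2 * I.levels) I.levels k s) :
    Runs E (updateProg d) s fun s' =>
      MemoryHolds I mode I.bound E.hash (2 * I.levels) I.levels (k + 1) s' ∧
      (∀ a, 1 ≤ a → a < 5 → s'.word a = s.word a) ∧ s'.word 5 = 2 * I.levels ∧
      s.Within s' (8 + 2 * I.levels * (N + 2)) (updateCost I N) := by
  have hE := hW.small
  have hm := hW.points
  have hlev : 0 < I.levels := by unfold Stream.levels; omega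
  set Y := 8 + 2 * I.levels * (N + 2) with hYdef
  have hY : 8 ≤ Y := by omega
  have hYm : Y ≤ 8 + 2 * I.levels * (I.m + 2) := by
    have := Nat.mul_le_mul_left (2 * I.levels) (Nat.add_le_add_right hN 2)
    omega
  have hlev2 : 2 * I.levels < 2 ^ E.bits := by
    have h3 : 2 * I.levels ≤ 2 * I.levels * (I.m + 2) := Nat.le_mul_of_pos_right _ (by omega)
    have := hW.cells
    omega
  unfold updateProg
  refine Runs.seq (Runs.setWord ?_)
  rw [eval_lit (by omega), eval_var (by omega), h1]
  set s₁ := State.tick (s.setWord 15 I.m) _ with hs₁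
  have e1 : ∀ a, s₁.word a = if a = 15 then I.m else s.word a := fun a => by simp [hs₁]
  have w1 : s.Within s₁ Y 10 := by
    refine ⟨?_, ?_, ?_, ?_⟩ <;> simp [hs₁, Expr.cost, var]
    omega
  have hite : Runs E (.ite (.lt (var 2) (var 15)) (.setWord (.lit 15) (var 2)) .skip) s₁ fun s' =>
      (∀ a, s'.word a = if a = 15 then min I.m I.w else s.word a) ∧ s'.point = s.point ∧
        s₁.Within s' Y 20 := by
    have hc : (Expr.lt (var 2) (var 15) : Expr d).eval E s₁ = if I.w < I.m then 1 else 0 :=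
      eval_lt (by omega) ((eval_var (by omega)).trans (by rw [e1, if_neg (by omega)]; exact h2))
        ((eval_var (by omega)).trans (by rw [e1, if_pos rfl]))
    by_cases hwm : I.w < I.m
    · refine Runs.ite_pos (by rw [hc, if_pos hwm]; exact one_ne_zero) (Runs.setWord ?_)
      rw [eval_lit (by omega), eval_var (by omega),
        show (s₁.tick _).word 2 = I.w by rw [State.tick_word, e1, if_neg (by omega)]; exact h2,
        min_eq_right hwm.le]
      refine ⟨fun a => ?_, rfl, ?_, ?_, ?_, rfl⟩
      · simp only [State.tick_word, State.setWord_word, e1]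
        split_ifs <;> rfl
      · simp; omega
      · simp
      · simp [Expr.cost, var]
    · refine Runs.ite_neg (by rw [hc, if_neg hwm]) (Runs.skip ?_)
      rw [min_eq_left (not_lt.1 hwm)]
      refine ⟨fun a => by simp [e1], rfl, ?_, ?_, ?_, rfl⟩
      · simp
      · simp
      · simp [Expr.cost, var]
  refine Runs.seq (hite.mono ?_)
  rintro s₂ ⟨e2, p2, w2⟩
  -- Word `5` starts at `2` and gains `2` per doubling, ending at `2 (⌈log₂ (min m w)⌉ + 1)`, two
  -- lists per level.
  refine Runs.seq (Runs.setWord (Runs.seq (Runs.setWord ?_)))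
  rw [eval_lit (by omega), eval_lit (by omega), eval_lit (by omega), eval_lit (by omega)]
  set s₃ := State.tick (State.setWord _ 16 1) _ with hs₃
  have e3 : ∀ a, s₃.word a = if a = 16 then 1 else if a = 5 then 2 else if a = 15 then min I.m I.w
      else s.word a := fun a => by simp [hs₃, e2]
  have w3 : s₂.Within s₃ Y 10 := by
    refine ⟨?_, ?_, ?_, ?_⟩ <;> simp [hs₃, Expr.cost]
    omega
  refine Runs.seq ((clogLoop_runs (Y := Y) (N := min I.m I.w) hE (by omega) (by omega) (by omega) (by omega)
    (by have := min_le_left I.m I.w; omega)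
    hY (Nat.clog 2 (min I.m I.w)) s₃ 0 2 (by simp) (by rw [e3]; simp) (by rw [e3]; simp)
    (by rw [e3]; simp) (by unfold Stream.levels at hlev2; omega)).mono ?_)
  rintro s₄ ⟨v4, e4, p4, w4⟩
  have v4' : s₄.word 5 = 2 * I.levels := by rw [v4]; unfold Stream.levels; ring
  refine Runs.seq (Runs.setWord (Runs.seq (Runs.setWord ?_)))
  rw [eval_lit (by omega), eval_lit (by omega), eval_lit (by omega), eval_lit (by omega)]
  set s₅ := State.tick (State.setWord _ 16 1) _ with hs₅
  have e5 : ∀ a, s₅.word a = if a = 16 then 1 else if a = 6 then 0 else s₄.word a :=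
    fun a => by simp [hs₅]
  have w5 : s₄.Within s₅ Y 10 := by
    refine ⟨?_, ?_, ?_, ?_⟩ <;> simp [hs₅, Expr.cost]
    omega
  have hclogm : Nat.clog 2 I.m ≤ I.m := by
    refine Nat.clog_le_of_le_pow (Nat.lt_two_pow_self).le
  refine Runs.seq ((clogLoop_runs (Y := Y) hE (by omega) (by omega) (by omega) (by omega) hm
    hY (Nat.clog 2 I.m) s₅ 0 0 (by simp) (by rw [e5]; simp)
    (by rw [e5, if_neg (by omega), if_neg (by omega), e4 _ (by omega) (by omega), e3,
          if_neg (by omega), if_neg (by omega), if_neg (by omega)]; exact h1)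
    (by rw [e5]; simp) (by omega)).mono ?_)
  rintro s₆ ⟨v6, e6, p6, w6⟩
  have v65 : s₆.word 5 = 2 * I.levels := by
    rw [e6 _ (by omega) (by omega), e5, if_neg (by omega), if_neg (by omega)]; exact v4'
  have v6' : s₆.word 6 = Nat.clog 2 I.m := by rw [v6]; ring
  refine Runs.seq (Runs.setWord (Runs.seq (Runs.setWord (Runs.seq (Runs.setWord ?_)))))
  have hb1 : 64 * ((4 * d + 1) ^ d) ^ 2 * Nat.clog 2 I.m < 2 ^ E.bits :=
    lt_of_le_of_lt (Nat.le_mul_of_pos_right _ (by omega)) hW.bound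
  rw [eval_lit (by omega), eval_lit (by omega), eval_lit (by omega), eval_lit (by omega),
    eval_mul (u := I.bound) (v := 2 * I.levels)
      (eval_mul (eval_lit hW.const) ((eval_var (by omega)).trans v6') hb1)
      ((eval_var (by omega)).trans v65) hW.bound]
  set s₇ := State.tick (State.setWord _ 8 8) _ with hs₇
  have e7 : ∀ a, s₇.word a = if a = 8 then 8 else if a = 7 then 1 else if a = 6 then
      I.bound * (2 * I.levels) else s₆.word a := fun a => by simp [hs₇]
  have w7 : s₆.Within s₇ Y 30 := by
    refine ⟨?_, ?_, ?_, ?_⟩ <;> simp [hs₇, Expr.cost, var]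
    omega
  have p7 : s₇.point = s.point := p6.trans (p4.trans p2)
  have e7' : ∀ a, a < 5 ∨ 16 < a → s₇.word a = s.word a := by
    intro a ha
    rw [e7, if_neg (by omega), if_neg (by omega), if_neg (by omega), e6 _ (by omega) (by omega),
      e5, if_neg (by omega), if_neg (by omega), e4 _ (by omega) (by omega), e3, if_neg (by omega),
      if_neg (by omega), if_neg (by omega)]
  refine (levelsLoop_runs (mode := mode) hE (K := I.bound) (Λ := 2 * I.levels) (n := I.levels)
    (k := k) (N := N) rfl (by have := hW.cells; omega) hW.levels hN₀ hN₁ ?_ I.levels s₇ 0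
    (by omega) (hr.congr (e7' 3 (by omega)) (by rw [p7])) ((e7' 0 (by omega)).trans h0)
    (by rw [e7, if_neg (by omega), if_neg (by omega), if_neg (by omega)]; exact v65)
    (by rw [e7]; simp) (by rw [e7]; simp) (by rw [e7]; simp) (fun l' hl' => absurd hl' (by omega))
    (fun l' _ hl' => (hM l' hl').congr (by omega) (fun a ha _ => e7' a (by omega))
      (fun y _ _ => by rw [p7]))).mono ?_
  · intro l hl e he
    exact hW.stamps _ (lt_trans ((boundedList_bounds (hr.admissible.stampSeq_strictMono mode) k).1
      e he).1 hk)
  · rintro s' ⟨g1, g2, g3⟩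
    refine ⟨g1, fun a h1 h5 => ?_, ?_, ?_⟩
    · rw [g2 a (by omega) (by omega)]; exact e7' a (by omega)
    · rw [g2 5 (by omega) (by omega), e7, if_neg (by omega), if_neg (by omega), if_neg (by omega)]
      exact v65
    · refine (((((((w1.trans w2).trans w3).trans w4).trans w5).trans w6).trans w7).trans g3).mono
        le_rfl ?_
      unfold updateCost Stream.levels
      omega

end SlidingSample

end

noncomputable section

namespace SlidingSample

variable {d : ℕ}

theorem Runs.random {E : Env d} {s : State d} {Q : State d → Prop} {a k : Expr d}
    (h : Q ((s.setWord (a.eval E s)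
      (min ⌊k.eval E s * E.coin s.drawn⌋₊ (k.eval E s - 1))).draw.tick (a.cost + k.cost + 1))) :
    Runs E (.random a k) s Q := ⟨_, .random a k s, h⟩

/-! ### Answering a query -/

/-- Go up to the first level whose cut is at most word `9`. -/
def findLevel : Prog d :=
  .while (.mul (.lt (var 8) (.add (.lit 8) (var 5))) (.lt (var 9) (field 3 8)))
    (.setWord (.lit 8) (.add (var 8) (.lit 2)))

/-- Count the entries with a positive flag and a stamp of at least word `9`; the address of the one
whose number is in word `15` goes to word `11`. -/
def scanLoop : Prog d :=
  .while (.lt (var 10) (var 13)) <|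
    .seq (.ite (.lt (field 0 10) (var 9)) .skip
      (.ite (field 1 10)
        (.seq (.ite (.lt (var 16) (.add (var 15) (.lit 1))) (.setWord (.lit 11) (var 10)) .skip)
          (.setWord (.lit 16) (.add (var 16) (.lit 1)))) .skip))
    (.setWord (.lit 10) (.add (var 10) (var 5)))

/-- Go through the list whose first cell is in word `14`. -/
def scanProg : Prog d :=
  .seq (.setWord (.lit 16) (.lit 0)) <| .seq (.setWord (.lit 10) (var 14)) scanLoop

/-- The program that answers a query. -/
def queryProg (d : ℕ) : Prog d :=
  .seq (.setWord (.lit 9) (.sub (.add (var 0) (.lit 1)) (var 2))) <|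
    .seq (.setWord (.lit 8) (.lit 8)) <| .seq findLevel <|
    .ite (.lt (var 8) (.add (.lit 8) (var 5)))
      (.seq (.setWord (.lit 14) (.add (var 8) (.lit 1))) <|
        .seq (.setWord (.lit 13) (.add (var 14) (field 2 14))) <|
        .seq (.setWord (.lit 15) (.lit 0)) <| .seq scanProg <|
        .ite (var 16)
          (.seq (.random (.lit 15) (var 16)) <| .seq scanProg <|
            .seq (.copyPoint (.lit 0) (var 11)) (.setWord (.lit 0) (.lit 1)))
          (.setWord (.lit 0) (.lit 0)))
      (.setWord (.lit 0) (.lit 0))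

/-- From `s` to `s'` no random number was drawn, and nothing but the words in `V` was changed. -/
structure State.Quiet (s s' : State d) (V : Finset ℕ) : Prop where
  words : ∀ a ∉ V, s'.word a = s.word a
  points : s'.point = s.point
  wordsUsed : s'.wordsUsed ≤ max s.wordsUsed 32
  pointsUsed : s'.pointsUsed = s.pointsUsed
  drawn : s'.drawn = s.drawn

theorem State.Quiet.trans {s s' s'' : State d} {V V' : Finset ℕ} (h : s.Quiet s' V)
    (h' : s'.Quiet s'' V') : s.Quiet s'' (V ∪ V') :=
  ⟨fun a ha => (h'.words a fun hm => ha (Finset.mem_union_right _ hm)).trans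
      (h.words a fun hm => ha (Finset.mem_union_left _ hm)),
    h'.points.trans h.points, by have := h.wordsUsed; have := h'.wordsUsed; omega,
    h'.pointsUsed.trans h.pointsUsed, h'.drawn.trans h.drawn⟩

theorem State.Quiet.mono {s s' : State d} {V V' : Finset ℕ} (h : s.Quiet s' V) (hV : V ⊆ V') :
    s.Quiet s' V' :=
  ⟨fun a ha => h.words a fun hm => ha (hV hm), h.points, h.wordsUsed, h.pointsUsed, h.drawn⟩

theorem State.quiet_tick (s : State d) (n : ℕ) (V : Finset ℕ) : s.Quiet (s.tick n) V :=
  ⟨fun _ _ => rfl, rfl, le_max_left _ _, rfl, rfl⟩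

theorem State.quiet_setWord (s : State d) {a : ℕ} (ha : a < 32) (v : ℕ) :
    s.Quiet (s.setWord a v) {a} :=
  ⟨fun b hb => by rw [State.setWord_word, if_neg (by simpa using hb)], rfl,
    by rw [State.setWord_wordsUsed]; omega, rfl, rfl⟩

/-- The entries with a positive flag and a stamp of at least `ws`. -/
def liveEntries (st : ℕ → ℕ) (ws : ℕ) (l : List (ℕ × ℕ)) : List (ℕ × ℕ) :=
  l.filter fun e => decide (ws ≤ st e.1 ∧ e.2 ≠ 0)

open Classical in
/-- The points among which a query chooses: the live entries of the first level whose cut is at most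
`ws`. -/
def pool (st : ℕ → ℕ) (n ws : ℕ) (c : ℕ → ℕ) (S : ℕ → List (ℕ × ℕ)) : List ℕ :=
  if h : ∃ l, l < n ∧ c l ≤ ws then (liveEntries st ws (S (Nat.find h))).map Prod.fst else []

theorem pool_eq {st : ℕ → ℕ} {n ws : ℕ} {c : ℕ → ℕ} {S : ℕ → List (ℕ × ℕ)} {l : ℕ} (hl : l < n)
    (hc : c l ≤ ws) (hlt : ∀ l' < l, ws < c l') :
    pool st n ws c S = (liveEntries st ws (S l)).map Prod.fst := by
  classical
  have h : ∃ l, l < n ∧ c l ≤ ws := ⟨l, hl, hc⟩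
  have hf : Nat.find h = l := by
    rw [Nat.find_eq_iff]
    exact ⟨⟨hl, hc⟩, fun l' hl' h' => absurd h'.2 (not_le.2 (hlt l' hl'))⟩
  rw [pool, dif_pos h, hf]

theorem pool_eq_nil {st : ℕ → ℕ} {n ws : ℕ} {c : ℕ → ℕ} {S : ℕ → List (ℕ × ℕ)}
    (h : ∀ l < n, ws < c l) : pool st n ws c S = [] := by
  rw [pool, dif_neg]
  rintro ⟨l, hl, hc⟩
  exact absurd hc (not_le.2 (h l hl))

section

variable {E : Env d} {st : ℕ → ℕ} {p : ℕ → Pt d}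

theorem findLevel_runs (hE : 64 ≤ 2 ^ E.bits) {n ws : ℕ} {c : ℕ → ℕ}
    (hX : 4 * (8 + 2 * n) + 4 ≤ 2 ^ E.bits) (r : ℕ) :
    ∀ (s : State d) (l : ℕ), l + r = n → s.word 5 = 2 * n → s.word 8 = 8 + 2 * l →
    s.word 9 = ws → (∀ l < n, s.word (4 * (8 + 2 * l) + 3) = c l) → (∀ l' < l, ws < c l') →
    Runs E findLevel s fun s' => s.Quiet s' {8} ∧ ∃ l ≤ n, s'.word 8 = 8 + 2 * l ∧
      (∀ l' < l, ws < c l') ∧ (l < n → c l ≤ ws) := by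
  have hcond : ∀ (s : State d) (l : ℕ), l ≤ n → s.word 5 = 2 * n → s.word 8 = 8 + 2 * l →
      s.word 9 = ws →
      (Expr.mul (.lt (var 8) (.add (.lit 8) (var 5))) (.lt (var 9) (field 3 8)) : Expr d).eval E s =
        (if 8 + 2 * l < 8 + 2 * n then 1 else 0) *
          (if ws < s.word (4 * (8 + 2 * l) + 3) then 1 else 0) := by
    intro s l hl h5 h8 h9
    refine eval_mul (eval_lt (by omega) ((eval_var (by omega)).trans h8)
      (eval_add (eval_lit (by omega)) ((eval_var (by omega)).trans h5) (by omega)))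
      (eval_lt (by omega) ((eval_var (by omega)).trans h9)
        (eval_field hE (by omega) h8 (by omega) (by omega))) ?_
    split_ifs <;> omega
  induction r with
  | zero =>
    intro s l hl h5 h8 h9 hc hlt
    refine Runs.while_neg ?_ ⟨s.quiet_tick _ _, l, by omega, h8, hlt, fun h => by omega⟩
    -- The product of the two comparisons acts as a conjunction. Past the last level the first
    -- factor vanishes, whatever word the second one reads.
    rw [hcond s l (by omega) h5 h8 h9, if_neg (by omega), zero_mul]
  | succ r ih =>
    intro s l hl h5 h8 h9 hc hlt
    have hln : l < n := by omega
    have hcl := hc l hln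
    by_cases hw : ws < c l
    · refine Runs.while_pos ?_ (Runs.setWord ?_)
      · rw [hcond s l hln.le h5 h8 h9, if_pos (by omega), hcl, if_pos hw]
        decide
      rw [eval_lit (by omega), eval_tick, eval_add (u := 8 + 2 * l) (v := 2)
        ((eval_var (by omega)).trans h8) (eval_lit (by omega)) (by omega)]
      set s₁ := State.tick (State.setWord _ 8 (8 + 2 * l + 2)) _ with hs₁
      have e : ∀ a, s₁.word a = if a = 8 then 8 + 2 * l + 2 else s.word a := fun a => by simp [hs₁]
      have q : s.Quiet s₁ {8} := (((s.quiet_tick _ {8}).trans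
        (State.quiet_setWord _ (by omega) _)).trans (State.quiet_tick _ _ {8})).mono (by decide)
      refine (ih s₁ (l + 1) (by omega) (by rw [e]; simpa using h5) (by rw [e]; simp; ring)
        (by rw [e]; simpa using h9) (fun l' hl' => by rw [e, if_neg (by omega)]; exact hc l' hl')
        fun l' hl' => ?_).mono fun s' h => ⟨(q.trans h.1).mono (by decide), h.2⟩
      rcases Nat.lt_succ_iff_lt_or_eq.1 hl' with h | rfl
      · exact hlt l' h
      · exact hw
    · refine Runs.while_neg ?_ ⟨s.quiet_tick _ _, l, hln.le, h8, hlt, fun _ => not_lt.1 hw⟩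
      rw [hcond s l hln.le h5 h8 h9, hcl, if_neg hw, mul_zero]

/-- Word `11` is overwritten at each live entry as long as the number of live entries seen before it
is at most `r`. Its final value is thus the address of live entry number `r`, counted from `0`, if
there is one. -/
theorem scanLoop_runs (hE : 64 ≤ 2 ^ E.bits) {ws Λ r X : ℕ} (hX : 4 * X + 4 ≤ 2 ^ E.bits)
    (hr : r + 1 < 2 ^ E.bits) (rest : List (ℕ × ℕ)) : ∀ (s : State d) (x n : ℕ),
    8 ≤ x → x + Λ * rest.length ≤ X → n + rest.length < 2 ^ E.bits → 0 < Λ →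
    s.word 5 = Λ → s.word 9 = ws → s.word 10 = x → s.word 13 = x + Λ * rest.length →
    s.word 15 = r → s.word 16 = n → Segment st p s Λ x rest →
    Runs E scanLoop s fun s' => s.Quiet s' {10, 11, 16} ∧
      s'.word 16 = n + (liveEntries st ws rest).length ∧
      (r < n → s'.word 11 = s.word 11) ∧
      ∀ e, n ≤ r → (liveEntries st ws rest)[r - n]? = some e →
        s.point (s'.word 11) = some (p e.1) := by
  induction rest with
  | nil =>
    intro s x n _ _ _ _ h5 h9 h10 h13 h15 h16 _
    rw [List.length_nil, mul_zero, add_zero] at h13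
    refine Runs.while_neg ?_ ⟨s.quiet_tick _ _, by simpa [liveEntries] using h16, fun _ => rfl, ?_⟩
    · rw [eval_lt (u := x) (v := x) (by omega) ((eval_var (by omega)).trans h10)
        ((eval_var (by omega)).trans h13), if_neg (lt_irrefl x)]
    · simp [liveEntries]
  | cons e rest ih =>
    intro s x n hx hxX hn hΛ h5 h9 h10 h13 h15 h16 hseg
    obtain ⟨⟨c0, c1, c2⟩, hseg⟩ := hseg
    have hlen : x + Λ * (e :: rest).length = x + Λ + Λ * rest.length := by
      rw [List.length_cons]; ring
    rw [hlen] at h13 hxX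
    rw [List.length_cons] at hn
    refine Runs.while_pos ?_ (Runs.seq ?_)
    · rw [eval_lt (u := x) (v := x + Λ + Λ * rest.length) (by omega)
        ((eval_var (by omega)).trans h10) ((eval_var (by omega)).trans h13), if_pos (by omega)]
      exact one_ne_zero
    set s₀ := s.tick ((Expr.lt (var 10) (var 13) : Expr d).cost + 1) with hs₀
    -- the rest of the loop
    have hrest : ∀ (s₁ : State d) (n' : ℕ), s.Quiet s₁ {10, 11, 16} → s₁.word 10 = x →
        s₁.word 16 = n' → n' ≤ n + 1 →
        (n' + (liveEntries st ws rest).length = n + (liveEntries st ws (e :: rest)).length) →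
        (r < n → r < n' ∧ s₁.word 11 = s.word 11) →
        (∀ e', n ≤ r → (liveEntries st ws (e :: rest))[r - n]? = some e' →
          (n' ≤ r ∧ (liveEntries st ws rest)[r - n']? = some e') ∨
            (r < n' ∧ s.point (s₁.word 11) = some (p e'.1))) →
        Runs E (.setWord (.lit 10) (.add (var 10) (var 5))) s₁ fun s' =>
          Runs E scanLoop s' fun s' => s.Quiet s' {10, 11, 16} ∧
            s'.word 16 = n + (liveEntries st ws (e :: rest)).length ∧
            (r < n → s'.word 11 = s.word 11) ∧
            ∀ e', n ≤ r → (liveEntries st ws (e :: rest))[r - n]? = some e' →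
              s.point (s'.word 11) = some (p e'.1) := by
      intro s₁ n' hq g10 g16 hn' hcount hlow hhigh
      refine Runs.setWord ?_
      have hw : ∀ a, a ≠ 10 → a ≠ 11 → a ≠ 16 → s₁.word a = s.word a := fun a h1 h2 h3 =>
        hq.words a (by simp [h1, h2, h3])
      rw [eval_lit (by omega), eval_add (u := x) (v := Λ) ((eval_var (by omega)).trans g10)
        ((eval_var (by omega)).trans ((hw 5 (by omega) (by omega) (by omega)).trans h5)) (by omega)]
      set s₂ := State.tick (s₁.setWord 10 (x + Λ)) _ with hs₂
      have e2 : ∀ a, s₂.word a = if a = 10 then x + Λ else s₁.word a := fun a => by simp [hs₂]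
      have e2' : ∀ a, a ≠ 10 → a ≠ 11 → a ≠ 16 → s₂.word a = s.word a := fun a h1 h2 h3 => by
        rw [e2, if_neg h1, hw a h1 h2 h3]
      have q2 : s.Quiet s₂ {10, 11, 16} := ((hq.trans (State.quiet_setWord s₁ (by omega) _)).trans
        (State.quiet_tick _ _ {10})).mono (by decide)
      refine (ih s₂ (x + Λ) n' (by omega) (by omega) (by omega) hΛ
        ((e2' 5 (by omega) (by omega) (by omega)).trans h5)
        ((e2' 9 (by omega) (by omega) (by omega)).trans h9) (by rw [e2, if_pos rfl])
        ((e2' 13 (by omega) (by omega) (by omega)).trans h13)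
        ((e2' 15 (by omega) (by omega) (by omega)).trans h15)
        (by rw [e2, if_neg (by omega)]; exact g16)
        (hseg.congr fun j _ => ⟨?_, ?_, by rw [q2.points]⟩)).mono ?_
      · exact e2' _ (by omega) (by omega) (by omega)
      · exact e2' _ (by omega) (by omega) (by omega)
      · rintro s' ⟨k1, k2, k3, k4⟩
        have k3' : r < n' → s'.word 11 = s₁.word 11 := fun h => by
          rw [k3 h, e2, if_neg (by omega)]
        refine ⟨(q2.trans k1).mono (by decide), k2.trans hcount, fun h => ?_, fun e' h1 h2 => ?_⟩
        · rw [k3' (hlow h).1, (hlow h).2]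
        · rcases hhigh e' h1 h2 with ⟨h3, h4⟩ | ⟨h3, h4⟩
          · rw [← q2.points]
            exact k4 e' h3 h4
          · rw [k3' h3]
            exact h4
    have hx4 : 4 * x + 4 ≤ 2 ^ E.bits := by omega
    have e0 : (field 0 10 : Expr d).eval E s₀ = st e.1 := by
      rw [hs₀, eval_tick, eval_field (z := x) hE (by omega) h10 hx4 (by omega)]; exact c0
    have hdead : ¬ (ws ≤ st e.1 ∧ e.2 ≠ 0) →
        liveEntries st ws (e :: rest) = liveEntries st ws rest := fun h => by
      rw [liveEntries, liveEntries, List.filter_cons_of_neg (by simpa using h)]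
    by_cases hc : st e.1 < ws
    · refine Runs.ite_pos ?_ (Runs.skip ?_)
      · rw [eval_lt (by omega) e0 ((eval_var (by omega)).trans h9), if_pos hc]
        exact one_ne_zero
      have hd := hdead fun h => absurd h.1 (not_le.2 hc)
      exact hrest _ n ⟨fun _ _ => rfl, rfl, le_max_left _ _, rfl, rfl⟩ h10 h16 (by omega) (by rw [hd])
        (fun h => ⟨h, rfl⟩) fun e' h1 h2 => Or.inl ⟨h1, by rwa [hd] at h2⟩
    · refine Runs.ite_neg ?_ ?_
      · rw [eval_lt (by omega) e0 ((eval_var (by omega)).trans h9), if_neg hc]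
      have e1 : ∀ m, (field 1 10 : Expr d).eval E (s₀.tick m) = e.2 := fun m => by
        rw [eval_tick, hs₀, eval_tick, eval_field (z := x) hE (by omega) h10 hx4 (by omega)]
        exact c1
      by_cases hf : e.2 = 0
      · refine Runs.ite_neg (by rw [e1, hf]) (Runs.skip ?_)
        have hd := hdead fun h => h.2 hf
        exact hrest _ n ⟨fun _ _ => rfl, rfl, le_max_left _ _, rfl, rfl⟩ h10 h16 (by omega)
          (by rw [hd]) (fun h => ⟨h, rfl⟩) fun e' h1 h2 => Or.inl ⟨h1, by rwa [hd] at h2⟩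
      · have hlive : liveEntries st ws (e :: rest) = e :: liveEntries st ws rest := by
          rw [liveEntries, liveEntries, List.filter_cons_of_pos (by simpa [hf] using not_lt.1 hc)]
        refine Runs.ite_pos (by rw [e1]; exact hf) (Runs.seq ?_)
        set s₁ := State.tick (State.tick s₀ _) _ with hs₁
        have q1 : s.Quiet s₁ {10, 11, 16} := ⟨fun _ _ => rfl, rfl, le_max_left _ _, rfl, rfl⟩
        have f1 : s₁.word = s.word := rfl
        have hcnd : (Expr.lt (var 16) (.add (var 15) (.lit 1)) : Expr d).eval E s₁ =
            if n < r + 1 then 1 else 0 :=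
          eval_lt (by omega) ((eval_var (by omega)).trans h16)
            (eval_add ((eval_var (by omega)).trans h15) (eval_lit (by omega)) hr)
        have hinc : ∀ s₂ : State d, s.Quiet s₂ {10, 11, 16} → s₂.word 10 = x → s₂.word 16 = n →
            s₂.word 11 = (if n < r + 1 then x else s.word 11) →
            Runs E (.setWord (.lit 16) (.add (var 16) (.lit 1))) s₂ fun s' =>
              Runs E (.setWord (.lit 10) (.add (var 10) (var 5))) s' fun s' =>
              Runs E scanLoop s' fun s' => s.Quiet s' {10, 11, 16} ∧
              s'.word 16 = n + (liveEntries st ws (e :: rest)).length ∧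
              (r < n → s'.word 11 = s.word 11) ∧
              ∀ e', n ≤ r → (liveEntries st ws (e :: rest))[r - n]? = some e' →
                s.point (s'.word 11) = some (p e'.1) := by
          intro s₂ q2 g10 g16 g11
          refine Runs.setWord ?_
          rw [eval_lit (by omega), eval_add (u := n) (v := 1) ((eval_var (by omega)).trans g16)
            (eval_lit (by omega)) (by omega)]
          refine hrest _ (n + 1) ((((q2.trans (State.quiet_setWord s₂ (by omega) _))).trans
            (State.quiet_tick _ _ {10})).mono (by decide)) (by simpa using g10) (by simp) le_rfl ?_
            ?_ ?_
          · rw [hlive, List.length_cons]; omega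
          · intro h
            rw [if_neg (by omega)] at g11
            exact ⟨by omega, by simpa using g11⟩
          · intro e' h1 h2
            rw [hlive] at h2
            by_cases hnr : n = r
            · right
              subst hnr
              simp only [Nat.sub_self, List.getElem?_cons_zero, Option.some.injEq] at h2
              subst h2
              rw [if_pos (by omega)] at g11
              exact ⟨by omega, by simpa [g11] using c2⟩
            · left
              rw [show r - n = r - (n + 1) + 1 by omega, List.getElem?_cons_succ] at h2
              exact ⟨by omega, h2⟩
        by_cases hnr : n < r + 1
        · refine Runs.ite_pos (by rw [hcnd, if_pos hnr]; exact one_ne_zero) (Runs.setWord ?_)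
          rw [eval_lit (by omega), eval_tick, eval_var (by omega), f1, h10]
          refine hinc _ ((((q1.trans (State.quiet_tick _ _ {10})).trans
            (State.quiet_setWord _ (by omega) _)).trans (State.quiet_tick _ _ {10})).mono (by decide))
            (by simpa [f1] using h10) (by simpa [f1] using h16) ?_
          rw [if_pos hnr]
          simp
        · refine Runs.ite_neg (by rw [hcnd, if_neg hnr]) (Runs.skip ?_)
          refine hinc _ ⟨fun _ _ => rfl, rfl, le_max_left _ _, rfl, rfl⟩ h10 h16 ?_
          rw [if_neg hnr]
          rfl

theorem scanProg_runs (hE : 64 ≤ 2 ^ E.bits) {ws Λ r X x : ℕ} {l : List (ℕ × ℕ)}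
    (hX : 4 * X + 4 ≤ 2 ^ E.bits) (hr : r + 1 < 2 ^ E.bits) (hx : 8 ≤ x)
    (hxX : x + Λ * l.length ≤ X) (hl : l.length < 2 ^ E.bits) (hΛ : 0 < Λ) {s : State d}
    (h5 : s.word 5 = Λ) (h9 : s.word 9 = ws) (h13 : s.word 13 = x + Λ * l.length)
    (h14 : s.word 14 = x) (h15 : s.word 15 = r) (hseg : Segment st p s Λ x l) :
    Runs E scanProg s fun s' => s.Quiet s' {10, 11, 16} ∧
      s'.word 16 = (liveEntries st ws l).length ∧
      ∀ e, (liveEntries st ws l)[r]? = some e → s.point (s'.word 11) = some (p e.1) := by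
  unfold scanProg
  refine Runs.seq (Runs.setWord (Runs.seq (Runs.setWord ?_)))
  rw [eval_lit (by omega), eval_lit (by omega), eval_lit (by omega), eval_tick,
    eval_var (by omega), show (s.setWord 16 0).word 14 = x by simpa using h14]
  set s₁ := State.tick (State.setWord _ 10 x) _ with hs₁
  have q : s.Quiet s₁ {10, 11, 16} := ((((s.quiet_setWord (by omega) _).trans
    (State.quiet_tick _ _ {10})).trans (State.quiet_setWord _ (by omega) _)).trans
    (State.quiet_tick _ _ {10})).mono (by decide)
  have e : ∀ a, a ≠ 10 → a ≠ 11 → a ≠ 16 → s₁.word a = s.word a := fun a h1 h2 h3 =>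
    q.words a (by simp [h1, h2, h3])
  refine (scanLoop_runs hE hX hr l s₁ x 0 hx hxX (by omega) hΛ
    ((e 5 (by omega) (by omega) (by omega)).trans h5)
    ((e 9 (by omega) (by omega) (by omega)).trans h9) (by simp [hs₁])
    ((e 13 (by omega) (by omega) (by omega)).trans h13)
    ((e 15 (by omega) (by omega) (by omega)).trans h15) (by simp [hs₁])
    (hseg.congr fun j _ => ⟨?_, ?_, by rw [q.points]⟩)).mono ?_
  · exact e _ (by omega) (by omega) (by omega)
  · exact e _ (by omega) (by omega) (by omega)
  · rintro s' ⟨k1, k2, -, k4⟩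
    refine ⟨(q.trans k1).mono (by decide), by simpa using k2, fun e' he' => ?_⟩
    rw [← q.points]
    exact k4 e' (by omega) (by simpa using he')

theorem queryProg_runs (hE : 64 ≤ 2 ^ E.bits) {n N clk w : ℕ} {c : ℕ → ℕ}
    {S : ℕ → List (ℕ × ℕ)} (hX : 4 * (8 + 2 * n * (N + 2)) + 4 ≤ 2 ^ E.bits)
    (hclk : clk + 1 < 2 ^ E.bits) (hS : ∀ l < n, (S l).length ≤ N) {s : State d}
    (h0 : s.word 0 = clk) (h2 : s.word 2 = w) (h5 : s.word 5 = 2 * n)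
    (hc : ∀ l < n, s.word (4 * (8 + 2 * l) + 3) = c l)
    (hseg : ∀ l < n, LaneHolds st p s (2 * n) (8 + 2 * l + 1) (S l)) :
    Runs E (queryProg d) s fun s' => s'.wordsUsed ≤ max s.wordsUsed 32 ∧
      s'.pointsUsed ≤ max s.pointsUsed 1 ∧
      (pool st n (clk + 1 - w) c S = [] → s'.word 0 = 0) ∧
      ∀ j, (pool st n (clk + 1 - w) c S)[min
          ⌊((pool st n (clk + 1 - w) c S).length : ℝ) * E.coin s.drawn⌋₊
          ((pool st n (clk + 1 - w) c S).length - 1)]? = some j →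
        s'.word 0 ≠ 0 ∧ s'.point 0 = some (p j) := by
  have hn : 2 * n ≤ 2 * n * (N + 2) := Nat.le_mul_of_pos_right _ (by omega)
  unfold queryProg
  refine Runs.seq (Runs.setWord (Runs.seq (Runs.setWord (Runs.seq ?_))))
  rw [eval_lit (by omega), eval_lit (by omega), eval_sub (u := clk + 1) (v := w)
    (eval_add ((eval_var (by omega)).trans h0) (eval_lit (by omega)) hclk)
    ((eval_var (by omega)).trans h2)]
  set ws := clk + 1 - w with hws
  set s₁ := State.tick (State.setWord _ 8 8) _ with hs₁
  have q1 : s.Quiet s₁ {8, 9} := ((((s.quiet_setWord (by omega) _).trans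
    (State.quiet_tick _ _ {8})).trans (State.quiet_setWord _ (by omega) _)).trans
    (State.quiet_tick _ _ {8})).mono (by decide)
  have e1 : ∀ a, a ≠ 8 → a ≠ 9 → s₁.word a = s.word a := fun a h1 h2 =>
    q1.words a (by simp [h1, h2])
  refine (findLevel_runs (n := n) (ws := ws) (c := c) hE (by omega) n s₁ 0 (by omega)
    ((e1 5 (by omega) (by omega)).trans h5) (by simp [hs₁]) (by simp [hs₁])
    (fun l hl => (e1 _ (by omega) (by omega)).trans (hc l hl))
    fun l' hl' => absurd hl' (by omega)).mono ?_
  rintro s₂ ⟨q2, l, hln, g8, hlt, hcl⟩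
  have q2' : s.Quiet s₂ {8, 9} := (q1.trans q2).mono (by decide)
  have e2 : ∀ a, a ≠ 8 → a ≠ 9 → s₂.word a = s.word a := fun a h1 h2 =>
    q2'.words a (by simp [h1, h2])
  have g9 : s₂.word 9 = ws := by rw [q2.words 9 (by decide)]; simp [hs₁]
  have g5 : s₂.word 5 = 2 * n := (e2 5 (by omega) (by omega)).trans h5
  have hcond : (Expr.lt (var 8) (.add (.lit 8) (var 5)) : Expr d).eval E s₂ =
      if 8 + 2 * l < 8 + 2 * n then 1 else 0 :=
    eval_lt (by omega) ((eval_var (by omega)).trans g8)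
      (eval_add (eval_lit (by omega)) ((eval_var (by omega)).trans g5) (by omega))
  have hfail : ∀ s₃ : State d, s₃.wordsUsed ≤ max s.wordsUsed 32 →
      s₃.pointsUsed ≤ max s.pointsUsed 1 → pool st n ws c S = [] →
      Runs E (.setWord (.lit 0) (.lit 0)) s₃ fun s' => s'.wordsUsed ≤ max s.wordsUsed 32 ∧
        s'.pointsUsed ≤ max s.pointsUsed 1 ∧ (pool st n ws c S = [] → s'.word 0 = 0) ∧
        ∀ j, (pool st n ws c S)[min ⌊((pool st n ws c S).length : ℝ) * E.coin s.drawn⌋₊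
          ((pool st n ws c S).length - 1)]? = some j → s'.word 0 ≠ 0 ∧ s'.point 0 = some (p j) := by
    intro s₃ hw hp hnil
    refine Runs.setWord ?_
    rw [eval_lit (by omega)]
    refine ⟨?_, hp, fun _ => by simp, fun j hj => by simp [hnil] at hj⟩
    simp
    omega
  rcases Nat.lt_or_ge l n with hlt' | hge
  swap
  · refine Runs.ite_neg (by rw [hcond, if_neg (by omega)]) (hfail _ q2'.wordsUsed ?_ ?_)
    · change s₂.pointsUsed ≤ _
      rw [q2'.pointsUsed]
      exact le_max_left _ _
    · exact pool_eq_nil fun l' hl' => hlt l' (by omega)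
  have hpool := pool_eq (st := st) (S := S) hlt' (hcl hlt') hlt
  set A := liveEntries st ws (S l) with hA
  have hlenA : (pool st n ws c S).length = A.length := by rw [hpool, List.length_map]
  have hlenS := hS l hlt'
  have hAS : A.length ≤ (S l).length := List.length_filter_le _ _
  have hmul : 2 * n * (S l).length ≤ 2 * n * N := Nat.mul_le_mul_left _ hlenS
  have hmul2 : N ≤ 2 * n * N := Nat.le_mul_of_pos_left _ (by omega)
  have hexp : 2 * n * (N + 2) = 2 * n * N + 2 * (2 * n) := by ring
  obtain ⟨hlen, hsg⟩ := hseg l hlt'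
  refine Runs.ite_pos (by rw [hcond, if_pos (by omega)]; exact one_ne_zero)
    (Runs.seq (Runs.setWord (Runs.seq (Runs.setWord ?_))))
  rw [eval_lit (by omega), eval_lit (by omega), eval_tick, eval_add (u := 8 + 2 * l) (v := 1)
    ((eval_var (by omega)).trans g8) (eval_lit (by omega)) (by omega)]
  set s₃ := State.tick (State.setWord _ 14 (8 + 2 * l + 1)) _ with hs₃
  have q3 : s.Quiet s₃ {8, 9, 14} := (((q2'.trans (State.quiet_tick _ _ {8})).trans
    (State.quiet_setWord _ (by omega) _)).trans (State.quiet_tick _ _ {8})).mono (by decide)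
  have e3 : ∀ a, a ≠ 8 → a ≠ 9 → a ≠ 14 → s₃.word a = s.word a := fun a h1 h2 h3 =>
    q3.words a (by simp [h1, h2, h3])
  have g14 : s₃.word 14 = 8 + 2 * l + 1 := by simp [hs₃]
  rw [eval_add (u := 8 + 2 * l + 1) (v := 2 * n * (S l).length) ((eval_var (by omega)).trans g14)
    ((eval_field hE (by omega) g14 (by omega) (by omega)).trans
      ((e3 _ (by omega) (by omega) (by omega)).trans hlen)) (by omega)]
  refine Runs.seq (Runs.setWord (Runs.seq ?_))
  rw [eval_lit (by omega), eval_lit (by omega)]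
  set s₄ := State.tick (State.setWord _ 15 0) _ with hs₄
  have q4 : s.Quiet s₄ {8, 9, 13, 14, 15} := ((((q3.trans
    (State.quiet_setWord _ (by omega) _)).trans (State.quiet_tick _ _ {8})).trans
    (State.quiet_setWord _ (by omega) _)).trans (State.quiet_tick _ _ {8})).mono (by decide)
  have e4 : ∀ a, (a < 8 ∨ 15 < a) → s₄.word a = s.word a := fun a h1 => q4.words a (by simp; omega)
  have v9 : s₄.word 9 = ws := by simpa [hs₄, hs₃] using g9
  have v13 : s₄.word 13 = 8 + 2 * l + 1 + 2 * n * (S l).length := by simp [hs₄]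
  have v14 : s₄.word 14 = 8 + 2 * l + 1 := by simpa [hs₄] using g14
  have hseg4 : ∀ s' : State d, s'.point = s.point → (∀ a, 32 ≤ a → s'.word a = s.word a) →
      Segment st p s' (2 * n) (8 + 2 * l + 1) (S l) := fun s' hp hw =>
    hsg.congr fun j _ => ⟨hw _ (by omega), hw _ (by omega), by rw [hp]⟩
  -- The first pass serves only to count the live entries; the second, with the random index,
  -- locates the chosen one.
  refine (scanProg_runs (X := 8 + 2 * n * (N + 2)) (x := 8 + 2 * l + 1) (r := 0) (l := S l) hE hX
    (by omega) (by omega) (by omega) (by omega) (by omega) ((e4 5 (by omega)).trans h5) v9 v13 v14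
    (by simp [hs₄]) (hseg4 s₄ q4.points fun a ha => e4 a (by omega))).mono ?_
  rintro s₅ ⟨q5, v16, -⟩
  have q5' : s.Quiet s₅ {8, 9, 10, 11, 13, 14, 15, 16} := (q4.trans q5).mono (by decide)
  have e5 : ∀ a, (a < 8 ∨ 16 < a) → s₅.word a = s.word a := fun a h1 =>
    q5'.words a (by simp; omega)
  have hev : (var 16 : Expr d).eval E s₅ = A.length := (eval_var (by omega)).trans v16
  by_cases hnil : A = []
  · refine Runs.ite_neg (by rw [hev, hnil]; rfl) (hfail _ q5'.wordsUsed ?_ ?_)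
    · change s₅.pointsUsed ≤ _
      rw [q5'.pointsUsed]
      exact le_max_left _ _
    · rw [hpool, hnil, List.map_nil]
  have hpos : 0 < A.length := List.length_pos_iff.2 hnil
  refine Runs.ite_pos (by rw [hev]; omega) (Runs.seq (Runs.random (Runs.seq ?_)))
  rw [eval_lit (by omega), eval_tick, hev,
    show (State.tick s₅ _).drawn = s.drawn from q5'.drawn]
  set r := min ⌊(A.length : ℝ) * E.coin s.drawn⌋₊ (A.length - 1) with hr
  have hrA : r < A.length := by omega
  set s₆ := State.tick (State.draw _) _ with hs₆
  have e6 : ∀ a, s₆.word a = if a = 15 then r else s₅.word a := fun a => by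
    simp [hs₆, State.draw]
  have p6 : s₆.point = s.point := q5'.points
  have u6 : s₆.wordsUsed = max s₅.wordsUsed 16 := by simp [hs₆, State.draw]
  have z6 : s₆.pointsUsed = s.pointsUsed := q5'.pointsUsed
  have u5 := q5'.wordsUsed
  have e6' : ∀ a, a ≠ 10 → a ≠ 11 → a ≠ 16 → a ≠ 15 → s₆.word a = s₄.word a :=
    fun a h1 h2 h3 h4 => by rw [e6, if_neg h4, q5.words a (by simp [h1, h2, h3])]
  refine (scanProg_runs (X := 8 + 2 * n * (N + 2)) (x := 8 + 2 * l + 1) (r := r) (l := S l)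
    (st := st) (p := p) hE hX (by omega) (by omega) (by omega) (by omega) (by omega)
    (by rw [e6, if_neg (by omega), e5 5 (by omega)]; exact h5)
    ((e6' 9 (by omega) (by omega) (by omega) (by omega)).trans v9)
    ((e6' 13 (by omega) (by omega) (by omega) (by omega)).trans v13)
    ((e6' 14 (by omega) (by omega) (by omega) (by omega)).trans v14) (by rw [e6, if_pos rfl])
    (hseg4 s₆ p6 fun a ha => by rw [e6, if_neg (by omega), e5 a (by omega)])).mono ?_
  rintro s₇ ⟨q7, -, v11⟩
  have u7 := q7.wordsUsed
  have z7 := q7.pointsUsed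
  refine Runs.seq (Runs.copyPoint (Runs.setWord ?_))
  rw [eval_lit (by omega), eval_lit (by omega), eval_var (by omega), q7.points]
  refine ⟨?_, ?_, fun h => ?_, fun j hj => ⟨?_, ?_⟩⟩
  · simp only [State.tick_wordsUsed, State.setWord_wordsUsed, State.setPoint_wordsUsed]
    omega
  · simp only [State.tick_pointsUsed, State.setWord_pointsUsed, State.setPoint_pointsUsed]
    omega
  · rw [hpool, List.map_eq_nil_iff] at h
    exact absurd h hnil
  · simp [eval_lit (show 1 < 2 ^ E.bits by omega)]
  · rw [hlenA, ← hr, hpool, List.getElem?_map, Option.map_eq_some_iff] at hj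
    obtain ⟨e, he, rfl⟩ := hj
    simpa using v11 e he

end

end SlidingSample

end

noncomputable section

namespace SlidingSample

variable {d : ℕ}

/-! ### The algorithm -/

/-- The sliding window algorithm. -/
def sampler (d : ℕ) : Algorithm d := ⟨updateProg d, queryProg d⟩

theorem refresh_length_le {near : ℕ → ℕ → Prop} {st : ℕ → ℕ} (cut i f : ℕ) (l : List (ℕ × ℕ)) :
    (refresh near st cut i f l).length ≤ l.length + 1 := by
  have h := List.length_filter_le (l := l)
    (fun e => @decide (cut ≤ st e.1 ∧ ¬ near i e.1) (Classical.propDecidable _))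
  rw [refresh, List.length_append]
  refine Nat.add_le_add ?_ ?_
  · unfold keepList
    convert h
  · split_ifs <;> simp

theorem groupList_length_le_index {near : ℕ → ℕ → Prop} {st : ℕ → ℕ} (C f : ℕ → ℕ) (k : ℕ) :
    (groupList near st C f k).length ≤ k := by
  induction k with
  | zero => simp [groupList]
  | succ k ih => exact (refresh_length_le _ _ _ _).trans (Nat.succ_le_succ ih)

theorem topList_length_le (I : Stream d) (mode : WindowModel) (K : ℕ) (H : ℕ → ℕ) (R k : ℕ) :
    (topList I mode K H R k).1.length ≤ k := by
  rw [topList, boundedList_fst]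
  exact groupList_length_le_index _ _ _

theorem sampleList_length_le (I : Stream d) (mode : WindowModel) (K : ℕ) (H : ℕ → ℕ) (R k : ℕ) :
    (sampleList I mode K H R k).length ≤ k := groupList_length_le_index _ _ _

theorem Reaches.unique {A : Algorithm d} {I : Stream d} {mode : WindowModel} {b : ℕ}
    {ω : Randomness b} {k : ℕ} {s s' : State d} (h : Reaches A I mode b ω k s)
    (h' : Reaches A I mode b ω k s') : s = s' := by
  induction k generalizing s s' with
  | zero => exact h.trans h'.symm
  | succ k ih =>
    obtain ⟨s₀, h0, hk, he⟩ := h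
    obtain ⟨s₁, h1, hk', he'⟩ := h'
    rw [← ih h0 h1] at he'
    exact he.unique he'

theorem Reaches.le {A : Algorithm d} {I : Stream d} {mode : WindowModel} {b : ℕ}
    {ω : Randomness b} {k : ℕ} {s : State d} (h : Reaches A I mode b ω k s) : k ≤ I.m := by
  cases k with
  | zero => exact Nat.zero_le _
  | succ k =>
    obtain ⟨_, _, hk, _⟩ := h
    exact hk

theorem Answers.unique {A : Algorithm d} {I : Stream d} {mode : WindowModel} {b : ℕ}
    {ω : Randomness b} {t : ℕ} {s s' : State d} (h : Answers A I mode b ω t s)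
    (h' : Answers A I mode b ω t s') : s = s' := by
  obtain ⟨s₀, h0, he⟩ := h
  obtain ⟨s₁, h1, he'⟩ := h'
  rw [← h0.unique h1] at he'
  exact he.unique he'

namespace Stream

/-- The points among which the query at time `t` chooses. -/
def queryPool (I : Stream d) (mode : WindowModel) (H : ℕ → ℕ) (t : ℕ) : List ℕ :=
  pool (I.stampSeq mode) I.levels (I.windowStart mode t)
    (fun l => (topList I mode I.bound H (2 ^ l) (I.received t)).2)
    (fun l => sampleList I mode I.bound H (2 ^ l) (I.received t))

/-- The lists have at most `N` entries. -/
def ListsAtMost (I : Stream d) (mode : WindowModel) (H : ℕ → ℕ) (N : ℕ) : Prop :=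
  ∀ l < I.levels, ∀ k ≤ I.m, (topList I mode I.bound H (2 ^ l) k).1.length ≤ N ∧
    (sampleList I mode I.bound H (2 ^ l) k).length ≤ N

/-- The number of cells that are used with lists of length `N`. -/
def cells (I : Stream d) (N : ℕ) : ℕ := 8 + 2 * I.levels * (N + 2)

theorem listsAtMost_m (I : Stream d) (mode : WindowModel) (H : ℕ → ℕ) :
    I.ListsAtMost mode H I.m := fun _ _ _ hk =>
  ⟨(topList_length_le _ _ _ _ _ _).trans hk, (sampleList_length_le _ _ _ _ _ _).trans hk⟩

theorem clock_le (I : Stream d) (mode : WindowModel) {t t' : ℕ} (h : t ≤ t') :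
    I.clock mode t ≤ I.clock mode t' := by
  cases mode with
  | timeBased => exact h
  | sequenceBased =>
    change I.received t ≤ I.received t'
    refine Finset.card_le_card fun i hi => ?_
    rw [Finset.mem_filter] at hi ⊢
    exact ⟨hi.1, hi.2.trans h⟩

end Stream

variable {I : Stream d} {mode : WindowModel} {b : ℕ}

/-- The parameter `N` is any bound on the lengths of the lists. With `N = m` it holds for all random
choices and yields halting; with the logarithmic bound it yields space and time. The time bound
holds for each single point, not merely on average. -/
theorem reaches_sampler (hd : 1 ≤ d) (hI : I.Admissible) (hW : I.WordSize mode b)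
    (ω : Randomness b) {N : ℕ} (hN : N ≤ I.m) (hlist : I.ListsAtMost mode (applyHash ω.1) N)
    (k : ℕ) (hk : k ≤ I.m) :
    ∃ s, Reaches (sampler d) I mode b ω k s ∧
      (∀ a, 1 ≤ a → a < 5 → s.word a = (initial I b).word a) ∧
      s.word 5 = (if k = 0 then 0 else 2 * I.levels) ∧
      MemoryHolds I mode I.bound (applyHash ω.1) (2 * I.levels) I.levels k s ∧
      s.wordsUsed ≤ 4 * I.cells N ∧ s.pointsUsed ≤ I.cells N ∧ s.steps ≤ k * updateCost I N := by
  have hcells : 8 ≤ I.cells N := by unfold Stream.cells; omega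
  induction k with
  | zero =>
    refine ⟨initial I b, rfl, fun _ _ _ => rfl, rfl, fun l hl => ?_, ?_, ?_, ?_⟩
    · have hw : ∀ a, 5 ≤ a → (initial I b).word a = 0 := fun a ha => by
        simp only [initial]
        rw [if_neg (by omega), if_neg (by omega), if_neg (by omega), if_neg (by omega)]
      exact ⟨⟨hw _ (by omega), trivial⟩, hw _ (by omega), hw _ (by omega), trivial⟩
    · change 5 ≤ _; omega
    · change 1 ≤ _; omega
    · simp [initial]
  | succ k ih =>
    obtain ⟨s, hs, h1, -, hM, hw, hp, hst⟩ := ih (by omega)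
    set s₀ := (s.setWord 0 (I.stamp mode ⟨k, hk⟩)).setPoint 0 (some (I.p ⟨k, hk⟩)) with hs₀
    have e : ∀ a, s₀.word a = if a = 0 then I.stamp mode ⟨k, hk⟩ else s.word a := fun a => by
      simp [hs₀]
    have h1' : ∀ a, 1 ≤ a → a < 5 → s₀.word a = (initial I b).word a := fun a ha ha' => by
      rw [e, if_neg (by omega), h1 a ha ha']
    have hr : Ready I (env I b ω 0) s₀ k :=
      ⟨hI, hd, rfl, h1' 3 (by omega) (by omega), by
        rw [hs₀, State.setPoint_point, if_pos rfl, Stream.pt_of_lt hk], hW.keys⟩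
    obtain ⟨s', hex, hM', hkeep, h5, hwithin⟩ := updateProg_runs (E := env I b ω 0) (s := s₀)
      (mode := mode) (k := k) hW hN (fun l hl => (hlist l hl k (by omega)).1)
      (fun l hl => (hlist l hl k (by omega)).2) hk hr
      (by rw [e, if_pos rfl, Stream.stampSeq, dif_pos (show k < I.m from hk)]) (h1' 1 (by omega) (by omega))
      (h1' 2 (by omega) (by omega))
      (fun l hl => (hM l hl).congr (by omega) (fun a ha _ => by rw [e, if_neg (by omega)])
        (fun y hy _ => by rw [hs₀, State.setPoint_point, if_neg (by omega)]; rfl))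
    have w1 := hwithin.words
    have w2 := hwithin.points
    have w3 := hwithin.steps
    have u1 : s₀.wordsUsed = max s.wordsUsed 1 := rfl
    have u2 : s₀.pointsUsed = max s.pointsUsed 1 := rfl
    have u3 : s₀.steps = s.steps := rfl
    have hY : 8 + 2 * I.levels * (N + 2) = I.cells N := rfl
    refine ⟨s', ⟨s, hs, hk, hex⟩, fun a ha ha' => (hkeep a ha ha').trans (h1' a ha ha'), ?_, hM',
      by omega, by omega, ?_⟩
    · rw [h5, if_neg (by omega)]
    · rw [Nat.succ_mul]; omega

theorem answers_sampler (hd : 1 ≤ d) (hI : I.Admissible) (hW : I.WordSize mode b)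
    (ω : Randomness b) {N : ℕ} (hN : N ≤ I.m) (hlist : I.ListsAtMost mode (applyHash ω.1) N)
    {t : ℕ} (ht : t ≤ I.T) :
    ∃ s, Answers (sampler d) I mode b ω t s ∧ s.wordsUsed ≤ 4 * I.cells N ∧
      s.pointsUsed ≤ I.cells N ∧
      (I.queryPool mode (applyHash ω.1) t = [] → s.word 0 = 0) ∧
      ∀ j, (I.queryPool mode (applyHash ω.1) t)[min
          ⌊((I.queryPool mode (applyHash ω.1) t).length : ℝ) * (ω.2 (t + 1, 0) : ℝ)⌋₊
          ((I.queryPool mode (applyHash ω.1) t).length - 1)]? = some j →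
        s.word 0 ≠ 0 ∧ s.point 0 = some (I.pt j) := by
  have hcells : 8 ≤ I.cells N := by unfold Stream.cells; omega
  obtain ⟨s, hs, h1, h5, hM, hw, hp, -⟩ := reaches_sampler hd hI hW ω hN hlist (I.received t)
    (Stream.received_le t)
  set s₀ : State d := { s.setWord 0 (I.clock mode t) with drawn := 0 } with hs₀
  have e : ∀ a, s₀.word a = if a = 0 then I.clock mode t else s.word a := fun a => by
    simp only [hs₀, State.setWord_word]
  set c : ℕ → ℕ := fun l => (topList I mode I.bound (applyHash ω.1) (2 ^ l) (I.received t)).2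
  set S : ℕ → List (ℕ × ℕ) := fun l =>
    sampleList I mode I.bound (applyHash ω.1) (2 ^ l) (I.received t)
  have hbits : ∀ n ≤ I.levels, 4 * (8 + 2 * n * (N + 2)) + 4 ≤ 2 ^ b := by
    intro n hn
    have h : 2 * n * (N + 2) ≤ 2 * I.levels * (I.m + 2) :=
      Nat.mul_le_mul (by omega) (by omega)
    have := hW.cells
    omega
  -- Before the first point, word `5` is still `0` and the query sees no levels at all. The pool
  -- computed with the true number of levels is then empty too.
  have hpoolz : I.received t = 0 → pool (I.stampSeq mode) 0 (I.windowStart mode t) c S =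
      I.queryPool mode (applyHash ω.1) t := by
    intro h0
    rw [pool_eq_nil fun l hl => absurd hl (by omega)]
    by_cases hex : ∃ l, l < I.levels ∧ c l ≤ I.windowStart mode t
    · classical
      obtain ⟨h2, h3⟩ := Nat.find_spec hex
      have := pool_eq (st := I.stampSeq mode) (S := S) h2 h3 fun l' hl' =>
        not_le.1 fun h => Nat.find_min hex hl' ⟨hl'.trans h2, h⟩
      refine Eq.trans ?_ this.symm
      have hS0 : S (Nat.find hex) = [] := by
        change sampleList I mode I.bound (applyHash ω.1) _ (I.received t) = []
        rw [h0]; rfl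
      rw [hS0]; rfl
    · exact (pool_eq_nil fun l hl => not_le.1 fun h => hex ⟨l, hl, h⟩).symm
  have key : ∀ n ≤ I.levels, s.word 5 = 2 * n → (∀ l < n, n = I.levels) →
      Runs (env I b ω (t + 1)) (queryProg d) s₀ fun s' => s'.wordsUsed ≤ max s₀.wordsUsed 32 ∧
        s'.pointsUsed ≤ max s₀.pointsUsed 1 ∧
        (pool (I.stampSeq mode) n (I.windowStart mode t) c S = [] → s'.word 0 = 0) ∧
        ∀ j, (pool (I.stampSeq mode) n (I.windowStart mode t) c S)[min
            ⌊((pool (I.stampSeq mode) n (I.windowStart mode t) c S).length : ℝ) *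
              (ω.2 (t + 1, 0) : ℝ)⌋₊
            ((pool (I.stampSeq mode) n (I.windowStart mode t) c S).length - 1)]? = some j →
          s'.word 0 ≠ 0 ∧ s'.point 0 = some (I.pt j) := by
    intro n hn hn5 hn'
    refine queryProg_runs (E := env I b ω (t + 1)) (N := N) hW.small (hbits n hn)
      (lt_of_le_of_lt (Nat.succ_le_succ (I.clock_le mode ht)) hW.clock)
      (fun l hl => (hlist l (by omega) _ (Stream.received_le t)).2)
      (by rw [e, if_pos rfl]) (by rw [e, if_neg (by omega), h1 2 (by omega) (by omega)]; rfl)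
      (by rw [e, if_neg (by omega)]; exact hn5)
      (fun l hl => by rw [e, if_neg (by omega)]; exact (hM l (by omega)).cut) fun l hl => ?_
    obtain rfl := hn' l hl
    exact (hM l hl).snd.congr (by omega) (fun a ha _ => by rw [e, if_neg (by omega)])
      (fun _ _ _ => rfl)
  obtain ⟨n, hn, hn5, hn', hpool⟩ : ∃ n ≤ I.levels, s.word 5 = 2 * n ∧ (∀ l < n, n = I.levels) ∧
      pool (I.stampSeq mode) n (I.windowStart mode t) c S =
        I.queryPool mode (applyHash ω.1) t := by
    by_cases h0 : I.received t = 0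
    · exact ⟨0, by omega, by rw [h5, if_pos h0], fun l hl => absurd hl (by omega), hpoolz h0⟩
    · exact ⟨I.levels, le_rfl, by rw [h5, if_neg h0], fun _ _ => rfl, rfl⟩
  obtain ⟨s', hex, k1, k2, k3, k4⟩ := key n hn hn5 hn'
  rw [hpool] at k3 k4
  have u1 : s₀.wordsUsed = max s.wordsUsed 1 := rfl
  have u2 : s₀.pointsUsed = s.pointsUsed := rfl
  exact ⟨s', ⟨s, hs, hex⟩, by omega, by omega, k3, k4⟩

theorem sampler_halts (hd : 1 ≤ d) (hI : I.Admissible) (hW : I.WordSize mode b)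
    (ω : Randomness b) : Halts (sampler d) I mode b ω := by
  refine ⟨fun k hk => ?_, fun t ht => ?_⟩
  · obtain ⟨s, hs, -⟩ := reaches_sampler hd hI hW ω le_rfl (I.listsAtMost_m mode _) k hk
    exact ⟨s, hs⟩
  · obtain ⟨s, hs, -⟩ := answers_sampler hd hI hW ω le_rfl (I.listsAtMost_m mode _) ht
    exact ⟨s, hs⟩

/-- From here on the machine is replaced by a choice from `queryPool`, with the first random number
of the query as the only coin. -/
theorem outputs_sampler_iff (hd : 1 ≤ d) (hI : I.Admissible) (hW : I.WordSize mode b)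
    (ω : Randomness b) {t : ℕ} (ht : t ≤ I.T) (u : Pt d) :
    Outputs (sampler d) I mode b ω t u ↔
      ∃ j, (I.queryPool mode (applyHash ω.1) t)[min
          ⌊((I.queryPool mode (applyHash ω.1) t).length : ℝ) * (ω.2 (t + 1, 0) : ℝ)⌋₊
          ((I.queryPool mode (applyHash ω.1) t).length - 1)]? = some j ∧ I.pt j = u := by
  obtain ⟨s, hs, -, -, h1, h2⟩ := answers_sampler hd hI hW ω le_rfl (I.listsAtMost_m mode _) ht
  constructor
  · rintro ⟨s', hs', h0, hu⟩
    rw [← hs.unique hs'] at h0 hu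
    have hne : I.queryPool mode (applyHash ω.1) t ≠ [] := fun h => h0 (h1 h)
    have hpos := List.length_pos_iff.2 hne
    have hlt : min ⌊((I.queryPool mode (applyHash ω.1) t).length : ℝ) * (ω.2 (t + 1, 0) : ℝ)⌋₊
          ((I.queryPool mode (applyHash ω.1) t).length - 1) <
        (I.queryPool mode (applyHash ω.1) t).length := by omega
    have hj := List.getElem?_eq_getElem hlt
    refine ⟨_, hj, ?_⟩
    have := (h2 _ hj).2
    rw [hu] at this
    exact (Option.some.inj this).symm
  · rintro ⟨j, hj, rfl⟩
    exact ⟨s, hs, h2 j hj⟩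

theorem sampler_space (hd : 1 ≤ d) (hI : I.Admissible) (hW : I.WordSize mode b)
    (ω : Randomness b) {N : ℕ} (hN : N ≤ I.m) (hlist : I.ListsAtMost mode (applyHash ω.1) N)
    {B : ℝ} (hB : ((4 + d) * I.cells N : ℕ) ≤ B) : SpaceAtMost (sampler d) I mode b ω B := by
  have h : ∀ s : State d, s.wordsUsed ≤ 4 * I.cells N → s.pointsUsed ≤ I.cells N →
      (s.space : ℝ) ≤ B := by
    intro s h1 h2
    refine le_trans (Nat.cast_le.2 ?_) hB
    have := Nat.mul_le_mul_left d h2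
    unfold State.space
    rw [add_mul]
    omega
  refine ⟨fun k s hs => ?_, fun t ht s hs => ?_⟩
  · obtain ⟨s', hs', -, -, -, h1, h2, -⟩ := reaches_sampler hd hI hW ω hN hlist k hs.le
    rw [hs.unique hs']
    exact h s' h1 h2
  · obtain ⟨s', hs', h1, h2, -⟩ := answers_sampler hd hI hW ω hN hlist ht
    rw [hs.unique hs']
    exact h s' h1 h2

theorem sampler_time (hd : 1 ≤ d) (hI : I.Admissible) (hW : I.WordSize mode b)
    (ω : Randomness b) {N : ℕ} (hN : N ≤ I.m) (hlist : I.ListsAtMost mode (applyHash ω.1) N)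
    {B : ℝ} (hB : (updateCost I N : ℝ) ≤ B) : AmortizedTimeAtMost (sampler d) I mode b ω B := by
  intro k s hs
  obtain ⟨s', hs', -, -, -, -, -, h⟩ := reaches_sampler hd hI hW ω hN hlist k hs.le
  rw [hs.unique hs']
  calc (s'.steps : ℝ) ≤ (k * updateCost I N : ℕ) := Nat.cast_le.2 h
    _ = k * (updateCost I N : ℝ) := by push_cast; ring
    _ ≤ k * B := mul_le_mul_of_nonneg_left hB (Nat.cast_nonneg _)

end SlidingSample

end

/-! ### Analysis: an output exists with high probability, and is exactly uniform. -/

noncomputable section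

namespace SlidingSample

variable {d : ℕ}

/-! ### The points among which a query chooses -/

namespace Stream

variable {I : Stream d} {mode : WindowModel} {H : ℕ → ℕ}

/-- The cut of level `l` after `k` points. -/
def levelCut (I : Stream d) (mode : WindowModel) (H : ℕ → ℕ) (l k : ℕ) : ℕ :=
  (topList I mode I.bound H (2 ^ l) k).2

theorem Admissible.listInv_sampleList (hI : I.Admissible) (mode : WindowModel) (K : ℕ) (H : ℕ → ℕ)
    (R k : ℕ) : ListInv I.Near (I.stampSeq mode) (I.levelCuts mode K H R) (I.Accepted H 1 R)
      (I.Touched H 1 R) k (sampleList I mode K H R k) :=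
  listInv_groupList hI.near_equivalence (cuts_mono (hI.stampSeq_strictMono mode))
    (cuts_le (hI.stampSeq_strictMono mode)) (fun i j => hI.touched_of_accepted H 1 R i j) k

/-- The points chosen from at level `l` are the last points of their groups in the window whose
representative is sampled. -/
theorem Admissible.mem_liveEntries (hI : I.Admissible) {l k a ws : ℕ}
    (ha : ∀ j < k, ws ≤ I.stampSeq mode j ↔ a ≤ j) (hcut : I.levelCut mode H l k ≤ ws) (j : ℕ) :
    j ∈ (liveEntries (I.stampSeq mode) ws (sampleList I mode I.bound H (2 ^ l) k)).map Prod.fst ↔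
      j ∈ lasts I.Near a k ∧ I.Accepted H 1 (2 ^ l) (I.levelRep mode I.bound H (2 ^ l) j) := by
  classical
  have inv := hI.listInv_sampleList mode I.bound H (2 ^ l) k
  have hn := hI.near_equivalence
  rw [List.mem_map, mem_lasts]
  constructor
  · rintro ⟨e, he, rfl⟩
    rw [liveEntries, List.mem_filter] at he
    obtain ⟨he, hw⟩ := he
    simp only [decide_eq_true_eq] at hw
    have hl := inv.isLast e he
    refine ⟨⟨(ha _ hl.1).1 hw.1, hl⟩, ?_⟩
    have hf := inv.flag e he
    by_contra hc
    rw [levelRep] at hc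
    rw [if_neg hc] at hf
    exact hw.2 hf
  · rintro ⟨⟨haj, hl⟩, hacc⟩
    have hws := (ha j hl.1).2 haj
    refine ⟨(j, 1), ?_, rfl⟩
    rw [liveEntries, List.mem_filter]
    refine ⟨(inv.mem_one_iff hn (fun i j => hI.touched_of_accepted H 1 _ i j) hl ?_).2 hacc, ?_⟩
    · rintro c rfl
      exact le_trans hcut hws
    · simpa using hws

theorem Admissible.nodup_liveEntries (hI : I.Admissible) (l k ws : ℕ) :
    ((liveEntries (I.stampSeq mode) ws (sampleList I mode I.bound H (2 ^ l) k)).map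
      Prod.fst).Nodup := by
  have inv := hI.listInv_sampleList mode I.bound H (2 ^ l) k
  rw [List.Nodup, List.pairwise_map]
  exact (inv.sorted.sublist List.filter_sublist).imp fun h => h.ne

theorem queryPool_eq {t l : ℕ} (hl : l < I.levels)
    (hc : I.levelCut mode H l (I.received t) ≤ I.windowStart mode t)
    (hlt : ∀ l' < l, I.windowStart mode t < I.levelCut mode H l' (I.received t)) :
    I.queryPool mode H t = (liveEntries (I.stampSeq mode) (I.windowStart mode t)
      (sampleList I mode I.bound H (2 ^ l) (I.received t))).map Prod.fst :=
  pool_eq hl hc hlt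

theorem queryPool_eq_nil {t : ℕ}
    (h : ∀ l < I.levels, I.windowStart mode t < I.levelCut mode H l (I.received t)) :
    I.queryPool mode H t = [] := pool_eq_nil h

open Classical in
/-- The samples are neither too small nor too large. -/
structure GoodSample (I : Stream d) (mode : WindowModel) (H : ℕ → ℕ) (l a k : ℕ) : Prop where
  many : 6 * I.bound * 2 ^ l ≤ (lasts I.Near a k).card →
    I.bound + 2 ≤ ((lasts I.Near a k).filter (I.Accepted H 0 (2 ^ l))).card
  few : (lasts I.Near a k).card ≤ 16 * Nat.clog 2 I.m * 2 ^ l →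
    ((lasts I.Near a k).filter (I.GroupTouched H 0 (2 ^ l))).card < I.bound
  size : (lasts I.Near a k).card ≤ 6 * I.bound * 2 ^ l →
    ((lasts I.Near a k).filter (I.GroupTouched H 1 (2 ^ l))).card <
      13 * ((4 * d + 1) ^ d) ^ 2 * I.bound
  some : 8 * Nat.clog 2 I.m * 2 ^ l ≤ (lasts I.Near a k).card →
    ∃ j ∈ lasts I.Near a k, I.Accepted H 1 (2 ^ l) (I.levelRep mode I.bound H (2 ^ l) j)

theorem Admissible.one_le_clog (hI : I.Admissible) : 1 ≤ Nat.clog 2 I.m :=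
  Nat.clog_pos one_lt_two hI.two_le_m

/-- The first list is bounded by construction. For the second, `many` limits the number of groups
since the cut, and `size` then limits the touched ones among them. -/
theorem Admissible.listsAtMost (hI : I.Admissible)
    (h : ∀ l < I.levels, ∀ k ≤ I.m, ∀ a ≤ k, I.GoodSample mode H l a k) :
    I.ListsAtMost mode H (min I.m (13 * ((4 * d + 1) ^ d) ^ 2 * I.bound)) := by
  classical
  intro l hl k hk
  have hn := hI.near_equivalence
  have hst := hI.stampSeq_strictMono mode
  have hb : 1 ≤ I.bound := by
    have := hI.one_le_clog
    unfold bound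
    exact Nat.one_le_iff_ne_zero.2 (by positivity)
  have hc : 1 ≤ ((4 * d + 1) ^ d) ^ 2 := Nat.one_le_iff_ne_zero.2 (by positivity)
  obtain ⟨h1, h2⟩ := I.listsAtMost_m mode H l hl k hk
  refine ⟨le_min h1 ((boundedList_length k).trans ?_), le_min h2 ?_⟩
  · have : I.bound ≤ ((4 * d + 1) ^ d) ^ 2 * I.bound := Nat.le_mul_of_pos_left _ hc
    rw [mul_assoc]
    omega
  · refine groupList_length_le hn hst (A := 6 * I.bound * 2 ^ l)
      (fun i j => hI.touched_of_accepted H 0 _ i j) (fun i j => hI.touched_of_accepted H 1 _ i j)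
      (fun a ha hA => ?_) (fun a ha hA => ?_)
    · exact (h l hl k hk a ha).many hA
    · exact (h l hl k hk a ha).size hA

/-- A level rejected by the query has its cut inside the window, which by `few` certifies many
groups. The top level cannot be rejected for lack of groups, and the rejection of level `l - 1`
supplies the groups that `some` needs at level `l`. -/
theorem Admissible.queryPool_spec (hI : I.Admissible)
    (h : ∀ l < I.levels, ∀ k ≤ I.m, ∀ a ≤ k, I.GoodSample mode H l a k) {t : ℕ}
    (hw : (I.window mode t).Nonempty) : I.queryPool mode H t ≠ [] ∧
      ∀ j ∈ I.queryPool mode H t, I.pt j ∈ I.window mode t := by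
  classical
  have hn := hI.near_equivalence
  have hst := hI.stampSeq_strictMono mode
  have hlam := hI.one_le_clog
  set k := I.received t with hk
  have hkm : k ≤ I.m := received_le t
  set ws := I.windowStart mode t with hws
  obtain ⟨a, hak, ha⟩ := exists_index_threshold hst ws k
  have hcard : (lasts I.Near a k).card ≤ min I.m I.w := hI.card_lasts_le mode t ha
  have hne : (lasts I.Near a k).Nonempty := by
    obtain ⟨x, hx⟩ := hw
    obtain ⟨i, hi, -, hi2⟩ := (hI.mem_window_iff mode t x).1 hx
    obtain ⟨j, hj, -, hij⟩ := exists_isLast hn hi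
    exact ⟨j, mem_lasts.2 ⟨((ha i hi).1 hi2).trans hij, hj⟩⟩
  have hcut : ∀ l < I.levels, ws < I.levelCut mode H l k →
      16 * Nat.clog 2 I.m * 2 ^ l < (lasts I.Near a k).card := fun l hl hlt =>
    card_lasts_of_cut hn hst (fun i j => hI.touched_of_accepted H 0 _ i j) ha
      (fun hle => (h l hl k hkm a hak).few hle) hlt
  have hex : ∃ l, l < I.levels ∧ I.levelCut mode H l k ≤ ws := by
    by_contra hcon
    push Not at hcon
    -- At the top level the inverse rate is at least `min m w`, which bounds the number of groups in
    -- the window.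
    have hL : Nat.clog 2 (min I.m I.w) < I.levels := Nat.lt_succ_self _
    have h1 := hcut _ hL (hcon _ hL)
    have h2 := Nat.le_pow_clog one_lt_two (min I.m I.w)
    have h3 : 2 ^ Nat.clog 2 (min I.m I.w) ≤
        16 * Nat.clog 2 I.m * 2 ^ Nat.clog 2 (min I.m I.w) :=
      Nat.le_mul_of_pos_left _ (by omega)
    omega
  obtain ⟨hl, hc⟩ := Nat.find_spec hex
  have hlt : ∀ l' < Nat.find hex, ws < I.levelCut mode H l' k := fun l' hl' =>
    not_le.1 fun hle => Nat.find_min hex hl' ⟨hl'.trans hl, hle⟩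
  set l := Nat.find hex
  have hpool := queryPool_eq hl hc hlt
  have hmem := hI.mem_liveEntries ha hc
  rw [hpool]
  refine ⟨fun hnil => ?_, fun j hj => ?_⟩
  · rw [hnil] at hmem
    simp only [List.not_mem_nil, false_iff, not_and] at hmem
    obtain ⟨j, hj, hacc⟩ : ∃ j ∈ lasts I.Near a k,
        I.Accepted H 1 (2 ^ l) (I.levelRep mode I.bound H (2 ^ l) j) := by
      -- At level `0` the rate is `1` and every cell is sampled, so a nonempty window suffices.
      rcases Nat.eq_zero_or_pos l with h0 | hpos
      · obtain ⟨j, hj⟩ := hne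
        refine ⟨j, hj, ?_⟩
        rw [h0]
        exact one_dvd _
      · refine (h l hl k hkm a hak).some ?_
        -- Rejection of level `l - 1` gives more than `16 λ 2 ^ (l - 1) = 8 λ 2 ^ l` groups, with `λ
        -- = ⌈log₂ m⌉`; this is the threshold in `some`.
        have h1 := hcut (l - 1) (by omega) (hlt _ (by omega))
        have h2 : 2 ^ l = 2 ^ (l - 1) * 2 := by rw [← pow_succ]; congr 1; omega
        rw [h2]
        refine le_trans (le_of_eq ?_) h1.le
        ring
    exact hmem j hj hacc
  · have hj' := ((hmem j).1 hj).1
    rw [mem_lasts] at hj'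
    exact (hI.mem_window_iff mode t _).2 ⟨j, hj'.2.1, rfl, (ha j hj'.2.1).2 hj'.1⟩

end Stream

theorem sampler_alwaysOutputs {I : Stream d} {mode : WindowModel} {b : ℕ} (hd : 1 ≤ d)
    (hI : I.Admissible) (hW : I.WordSize mode b) (ω : Randomness b)
    (h : ∀ l < I.levels, ∀ k ≤ I.m, ∀ a ≤ k, I.GoodSample mode (applyHash ω.1) l a k) :
    AlwaysOutputs (sampler d) I mode b ω := by
  intro t ht hw
  obtain ⟨hne, hmem⟩ := hI.queryPool_spec h hw
  have hpos := List.length_pos_iff.2 hne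
  have hlt : min ⌊((I.queryPool mode (applyHash ω.1) t).length : ℝ) * (ω.2 (t + 1, 0) : ℝ)⌋₊
        ((I.queryPool mode (applyHash ω.1) t).length - 1) <
      (I.queryPool mode (applyHash ω.1) t).length := by omega
  exact ⟨_, hmem _ (List.getElem_mem hlt), (outputs_sampler_iff hd hI hW ω ht _).2
    ⟨_, List.getElem?_eq_getElem hlt, rfl⟩⟩

end SlidingSample

end

noncomputable section

namespace SlidingSample

variable {d : ℕ}

/-! ### The samples are good with high probability -/

theorem exp_neg_le_half_pow {n : ℕ} {x : ℝ} (h : (n : ℝ) ≤ x) : Real.exp (-x) ≤ (1 / 2) ^ n := by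
  have h2 : (2 : ℝ) ^ n ≤ Real.exp n := by
    rw [← Real.exp_one_pow]
    exact pow_le_pow_left₀ (by norm_num) (by linarith [Real.exp_one_gt_d9]) n
  rw [Real.exp_neg, one_div, inv_pow]
  exact inv_anti₀ (by positivity) (h2.trans (Real.exp_le_exp.2 h))

theorem half_pow_mul_exp_le {T n r : ℕ} {x : ℝ} (h : x ≤ n) (hT : 2 * n + r ≤ T) :
    (1 / 2 : ℝ) ^ T * Real.exp x ≤ (1 / 2) ^ r := by
  have h2 : Real.exp x ≤ (2 ^ 2) ^ n := by
    refine (Real.exp_le_exp.2 h).trans ?_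
    rw [← Real.exp_one_pow]
    exact pow_le_pow_left₀ (Real.exp_pos _).le (by linarith [Real.exp_one_lt_d9]) n
  calc (1 / 2 : ℝ) ^ T * Real.exp x ≤ (1 / 2) ^ (2 * n + r) * (2 ^ 2) ^ n :=
        mul_le_mul (pow_le_pow_of_le_one (by norm_num) (by norm_num) hT) h2 (Real.exp_pos _).le
          (by positivity)
    _ = (1 / 2) ^ r := by
        rw [pow_add, ← pow_mul, mul_right_comm, ← mul_pow]
        norm_num

namespace Stream

variable {I : Stream d} {mode : WindowModel} {b : ℕ}

-- One tail bound for each of the four ways to fail. The constants are such that each has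
-- probability at most `2 ^ (-8 λ)`, where `λ = ⌈log₂ m⌉`.
open Classical in
theorem Admissible.card_not_goodSample (hI : I.Admissible) (hd : 1 ≤ d)
    (hb : 2 * I.base ^ d ≤ 2 ^ b) (hbpos : 0 < b) {l : ℕ} (hl : l ≤ b) (a k : ℕ) :
    ((Finset.univ.filter fun h : Fin (2 ^ b) → Fin (2 ^ b) =>
      ¬ I.GoodSample mode (applyHash h) l a k).card : ℝ) ≤
      4 * (1 / 2) ^ (8 * Nat.clog 2 I.m) * Fintype.card (Fin (2 ^ b) → Fin (2 ^ b)) := by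
  set lam := Nat.clog 2 I.m with hlam
  set c := (4 * d + 1) ^ d with hc
  set n := (lasts I.Near a k).card with hn
  set tot : ℝ := ((Fintype.card (Fin (2 ^ b) → Fin (2 ^ b)) : ℕ) : ℝ) with htot
  have hlam1 : 1 ≤ lam := hI.one_le_clog
  have hc1 : 1 ≤ c := Nat.one_le_iff_ne_zero.2 (by positivity)
  have hK : I.bound = 64 * c ^ 2 * lam := rfl
  have hcc : c ≤ c ^ 2 := Nat.le_self_pow two_ne_zero c
  have hK8 : 64 * lam ≤ I.bound := by
    rw [hK, mul_right_comm]
    exact Nat.le_mul_of_pos_right _ (by omega)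
  have hR : (0 : ℝ) < ((2 ^ l : ℕ) : ℝ) := by positivity
  set F₁ := Finset.univ.filter fun h : Fin (2 ^ b) → Fin (2 ^ b) =>
    6 * I.bound * 2 ^ l ≤ n ∧
      ((lasts I.Near a k).filter (I.Accepted (applyHash h) 0 (2 ^ l))).card ≤ I.bound + 1 with hF₁
  set F₂ := Finset.univ.filter fun h : Fin (2 ^ b) → Fin (2 ^ b) => n ≤ 16 * lam * 2 ^ l ∧
    c * (64 * c * lam) ≤ ((lasts I.Near a k).filter (I.GroupTouched (applyHash h) 0 (2 ^ l))).card
    with hF₂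
  set F₃ := Finset.univ.filter fun h : Fin (2 ^ b) → Fin (2 ^ b) => n ≤ 6 * I.bound * 2 ^ l ∧
    c * (13 * c * I.bound) ≤
      ((lasts I.Near a k).filter (I.GroupTouched (applyHash h) 1 (2 ^ l))).card with hF₃
  set F₄ := Finset.univ.filter fun h : Fin (2 ^ b) → Fin (2 ^ b) => 8 * lam * 2 ^ l ≤ n ∧
    ∀ j ∈ lasts I.Near a k, ¬ I.Accepted (applyHash h) 1 (2 ^ l)
      (I.levelRep mode I.bound (applyHash h) (2 ^ l) j) with hF₄
  have hsub : (Finset.univ.filter fun h : Fin (2 ^ b) → Fin (2 ^ b) =>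
      ¬ I.GoodSample mode (applyHash h) l a k) ⊆ F₁ ∪ F₂ ∪ F₃ ∪ F₄ := by
    intro h hh
    have hh' := (Finset.mem_filter.1 hh).2
    by_contra hcon
    simp only [Finset.mem_union, hF₁, hF₂, hF₃, hF₄, Finset.mem_filter, Finset.mem_univ, true_and,
      not_or, not_and] at hcon
    obtain ⟨⟨⟨h1, h2⟩, h3⟩, h4⟩ := hcon
    refine hh' ⟨fun h => ?_, fun h => ?_, fun h => ?_, fun h => ?_⟩
    · have := h1 h
      omega
    · have h5 := h2 h
      have h6 : c * (64 * c * lam) = I.bound := by rw [hK]; ring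
      omega
    · have h5 := h3 h
      have h6 : c * (13 * c * I.bound) = 13 * c ^ 2 * I.bound := by ring
      rw [h6] at h5
      exact not_le.1 h5
    · have h5 := h4 h
      push Not at h5
      exact h5
  -- The condition `P` on the number of groups does not depend on the hash function. Where it fails
  -- the bad set is empty; where it holds it may be used in the exponent.
  have hle : ∀ (P : Prop) (F G : Finset (Fin (2 ^ b) → Fin (2 ^ b))) (x : ℝ), (∀ h ∈ F, P) →
      F ⊆ G → (G.card : ℝ) ≤ x * tot → (P → x ≤ (1 / 2) ^ (8 * lam)) →
      (F.card : ℝ) ≤ (1 / 2) ^ (8 * lam) * tot := by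
    intro P F G x hP hFG hG hx
    rcases F.eq_empty_or_nonempty with h0 | ⟨h, hh⟩
    · rw [h0, Finset.card_empty, Nat.cast_zero]
      positivity
    · exact ((Nat.cast_le.2 (Finset.card_le_card hFG)).trans hG).trans
        (mul_le_mul_of_nonneg_right (hx (hP h hh)) (Nat.cast_nonneg _))
  -- The exponent is at least `3 K`, which exceeds `K + 1 + 8 λ` because `K ≥ 64 λ`.
  have b₁ : (F₁.card : ℝ) ≤ (1 / 2) ^ (8 * lam) * tot := by
    refine hle _ _ _ _ (fun h hh => (Finset.mem_filter.1 hh).2.1)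
      (fun h hh => Finset.mem_filter.2 ⟨Finset.mem_univ _, (Finset.mem_filter.1 hh).2.2⟩)
      (hI.card_few_accepted hd hb (τ := 0) (by omega) hl a k (I.bound + 1)) fun hP => ?_
    have h1 : (3 * I.bound : ℕ) ≤ (n : ℝ) / (2 * (2 ^ l : ℕ)) := by
      rw [le_div_iff₀ (by positivity)]
      have : ((6 * I.bound * 2 ^ l : ℕ) : ℝ) ≤ n := Nat.cast_le.2 hP
      push_cast at this ⊢
      linarith
    calc (2 : ℝ) ^ (I.bound + 1) * Real.exp (-(n / (2 * (2 ^ l : ℕ))))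
        ≤ 2 ^ (I.bound + 1) * (1 / 2) ^ (3 * I.bound) :=
          mul_le_mul_of_nonneg_left (exp_neg_le_half_pow h1) (by positivity)
      _ ≤ 2 ^ (I.bound + 1) * (1 / 2) ^ (I.bound + 1 + 8 * lam) :=
          mul_le_mul_of_nonneg_left (pow_le_pow_of_le_one (by norm_num) (by norm_num) (by omega))
            (by positivity)
      _ = (1 / 2) ^ (8 * lam) := by
          rw [pow_add (1 / 2 : ℝ), ← mul_assoc, ← mul_pow]
          norm_num
  have hdiv : ∀ M : ℕ, n ≤ M * 2 ^ l → ((c * n : ℕ) : ℝ) / ((2 ^ l : ℕ) : ℝ) ≤ (c * M : ℕ) := by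
    intro M hM
    rw [div_le_iff₀ hR]
    have h1 := Nat.mul_le_mul_left c hM
    rw [← mul_assoc] at h1
    exact_mod_cast h1
  -- With `c = (4 * d + 1) ^ d` there are on average at most `16 c λ` sampled candidates, and `64 c
  -- λ ≥ 2 * 16 c λ + 8 λ`. The same scheme with `6 c K` and `13 c K` gives `b₃`.
  have b₂ : (F₂.card : ℝ) ≤ (1 / 2) ^ (8 * lam) * tot := by
    refine hle _ _ _ _ (fun h hh => (Finset.mem_filter.1 hh).2.1)
      (fun h hh => Finset.mem_filter.2 ⟨Finset.mem_univ _, (Finset.mem_filter.1 hh).2.2⟩)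
      (hI.card_many_touched hd hb (τ := 0) (by omega) hl a k (64 * c * lam)) fun hP => ?_
    refine half_pow_mul_exp_le (hdiv _ hP) ?_
    have h1 : lam ≤ c * lam := Nat.le_mul_of_pos_left _ hc1
    have h2 : c * (16 * lam) = 16 * (c * lam) := by ring
    rw [mul_assoc 64, h2]
    omega
  have b₃ : (F₃.card : ℝ) ≤ (1 / 2) ^ (8 * lam) * tot := by
    refine hle _ _ _ _ (fun h hh => (Finset.mem_filter.1 hh).2.1)
      (fun h hh => Finset.mem_filter.2 ⟨Finset.mem_univ _, (Finset.mem_filter.1 hh).2.2⟩)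
      (hI.card_many_touched hd hb (τ := 1) (by omega) hl a k (13 * c * I.bound)) fun hP => ?_
    refine half_pow_mul_exp_le (hdiv _ hP) ?_
    have h1 : I.bound ≤ c * I.bound := Nat.le_mul_of_pos_left _ hc1
    have h2 : c * (6 * I.bound) = 6 * (c * I.bound) := by ring
    rw [mul_assoc 13, h2]
    omega
  have b₄ : (F₄.card : ℝ) ≤ (1 / 2) ^ (8 * lam) * tot := by
    refine hle _ _ _ _ (fun h hh => (Finset.mem_filter.1 hh).2.1)
      (fun h hh => Finset.mem_filter.2 ⟨Finset.mem_univ _, (Finset.mem_filter.1 hh).2.2⟩)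
      (hI.card_none_accepted hd hb hbpos mode I.bound hl a k) fun hP => ?_
    refine exp_neg_le_half_pow ?_
    rw [le_div_iff₀ hR]
    exact_mod_cast hP
  have hcard : (Finset.univ.filter fun h : Fin (2 ^ b) → Fin (2 ^ b) =>
      ¬ I.GoodSample mode (applyHash h) l a k).card ≤ F₁.card + F₂.card + F₃.card + F₄.card := by
    refine (Finset.card_le_card hsub).trans ((Finset.card_union_le _ _).trans ?_)
    refine Nat.add_le_add_right ((Finset.card_union_le _ _).trans ?_) _
    exact Nat.add_le_add_right (Finset.card_union_le _ _) _
  have hcard' : ((Finset.univ.filter fun h : Fin (2 ^ b) → Fin (2 ^ b) =>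
      ¬ I.GoodSample mode (applyHash h) l a k).card : ℝ) ≤
        F₁.card + F₂.card + F₃.card + F₄.card := by exact_mod_cast hcard
  linarith

open Classical in
/-- All the samples are good with probability at least `1 - 1 / m`. -/
theorem Admissible.card_bad (hI : I.Admissible) (hd : 1 ≤ d) (hW : I.WordSize mode b) :
    ((Finset.univ.filter fun h : Fin (2 ^ b) → Fin (2 ^ b) =>
      ¬ ∀ l < I.levels, ∀ k ≤ I.m, ∀ a ≤ k, I.GoodSample mode (applyHash h) l a k).card : ℝ) * I.m ≤
      Fintype.card (Fin (2 ^ b) → Fin (2 ^ b)) := by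
  set tot : ℝ := ((Fintype.card (Fin (2 ^ b) → Fin (2 ^ b)) : ℕ) : ℝ) with htot
  set lam := Nat.clog 2 I.m with hlam
  set q : ℕ := 2 ^ lam with hq
  have hlam1 : 1 ≤ lam := hI.one_le_clog
  have hlev := hW.levels
  set J := Finset.range I.levels ×ˢ (Finset.range (I.m + 1) ×ˢ Finset.range (I.m + 1)) with hJ
  have hsub : (Finset.univ.filter fun h : Fin (2 ^ b) → Fin (2 ^ b) =>
      ¬ ∀ l < I.levels, ∀ k ≤ I.m, ∀ a ≤ k, I.GoodSample mode (applyHash h) l a k) ⊆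
      J.biUnion fun z => Finset.univ.filter fun h : Fin (2 ^ b) → Fin (2 ^ b) =>
        ¬ I.GoodSample mode (applyHash h) z.1 z.2.1 z.2.2 := by
    intro h hh
    have hh' := (Finset.mem_filter.1 hh).2
    push Not at hh'
    obtain ⟨l, hl, k, hk, a, ha, hg⟩ := hh'
    refine Finset.mem_biUnion.2 ⟨(l, a, k), ?_, Finset.mem_filter.2 ⟨Finset.mem_univ _, hg⟩⟩
    simp only [hJ, Finset.mem_product, Finset.mem_range]
    omega
  have h1 : ((Finset.univ.filter fun h : Fin (2 ^ b) → Fin (2 ^ b) =>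
      ¬ ∀ l < I.levels, ∀ k ≤ I.m, ∀ a ≤ k, I.GoodSample mode (applyHash h) l a k).card : ℝ) ≤
      J.card * (4 * (1 / 2) ^ (8 * lam) * tot) := by
    refine (Nat.cast_le.2 ((Finset.card_le_card hsub).trans Finset.card_biUnion_le)).trans ?_
    rw [Nat.cast_sum, ← nsmul_eq_mul]
    refine Finset.sum_le_card_nsmul _ _ _ fun z hz => ?_
    simp only [hJ, Finset.mem_product, Finset.mem_range] at hz
    exact hI.card_not_goodSample hd hW.keys.le (by omega) (by omega) _ _
  have hmq : I.m ≤ q := Nat.le_pow_clog one_lt_two _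
  have hq2 : 2 ≤ q := by
    calc 2 = 2 ^ 1 := rfl
      _ ≤ 2 ^ lam := Nat.pow_le_pow_right (by omega) hlam1
  have hlevq : I.levels ≤ q := by
    have h2 : Nat.clog 2 (min I.m I.w) ≤ lam := Nat.clog_mono_right _ (min_le_left _ _)
    have h3 : lam < 2 ^ lam := Nat.lt_two_pow_self
    unfold Stream.levels
    omega
  -- With `q = 2 ^ λ ≥ m`, four failures for each level and index pair, times `m`, stay below `q ^ 8
  -- = 2 ^ (8 λ)`.
  have hcount : J.card * 4 * I.m ≤ q ^ 8 := by
    have h2 : J.card = I.levels * ((I.m + 1) * (I.m + 1)) := by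
      simp [hJ]
    rw [h2]
    calc I.levels * ((I.m + 1) * (I.m + 1)) * 4 * I.m
        ≤ q * ((q * q) * (q * q)) * (q * q) * q := by
          have h3 : I.m + 1 ≤ q * q := by nlinarith
          have h4 : 4 ≤ q * q := by nlinarith
          gcongr
      _ = q ^ 8 := by ring
  have hq8 : (1 / 2 : ℝ) ^ (8 * lam) = ((q ^ 8 : ℕ) : ℝ)⁻¹ := by
    rw [hq, ← pow_mul, mul_comm 8, one_div, inv_pow]
    norm_cast
  have hpos : (0 : ℝ) < ((q ^ 8 : ℕ) : ℝ) := by positivity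
  calc _ ≤ J.card * (4 * (1 / 2) ^ (8 * lam) * tot) * I.m :=
        mul_le_mul_of_nonneg_right h1 (Nat.cast_nonneg _)
    _ = ((J.card * 4 * I.m : ℕ) : ℝ) * ((q ^ 8 : ℕ) : ℝ)⁻¹ * tot := by
        rw [hq8]; push_cast; ring
    _ ≤ 1 * tot := by
        refine mul_le_mul_of_nonneg_right ?_ (Nat.cast_nonneg _)
        rw [← div_eq_mul_inv, div_le_one hpos]
        exact_mod_cast hcount
    _ = tot := one_mul _

end Stream

theorem randomness_fst (b : ℕ) (S : Set (Fin (2 ^ b) → Fin (2 ^ b))) :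
    randomness b {ω | ω.1 ∈ S} =
      (PMF.uniformOfFintype (Fin (2 ^ b) → Fin (2 ^ b))).toMeasure S := by
  have h : {ω : Randomness b | ω.1 ∈ S} = S ×ˢ Set.univ := by ext ω; simp
  rw [h, randomness, Measure.prod_prod, measure_univ, mul_one]

theorem randomness_bad {I : Stream d} {mode : WindowModel} {b : ℕ} (hd : 1 ≤ d)
    (hI : I.Admissible) (hW : I.WordSize mode b) :
    randomness b {ω | ¬ ∀ l < I.levels, ∀ k ≤ I.m, ∀ a ≤ k,
      I.GoodSample mode (applyHash ω.1) l a k} ≤ 1 / (I.m : ENNReal) := by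
  classical
  have h := hI.card_bad (mode := mode) hd hW
  have h2 := randomness_fst b {h | ¬ ∀ l < I.levels, ∀ k ≤ I.m, ∀ a ≤ k,
      I.GoodSample mode (applyHash h) l a k}
  refine (le_of_eq h2).trans ?_
  rw [PMF.toMeasure_uniformOfFintype_apply _ (Set.toFinite _).measurableSet]
  have hm : (I.m : ENNReal) ≠ 0 := by
    have := hI.two_le_m
    exact_mod_cast (by omega : I.m ≠ 0)
  have ht : ((Fintype.card (Fin (2 ^ b) → Fin (2 ^ b)) : ℕ) : ENNReal) ≠ 0 :=
    Nat.cast_ne_zero.2 Fintype.card_ne_zero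
  rw [ENNReal.div_le_iff ht (ENNReal.natCast_ne_top _), one_div, mul_comm, ← div_eq_mul_inv,
    ENNReal.le_div_iff_mul_le (Or.inl hm) (Or.inl (ENNReal.natCast_ne_top _)),
    Fintype.card_ofFinset]
  exact_mod_cast h

end SlidingSample

end

noncomputable section

namespace SlidingSample

variable {d : ℕ}

/-! ### The output is uniform -/

/-- The index into a list of length `n` given by a random number. -/
def coinIndex (n : ℕ) (x : ℝ) : ℕ := min ⌊(n : ℝ) * x⌋₊ (n - 1)

theorem measurable_coinIndex (n : ℕ) : Measurable (coinIndex n) := by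
  unfold coinIndex
  exact (Nat.measurable_floor.comp (measurable_const_mul _)).min measurable_const

/-- The set lies between the open and the closed interval from `i / n` to `(i + 1) / n`. The minimum
in `coinIndex` only affects the endpoint `1`. -/
theorem volume_coinIndex {n i : ℕ} (hi : i < n) :
    volume {x : unitInterval | coinIndex n x = i} = (n : ENNReal)⁻¹ := by
  have hn : (0 : ℝ) < n := by exact_mod_cast (by omega : 0 < n)
  have hlen : ((i : ℝ) + 1) / n - i / n = (n : ℝ)⁻¹ := by field_simp; ring
  have hvol : ENNReal.ofReal (((i : ℝ) + 1) / n - i / n) = (n : ENNReal)⁻¹ := by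
    rw [hlen, ENNReal.ofReal_inv_of_pos hn, ENNReal.ofReal_natCast]
  change (volume : Measure ↥(unitInterval : Set ℝ)) _ = _
  rw [← volume_image_subtype_coe measurableSet_Icc]
  apply le_antisymm
  · rw [← hvol, ← Real.volume_Icc]
    refine measure_mono ?_
    rintro _ ⟨x, hx, rfl⟩
    have hx0 : (0 : ℝ) ≤ x := x.2.1
    have hx1 : (x : ℝ) ≤ 1 := x.2.2
    have hnx : (0 : ℝ) ≤ n * x := by positivity
    simp only [Set.mem_ofPred_eq, coinIndex] at hx
    refine ⟨?_, ?_⟩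
    · rw [div_le_iff₀ hn, mul_comm]
      exact (Nat.cast_le.2 (by omega : i ≤ ⌊(n : ℝ) * x⌋₊)).trans (Nat.floor_le hnx)
    · rw [le_div_iff₀ hn, mul_comm]
      rcases Nat.lt_or_ge (n - 1) ⌊(n : ℝ) * x⌋₊ with h | h
      · have h1 : i + 1 = n := by omega
        have h2 : (i : ℝ) + 1 = n := by exact_mod_cast h1
        rw [h2]
        exact mul_le_of_le_one_right hn.le hx1
      · have h1 : ⌊(n : ℝ) * x⌋₊ = i := by omega
        have := (Nat.lt_floor_add_one ((n : ℝ) * x)).le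
        rwa [h1] at this
  · rw [← hvol, ← Real.volume_Ioo]
    refine measure_mono fun x hx => ?_
    obtain ⟨h1, h2⟩ := hx
    have hx0 : 0 ≤ x := le_trans (by positivity) h1.le
    have hin : (i : ℝ) + 1 ≤ n := by exact_mod_cast hi
    rw [div_lt_iff₀ hn, mul_comm] at h1
    rw [lt_div_iff₀ hn, mul_comm] at h2
    have hx1 : x ≤ 1 := by
      by_contra hc
      push Not at hc
      nlinarith
    refine ⟨⟨x, hx0, hx1⟩, ?_, rfl⟩
    have hf : ⌊(n : ℝ) * x⌋₊ = i := (Nat.floor_eq_iff (by positivity)).2 ⟨h1.le, h2⟩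
    simp only [Set.mem_ofPred_eq, coinIndex, hf]
    omega

open Classical in
theorem volume_getElem {l : List ℕ} (hl : l.Nodup) (g : ℕ) :
    volume {x : unitInterval | l[coinIndex l.length x]? = some g} =
      if g ∈ l then (l.length : ENNReal)⁻¹ else 0 := by
  split_ifs with h
  · obtain ⟨i, hi, rfl⟩ := List.getElem_of_mem h
    rw [← volume_coinIndex hi]
    congr 1
    ext x
    have hx : coinIndex l.length x < l.length := by unfold coinIndex; omega
    simp only [Set.mem_ofPred_eq]
    rw [List.getElem?_eq_getElem hx, Option.some.injEq, hl.getElem_inj_iff]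
  · have : {x : unitInterval | l[coinIndex l.length x]? = some g} = ∅ := by
      ext x
      simp only [Set.mem_ofPred_eq, Set.mem_empty_iff_false, iff_false]
      intro hx
      exact h (List.mem_of_getElem? hx)
    rw [this, measure_empty]

theorem swap_swap_apply {X : Type*} [DecidableEq X] (a b x : X) :
    Equiv.swap a b (Equiv.swap a b x) = x := by
  rw [← Equiv.trans_apply, Equiv.swap_swap, Equiv.refl_apply]

section Choice

variable (b t : ℕ) (Q : (Fin (2 ^ b) → Fin (2 ^ b)) → List ℕ) (g : ℕ)

theorem measurableSet_coin (h : Fin (2 ^ b) → Fin (2 ^ b)) :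
    MeasurableSet {x : unitInterval | (Q h)[coinIndex (Q h).length x]? = some g} :=
  ((measurable_coinIndex (Q h).length).comp measurable_subtype_coe)
    (MeasurableSet.of_discrete (s := {i : ℕ | (Q h)[i]? = some g}))

theorem measurableSet_slice (h : Fin (2 ^ b) → Fin (2 ^ b)) :
    MeasurableSet (({h} : Set (Fin (2 ^ b) → Fin (2 ^ b))) ×ˢ
      ((Function.eval (t + 1, 0) : (ℕ × ℕ → unitInterval) → unitInterval) ⁻¹'
        {x | (Q h)[coinIndex (Q h).length x]? = some g})) :=
  (measurableSet_singleton h).prod (measurable_pi_apply _ (measurableSet_coin b Q g h))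

theorem getElem_eq_biUnion :
    {ω : Randomness b | (Q ω.1)[coinIndex (Q ω.1).length (ω.2 (t + 1, 0))]? = some g} =
      ⋃ h ∈ (Finset.univ : Finset (Fin (2 ^ b) → Fin (2 ^ b))),
        ({h} : Set (Fin (2 ^ b) → Fin (2 ^ b))) ×ˢ (Function.eval (t + 1, 0) ⁻¹'
          {x | (Q h)[coinIndex (Q h).length x]? = some g}) := by
  ext ω
  simp

theorem measurableSet_getElem : MeasurableSet
    {ω : Randomness b | (Q ω.1)[coinIndex (Q ω.1).length (ω.2 (t + 1, 0))]? = some g} := by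
  rw [getElem_eq_biUnion]
  exact Finset.measurableSet_biUnion _ fun h _ => measurableSet_slice b t Q g h

/-- The distribution of a random choice from a random list. -/
theorem randomness_getElem (hQ : ∀ h, (Q h).Nodup) [∀ h, Decidable (g ∈ Q h)] :
    randomness b {ω | (Q ω.1)[coinIndex (Q ω.1).length (ω.2 (t + 1, 0))]? = some g} =
      ∑ h, (Fintype.card (Fin (2 ^ b) → Fin (2 ^ b)) : ENNReal)⁻¹ *
        if g ∈ Q h then ((Q h).length : ENNReal)⁻¹ else 0 := by
  classical
  rw [getElem_eq_biUnion, measure_biUnion_finset]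
  · refine Finset.sum_congr rfl fun h _ => ?_
    rw [randomness, Measure.prod_prod, PMF.toMeasure_apply_singleton _ _ (measurableSet_singleton h),
      PMF.uniformOfFintype_apply,
      (measurePreserving_eval_infinitePi (fun _ : ℕ × ℕ => (volume : Measure unitInterval))
        (t + 1, 0)).measure_preimage (measurableSet_coin b Q g h).nullMeasurableSet,
      volume_getElem (hQ h)]
    congr
  · intro h _ h' _ hne
    rw [Function.onFun, Set.disjoint_left]
    rintro ω ⟨h1, -⟩ ⟨h2, -⟩
    exact hne (h1.symm.trans h2)
  · exact fun h _ => measurableSet_slice b t Q g h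

end Choice

namespace Stream

variable {I : Stream d} {mode : WindowModel} {b : ℕ}

theorem levelCut_congr {h h' : Fin (2 ^ b) → Fin (2 ^ b)} (hbpos : 0 < b)
    (hh : ∀ κ : Fin (2 ^ b), (κ : ℕ) % 2 ≠ 1 → h κ = h' κ) (l k : ℕ) :
    I.levelCut mode (applyHash h) l k = I.levelCut mode (applyHash h') l k := by
  unfold levelCut topList
  rw [initFlag_congr hbpos hh]

/-- The first level whose cut is not above the window. -/
def queryLevel (I : Stream d) (mode : WindowModel) (H : ℕ → ℕ) (t : ℕ) : ℕ :=
  sInf {l | l < I.levels ∧ I.levelCut mode H l (I.received t) ≤ I.windowStart mode t}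

theorem Admissible.nodup_queryPool (hI : I.Admissible) (H : ℕ → ℕ) (t : ℕ) :
    (I.queryPool mode H t).Nodup := by
  by_cases hex : {l | l < I.levels ∧
      I.levelCut mode H l (I.received t) ≤ I.windowStart mode t}.Nonempty
  · obtain ⟨h1, h2⟩ := Nat.sInf_mem hex
    rw [queryPool_eq h1 h2 fun l' hl' => not_le.1 fun h => Nat.notMem_of_lt_sInf hl'
      ⟨hl'.trans h1, h⟩]
    exact hI.nodup_liveEntries _ _ _
  · rw [queryPool_eq_nil fun l hl => not_le.1 fun h => hex ⟨l, hl, h⟩]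
    exact List.nodup_nil

theorem Admissible.mem_queryPool (hI : I.Admissible) {H : ℕ → ℕ} {t a : ℕ}
    (ha : ∀ j < I.received t, I.windowStart mode t ≤ I.stampSeq mode j ↔ a ≤ j) (j : ℕ) :
    j ∈ I.queryPool mode H t ↔
      (∃ l < I.levels, I.levelCut mode H l (I.received t) ≤ I.windowStart mode t) ∧
      j ∈ lasts I.Near a (I.received t) ∧ I.Accepted H 1 (2 ^ I.queryLevel mode H t)
        (I.levelRep mode I.bound H (2 ^ I.queryLevel mode H t) j) := by
  by_cases hex : {l | l < I.levels ∧
      I.levelCut mode H l (I.received t) ≤ I.windowStart mode t}.Nonempty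
  · obtain ⟨h1, h2⟩ := Nat.sInf_mem hex
    rw [queryPool_eq h1 h2 fun l' hl' => not_le.1 fun h => Nat.notMem_of_lt_sInf hl'
      ⟨hl'.trans h1, h⟩, hI.mem_liveEntries ha h2]
    exact (and_iff_right hex).symm
  · rw [queryPool_eq_nil fun l hl => not_le.1 fun h => hex ⟨l, hl, h⟩]
    simp only [List.not_mem_nil, false_iff, not_and]
    exact fun h => absurd h hex

/-- The hash functions have a symmetry that exchanges two groups of the window. -/
theorem Admissible.exists_swap (hI : I.Admissible) (hd : 1 ≤ d) (hW : I.WordSize mode b) {t a : ℕ}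
    (ha : ∀ j < I.received t, I.windowStart mode t ≤ I.stampSeq mode j ↔ a ≤ j) {g g' : ℕ}
    (hg : g ∈ lasts I.Near a (I.received t)) (hg' : g' ∈ lasts I.Near a (I.received t)) :
    ∃ σ : Equiv.Perm (Fin (2 ^ b) → Fin (2 ^ b)), ∀ h j,
      j ∈ I.queryPool mode (applyHash (σ h)) t ↔
        Equiv.swap g g' j ∈ I.queryPool mode (applyHash h) t := by
  have hbpos : 0 < b := by have := hW.levels; omega
  set κ : (Fin (2 ^ b) → Fin (2 ^ b)) → ℕ → Fin (2 ^ b) := fun h =>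
    I.repWord mode I.bound b (applyHash h) (2 ^ I.queryLevel mode (applyHash h) t) with hκ
  -- The transposition of the two representatives' keys. It depends on the hash function, but only
  -- through its even values, and it moves only odd words.
  set τ : (Fin (2 ^ b) → Fin (2 ^ b)) → Equiv.Perm (Fin (2 ^ b)) := fun h =>
    Equiv.swap (κ h g) (κ h g') with hτ
  have heven : ∀ h (x : Fin (2 ^ b)), (x : ℕ) % 2 ≠ 1 → (h ∘ τ h) x = h x := by
    intro h x hx
    rw [Function.comp_apply, hτ]
    congr 1
    refine Equiv.swap_apply_of_ne_of_ne ?_ ?_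
    · rintro rfl
      exact hx (repWord_odd hbpos _ _ _ _ _)
    · rintro rfl
      exact hx (repWord_odd hbpos _ _ _ _ _)
  have hcut : ∀ h l, I.levelCut mode (applyHash (h ∘ τ h)) l (I.received t) =
      I.levelCut mode (applyHash h) l (I.received t) := fun h l =>
    levelCut_congr hbpos (heven h) l _
  have hlev : ∀ h, I.queryLevel mode (applyHash (h ∘ τ h)) t = I.queryLevel mode (applyHash h) t := by
    intro h
    unfold queryLevel
    simp_rw [hcut]
  have hrep : ∀ h, κ (h ∘ τ h) = κ h := by
    intro h
    funext j
    simp only [hκ, repWord]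
    rw [hlev, levelRep_congr hbpos (heven h)]
  -- The transposition computed from the modified hash function is the same one, so applying the
  -- modification twice undoes it. In particular it is a bijection.
  have hinv : Function.Involutive fun h => h ∘ τ h := by
    intro h
    have h1 : τ (h ∘ τ h) = τ h := by
      change Equiv.swap (κ (h ∘ τ h) g) (κ (h ∘ τ h) g') = _
      rw [hrep]
    funext x
    simp only [Function.comp_apply, h1]
    congr 1
    exact swap_swap_apply _ _ _
  refine ⟨hinv.toPerm, fun h j => ?_⟩
  change j ∈ I.queryPool mode (applyHash (h ∘ τ h)) t ↔ _
  rw [hI.mem_queryPool ha, hI.mem_queryPool ha]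
  simp_rw [hcut]
  refine and_congr_right fun _ => ?_
  have hacc : ∀ (h : Fin (2 ^ b) → Fin (2 ^ b)) i,
      I.Accepted (applyHash h) 1 (2 ^ I.queryLevel mode (applyHash h) t)
        (I.levelRep mode I.bound (applyHash h) (2 ^ I.queryLevel mode (applyHash h) t) i) ↔
      2 ^ I.queryLevel mode (applyHash h) t ∣ (h (κ h i) : ℕ) := fun _ _ => Iff.rfl
  rw [hacc, hacc, hlev, hrep]
  have hmem : Equiv.swap g g' j ∈ lasts I.Near a (I.received t) ↔
      j ∈ lasts I.Near a (I.received t) := by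
    by_cases h1 : j = g
    · subst h1; simp [hg, hg']
    by_cases h2 : j = g'
    · subst h2; simp [hg, hg']
    rw [Equiv.swap_apply_of_ne_of_ne h1 h2]
  rw [hmem]
  refine and_congr_right fun hj => ?_
  have hinj := hI.repWord_injOn hd hW.keys.le mode I.bound (applyHash h)
    (2 ^ I.queryLevel mode (applyHash h) t) a (I.received t)
  -- Distinct groups have distinct representative keys, so the transposition of keys corresponds to
  -- the transposition of `g` and `g'` on the last points.
  have hsw : τ h (κ h j) = κ h (Equiv.swap g g' j) := by
    by_cases h1 : j = g
    · subst h1; simp [hτ]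
    by_cases h2 : j = g'
    · subst h2; simp [hτ]
    rw [Equiv.swap_apply_of_ne_of_ne h1 h2]
    exact Equiv.swap_apply_of_ne_of_ne (fun h => h1 (hinj hj hg h)) (fun h => h2 (hinj hj hg' h))
  rw [Function.comp_apply, hsw]

end Stream

/-- The events that group `g` is output are disjoint, their union is the event of an output, and the
symmetry of `exists_swap` makes them equally likely. -/
theorem sampler_uniformOutput {I : Stream d} {mode : WindowModel} {b : ℕ} (hd : 1 ≤ d)
    (hI : I.Admissible) (hW : I.WordSize mode b) {t : ℕ} (ht : t ≤ I.T) :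
    UniformOutput (sampler d) I mode b t := by
  classical
  obtain ⟨a, -, ha⟩ := exists_index_threshold (hI.stampSeq_strictMono mode) (I.windowStart mode t)
    (I.received t)
  obtain ⟨hpart, hinj, hgroup⟩ := hI.naturalPartition_window mode t ha
  set S := lasts I.Near a (I.received t) with hS
  set Q : (Fin (2 ^ b) → Fin (2 ^ b)) → List ℕ := fun h => I.queryPool mode (applyHash h) t with hQ
  have hQn : ∀ h, (Q h).Nodup := fun h => hI.nodup_queryPool _ _
  have hQS : ∀ h, ∀ j ∈ Q h, j ∈ S := fun h j hj => ((hI.mem_queryPool ha j).1 hj).2.1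
  set V : ℕ → Set (Randomness b) := fun g =>
    {ω | (Q ω.1)[coinIndex (Q ω.1).length (ω.2 (t + 1, 0))]? = some g} with hV
  have hout : ∀ ω u, Outputs (sampler d) I mode b ω t u ↔ ∃ j, ω ∈ V j ∧ I.pt j = u := fun ω u =>
    outputs_sampler_iff hd hI hW ω ht u
  have hVS : ∀ ω j, ω ∈ V j → j ∈ S := fun ω j h => hQS _ _ (List.mem_of_getElem? h)
  have heq : ∀ g ∈ S, ∀ g' ∈ S, randomness b (V g) = randomness b (V g') := by
    intro g hg g' hg'
    obtain ⟨σ, hσ⟩ := hI.exists_swap hd hW ha hg hg'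
    rw [hV, randomness_getElem b t Q _ hQn, randomness_getElem b t Q _ hQn]
    -- Reindexing by the symmetry matches the two sums term by term: it turns membership of `g'`
    -- into membership of `g` and keeps the size of the pool.
    rw [← Equiv.sum_comp σ (fun h => (Fintype.card (Fin (2 ^ b) → Fin (2 ^ b)) : ENNReal)⁻¹ *
      if g' ∈ Q h then ((Q h).length : ENNReal)⁻¹ else 0)]
    refine Finset.sum_congr rfl fun h _ => ?_
    have h1 : g' ∈ Q (σ h) ↔ g ∈ Q h := by
      have := hσ h g'
      rwa [Equiv.swap_apply_right] at this
    have h2 : (Q (σ h)).length = (Q h).length := by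
      rw [← List.toFinset_card_of_nodup (hQn _), ← List.toFinset_card_of_nodup (hQn h)]
      refine Finset.card_bij (fun j _ => Equiv.swap g g' j) ?_ ?_ ?_
      · intro j hj
        rw [List.mem_toFinset] at hj ⊢
        exact (hσ h j).1 hj
      · exact fun i _ j _ hij => (Equiv.swap g g').injective hij
      · intro j hj
        refine ⟨Equiv.swap g g' j, ?_, swap_swap_apply _ _ _⟩
        rw [List.mem_toFinset] at hj ⊢
        refine (hσ h _).2 ?_
        rwa [swap_swap_apply]
    simp only [h1, h2]
  have hVm : ∀ g, MeasurableSet (V g) := fun g => measurableSet_getElem b t Q g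
  have hdisj : ∀ g g', g ≠ g' → Disjoint (V g) (V g') := fun g g' hne =>
    Set.disjoint_left.2 fun ω h h' => hne (Option.some.inj (h.symm.trans h'))
  intro G hG
  rw [hpart] at hG ⊢
  obtain ⟨g, hg, rfl⟩ := hG
  have h1 : {ω : Randomness b | ∃ u ∈ group I.α (I.window mode t) (I.pt g),
      Outputs (sampler d) I mode b ω t u} = V g := by
    ext ω
    constructor
    · rintro ⟨u, hu, ho⟩
      obtain ⟨j, hj, rfl⟩ := (hout ω u).1 ho
      have := (hgroup g hg j (hVS ω j hj)).1 hu
      rwa [this] at hj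
    · intro h
      exact ⟨I.pt g, (hgroup g hg g hg).2 rfl, (hout ω _).2 ⟨g, h, rfl⟩⟩
  have h2 : {ω : Randomness b | ∃ u, Outputs (sampler d) I mode b ω t u} = ⋃ j ∈ S, V j := by
    ext ω
    simp only [Set.mem_ofPred_eq, Set.mem_iUnion, exists_prop]
    constructor
    · rintro ⟨u, ho⟩
      obtain ⟨j, hj, -⟩ := (hout ω u).1 ho
      exact ⟨j, hVS ω j hj, hj⟩
    · rintro ⟨j, -, hj⟩
      exact ⟨_, (hout ω _).2 ⟨j, hj, rfl⟩⟩
  have hne : (S.card : ENNReal) ≠ 0 := by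
    exact_mod_cast (Finset.card_pos.2 ⟨g, hg⟩).ne'
  rw [h1, h2, Set.InjOn.ncard_image hinj, Set.ncard_coe_finset,
    measure_biUnion_finset (fun j _ j' _ h => hdisj j j' h) fun j _ => hVm j,
    Finset.sum_congr rfl fun j hj => heq j hj g hg, Finset.sum_const, nsmul_eq_mul, mul_comm,
    ENNReal.mul_div_cancel_right hne (ENNReal.natCast_ne_top _)]

end SlidingSample

end

noncomputable section

namespace SlidingSample

/-! ### Constants -/

/-- The constant in the word length. -/
def bitsFactor (d : ℕ) : ℕ := 64 * ((4 * d + 1) ^ d) ^ 2 + (1 + 2 * d) * d + 10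

/-- Let `S` be the sum in `wordBits` and `q ≥ S` the power of two there. The words have `q ^ c`
values, and each requirement except that on `levels` is at most a power of `q` with exponent
depending on `d` alone; constants are absorbed by `n < q ^ n`. The number of levels is compared with
the word length directly. -/
theorem Stream.Admissible.wordSize {d : ℕ} {I : Stream d} (hI : I.Admissible)
    (mode : WindowModel) : I.WordSize mode (I.wordBits mode (bitsFactor d)) := by
  set S := I.m + I.w + I.gridSize + I.clock mode I.T with hS
  set q := 2 ^ Nat.clog 2 S with hq
  set c := bitsFactor d with hc
  have hbits : 2 ^ I.wordBits mode c = q ^ c := by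
    rw [Stream.wordBits, ← hS, hq, ← pow_mul, mul_comm]
  have hm := hI.two_le_m
  have hw := hI.two_le_w
  have hg : 1 ≤ I.gridSize := by unfold Stream.gridSize; omega
  have hSq : S ≤ q := Nat.le_pow_clog one_lt_two S
  have hclog : 3 ≤ Nat.clog 2 S := by
    have : 2 < Nat.clog 2 S := (Nat.lt_clog_iff_pow_lt one_lt_two).2 (by omega)
    omega
  have hq8 : 8 ≤ q := by
    calc 8 = 2 ^ 3 := rfl
      _ ≤ 2 ^ Nat.clog 2 S := Nat.pow_le_pow_right (by omega) hclog
  have hpow : ∀ {e : ℕ}, e ≤ c → q ^ e ≤ q ^ c := fun h => Nat.pow_le_pow_right (by omega) h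
  have hlev : I.levels ≤ I.m + 1 := by
    have h1 : Nat.clog 2 (min I.m I.w) ≤ min I.m I.w :=
      Nat.clog_le_of_le_pow Nat.lt_two_pow_self.le
    have := min_le_left I.m I.w
    unfold Stream.levels
    omega
  have hlevq : I.levels ≤ q := by omega
  have hq1 : q < q ^ c := by
    calc q = q ^ 1 := (pow_one q).symm
      _ < q ^ c := Nat.pow_lt_pow_right (by omega) (by unfold bitsFactor at hc; omega)
  have hclk : I.clock mode I.T + 1 < q := by omega
  have hconst : 64 * ((4 * d + 1) ^ d) ^ 2 < q ^ (64 * ((4 * d + 1) ^ d) ^ 2) :=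
    Nat.lt_pow_self (by omega)
  constructor
  · rw [hbits]
    refine le_trans ?_ (hpow (e := 2) (by unfold bitsFactor at hc; omega))
    nlinarith
  · rw [hbits]
    have h1 : I.base ≤ q ^ (1 + 2 * d) := by
      have h2 : 2 * d + 1 ≤ q ^ (2 * d) := Nat.lt_pow_self (by omega)
      have h3 : I.gridSize ≤ q := by omega
      calc I.base = I.gridSize + 2 * d := rfl
        _ ≤ I.gridSize * (2 * d + 1) := by nlinarith
        _ ≤ q * q ^ (2 * d) := Nat.mul_le_mul h3 h2
        _ = q ^ (1 + 2 * d) := by rw [pow_add, pow_one]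
    calc 2 * I.base ^ d < q * I.base ^ d := by
          refine Nat.mul_lt_mul_of_pos_right (by omega) (Nat.pow_pos ?_)
          unfold Stream.base
          omega
      _ ≤ q * (q ^ (1 + 2 * d)) ^ d := Nat.mul_le_mul_left _ (Nat.pow_le_pow_left h1 _)
      _ = q ^ (1 + (1 + 2 * d) * d) := by rw [← pow_mul, pow_add, pow_one]
      _ ≤ q ^ c := hpow (by unfold bitsFactor at hc; omega)
  · have h1 : Nat.clog 2 (min I.m I.w) ≤ Nat.clog 2 S :=
      Nat.clog_mono_right _ ((min_le_left _ _).trans (by omega))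
    have h2 : 10 * Nat.clog 2 S ≤ c * Nat.clog 2 S :=
      Nat.mul_le_mul_right _ (by unfold bitsFactor at hc; omega)
    change Nat.clog 2 (min I.m I.w) + 1 < c * Nat.clog 2 S
    omega
  · rw [hbits]
    refine le_trans ?_ (hpow (e := 2) (by unfold bitsFactor at hc; omega))
    nlinarith
  · rw [hbits]
    exact hconst.trans_le (hpow (by unfold bitsFactor at hc; omega))
  · rw [hbits]
    have h1 : Nat.clog 2 I.m ≤ q :=
      (Nat.clog_le_of_le_pow Nat.lt_two_pow_self.le).trans (by omega)
    calc I.bound * (2 * I.levels)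
        = 64 * ((4 * d + 1) ^ d) ^ 2 * (Nat.clog 2 I.m * (2 * I.levels)) := by
          unfold Stream.bound; ring
      _ ≤ 64 * ((4 * d + 1) ^ d) ^ 2 * (q * (q * q)) :=
          Nat.mul_le_mul_left _ (Nat.mul_le_mul h1 (Nat.mul_le_mul (by omega) hlevq))
      _ < q ^ (64 * ((4 * d + 1) ^ d) ^ 2) * (q * (q * q)) :=
          Nat.mul_lt_mul_of_pos_right hconst (by positivity)
      _ = q ^ (64 * ((4 * d + 1) ^ d) ^ 2 + 3) := by ring
      _ ≤ q ^ c := hpow (by unfold bitsFactor at hc; omega)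
  · rw [hbits]
    refine le_trans ?_ (hpow (e := 4) (by unfold bitsFactor at hc; omega))
    have h1 : 2 * I.levels * (I.m + 2) ≤ 2 * q * q :=
      Nat.mul_le_mul (by omega) (by omega)
    have h2 : 8 * 8 * (q * q) ≤ q * q * (q * q) := by
      have : 8 * 8 ≤ q * q := Nat.mul_le_mul hq8 hq8
      exact Nat.mul_le_mul_right _ this
    have h3 : q ^ 4 = q * q * (q * q) := by ring
    nlinarith
  · intro k hk
    rw [hbits]
    have h1 := hI.stamp_le_clock mode I.T (i := k) (by rw [hI.received_T]; exact hk)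
    omega
  · rw [hbits]
    omega

/-- The bound `⌈log₂ n⌉ ≤ log₂ n + 1 ≤ 2 log₂ n` suffices, as `2 / log 2 < 3`. -/
theorem clog_le_three_mul_log {n : ℕ} (hn : 2 ≤ n) : (Nat.clog 2 n : ℝ) ≤ 3 * Real.log n := by
  have hpos : 0 < Nat.clog 2 n := Nat.clog_pos one_lt_two hn
  have h1 : 2 ^ (Nat.clog 2 n - 1) < n :=
    (Nat.lt_clog_iff_pow_lt one_lt_two).1 (by omega)
  have h2 : ((Nat.clog 2 n - 1 : ℕ) : ℝ) * Real.log 2 ≤ Real.log n := by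
    rw [← Real.log_pow]
    exact Real.log_le_log (by positivity) (by exact_mod_cast h1.le)
  have h3 : Real.log 2 ≤ Real.log n := Real.log_le_log (by norm_num) (by exact_mod_cast hn)
  rw [Nat.cast_sub hpos, Nat.cast_one] at h2
  have h4 := Real.log_two_gt_d9
  have h5 : (0 : ℝ) ≤ Nat.clog 2 n := Nat.cast_nonneg _
  nlinarith

/-- The constant in the bounds on the lengths of the lists. -/
def listFactor (d : ℕ) : ℕ := 832 * ((4 * d + 1) ^ d) ^ 4 + 2

/-- The constant in the bounds on space and time. -/
def costFactor (d : ℕ) : ℕ :=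
  9 * ((4 + d) * (8 + 4 * listFactor d) +
    (2 * (hashCost d 0 + hashCost d 1 + 610 + 160 * listFactor d) + 200))

namespace Stream.Admissible

variable {d : ℕ} {I : Stream d}

theorem le_costFactor (hI : I.Admissible) {n F : ℕ}
    (hn : n ≤ F * (Nat.clog 2 I.w * Nat.clog 2 I.m)) (hF : 9 * F ≤ costFactor d) :
    (n : ℝ) ≤ costFactor d * (Real.log I.w * Real.log I.m) := by
  have h1 := clog_le_three_mul_log hI.two_le_w
  have h2 := clog_le_three_mul_log hI.two_le_m
  have h3 : 0 ≤ Real.log I.w := Real.log_natCast_nonneg _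
  have h4 : 0 ≤ Real.log I.m := Real.log_natCast_nonneg _
  have hF' : (9 : ℝ) * F ≤ costFactor d := by exact_mod_cast hF
  calc (n : ℝ) ≤ F * (Nat.clog 2 I.w * Nat.clog 2 I.m) := by exact_mod_cast hn
    -- The factor `9` in `costFactor` comes from replacing two binary logarithms by natural ones.
    _ ≤ F * (3 * Real.log I.w * (3 * Real.log I.m)) := by gcongr
    _ = 9 * F * (Real.log I.w * Real.log I.m) := by ring
    _ ≤ costFactor d * (Real.log I.w * Real.log I.m) := by gcongr

theorem clog_bounds (hI : I.Admissible) {N : ℕ}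
    (hN : N ≤ 13 * ((4 * d + 1) ^ d) ^ 2 * I.bound) :
    1 ≤ Nat.clog 2 I.w ∧ I.levels ≤ 2 * Nat.clog 2 I.w ∧ N + 2 ≤ listFactor d * Nat.clog 2 I.m := by
  have hw : 1 ≤ Nat.clog 2 I.w := Nat.clog_pos one_lt_two hI.two_le_w
  have hm := hI.one_le_clog
  refine ⟨hw, ?_, ?_⟩
  · have : Nat.clog 2 (min I.m I.w) ≤ Nat.clog 2 I.w := Nat.clog_mono_right _ (min_le_right _ _)
    unfold levels
    omega
  · calc N + 2 ≤ 13 * ((4 * d + 1) ^ d) ^ 2 * I.bound + 2 * Nat.clog 2 I.m := by omega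
      -- Here `13 * 64 = 832`, and the two squares of `(4 * d + 1) ^ d` combine to its fourth power.
      _ = listFactor d * Nat.clog 2 I.m := by unfold listFactor bound; ring

theorem cells_le (hI : I.Admissible) {N : ℕ} (hN : N ≤ 13 * ((4 * d + 1) ^ d) ^ 2 * I.bound) :
    (4 + d) * I.cells N ≤
      (4 + d) * (8 + 4 * listFactor d) * (Nat.clog 2 I.w * Nat.clog 2 I.m) := by
  obtain ⟨hw, hlev, hN'⟩ := hI.clog_bounds hN
  have hm := hI.one_le_clog
  rw [mul_assoc]
  refine Nat.mul_le_mul_left _ ?_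
  have h1 : 2 * I.levels * (N + 2) ≤
      2 * (2 * Nat.clog 2 I.w) * (listFactor d * Nat.clog 2 I.m) := by gcongr
  have h2 : 1 ≤ Nat.clog 2 I.w * Nat.clog 2 I.m := Nat.mul_pos hw hm
  have h3 : 2 * (2 * Nat.clog 2 I.w) * (listFactor d * Nat.clog 2 I.m) =
      4 * listFactor d * (Nat.clog 2 I.w * Nat.clog 2 I.m) := by ring
  unfold cells
  rw [add_mul]
  omega

theorem updateCost_le (hI : I.Admissible) {N : ℕ}
    (hN : N ≤ 13 * ((4 * d + 1) ^ d) ^ 2 * I.bound) :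
    updateCost I N ≤ (2 * (hashCost d 0 + hashCost d 1 + 610 + 160 * listFactor d) + 200) *
      (Nat.clog 2 I.w * Nat.clog 2 I.m) := by
  obtain ⟨hw, hlev, hN'⟩ := hI.clog_bounds hN
  have hm := hI.one_le_clog
  set u := Nat.clog 2 I.w
  set lam := Nat.clog 2 I.m
  set e := hashCost d 0 + hashCost d 1 + 610
  have h1 : levelCost d N + 10 ≤ (e + 160 * listFactor d) * lam := by
    have h2 : e ≤ e * lam := Nat.le_mul_of_pos_right _ hm
    have h3 : levelCost d N + 10 = e + 160 * N := by
      unfold levelCost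
      omega
    have h4 : (e + 160 * listFactor d) * lam = e * lam + 160 * (listFactor d * lam) := by ring
    rw [h3, h4]
    omega
  have h5 : I.levels * (levelCost d N + 10) ≤ 2 * u * ((e + 160 * listFactor d) * lam) :=
    Nat.mul_le_mul hlev h1
  have h6 : u ≤ u * lam := Nat.le_mul_of_pos_right _ hm
  have h7 : lam ≤ u * lam := Nat.le_mul_of_pos_left _ hw
  have h8 : (2 * (e + 160 * listFactor d) + 200) * (u * lam) =
      2 * u * ((e + 160 * listFactor d) * lam) + 200 * (u * lam) := by ring
  unfold updateCost
  rw [h8]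
  omega

end Stream.Admissible

end SlidingSample

end

theorem mainTheorem2 (d : ℕ) (hd : 1 ≤ d) :
    ∃ (A : SlidingSample.Algorithm d) (c C : ℕ),
      ∀ (I : SlidingSample.Stream d), I.Admissible → ∀ mode : SlidingSample.WindowModel,
        (∀ ω, SlidingSample.Halts A I mode (I.wordBits mode c) ω) ∧
        SlidingSample.randomness (I.wordBits mode c)
            {ω | ¬ (SlidingSample.AlwaysOutputs A I mode (I.wordBits mode c) ω ∧
              SlidingSample.SpaceAtMost A I mode (I.wordBits mode c) ω
                (C * (Real.log I.w * Real.log I.m)) ∧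
              SlidingSample.AmortizedTimeAtMost A I mode (I.wordBits mode c) ω
                (C * (Real.log I.w * Real.log I.m)))} ≤ 1 / (I.m : ENNReal) ∧
        ∀ t ≤ I.T, (I.window mode t).Nonempty →
          SlidingSample.UniformOutput A I mode (I.wordBits mode c) t := by
  refine ⟨SlidingSample.sampler d, SlidingSample.bitsFactor d, SlidingSample.costFactor d,
    fun I hI mode => ?_⟩
  have hW := hI.wordSize mode
  refine ⟨SlidingSample.sampler_halts hd hI hW, ?_,
    fun t ht _ => SlidingSample.sampler_uniformOutput hd hI hW ht⟩
  -- All three high-probability claims hold whenever all samples are good, so one bad event covers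
  -- them.
  refine le_trans (MeasureTheory.measure_mono ?_) (SlidingSample.randomness_bad hd hI hW)
  refine fun ω hω hgood => hω ?_
  have hN := min_le_right I.m (13 * ((4 * d + 1) ^ d) ^ 2 * I.bound)
  exact ⟨SlidingSample.sampler_alwaysOutputs hd hI hW ω hgood,
    SlidingSample.sampler_space hd hI hW ω (min_le_left _ _) (hI.listsAtMost hgood)
      (hI.le_costFactor (hI.cells_le hN) (by unfold SlidingSample.costFactor; omega)),
    SlidingSample.sampler_time hd hI hW ω (min_le_left _ _) (hI.listsAtMost hgood)
      (hI.le_costFactor (hI.updateCost_le hN) (by unfold SlidingSample.costFactor; omega))⟩
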